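/- Work in the Hilbert space $L^2[0,\infty[$ of complex-valued functions. For $\alpha\in\mathbb{C}$ let \[ L_\alpha=-\partial_x^2+\Big(-\frac14+\alpha\Big)\frac1{x^2}. \] Let $L_\alpha^{\min}$ be the closure of $L_\alpha$ restricted to $C_{\rm c}^\infty]0,\infty[$, and let $L_\alpha^{\max}$ be the operator $L_\alpha$ (in the sense of distributions on $]0,\infty[$) with domain $\{f\in L^2[0,\infty[\;:\;L_\alpha f\in L^2[0,\infty[\}$. Fix a cutoff $\xi\in C_{\rm c}^\infty(\mathbb{R})$, real-valued, with $\xi=1$ in a neighbourhood of $0$. For $\operatorname{Re} m>-1$ let $H_m$ be the restriction of $L_{m^2}^{\max}$ to $\operatorname{Dom}L_{m^2}^{\min}+\mathbb{C}\,x^{\frac12+m}\xi$. Let $(U_\tau f)(x)=e^{\tau/2}f(e^\tau x)$, $\tau\in\mathbb{R}$; an operator $B$ is called homogeneous of degree $\nu\in\mathbb{R}$ if $U_\tau BU_\tau^{-1}=e^{\nu\tau}B$ for all $\tau\in\mathbb{R}$, and homogeneous if this holds for some $\nu$. An operator is Hermitian if it is densely defined and symmetric. The Friedrichs extension of a nonnegative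 Hermitian operator $T$ is its self-adjoint extension obtained by restricting $T^*$ to the domain of the closure of the quadratic form $\langle f, Tf\rangle$; the Krein extension of $T$ is its smallest nonnegative self-adjoint extension, in the sense of the order of quadratic forms. The Dirichlet and Neumann Laplacians on the half-line are $-\partial_x^2$ on $\{f\in H^2]0,\infty[\;:\;f(0)=0\}$ and on $\{f\in H^2]0,\infty[\;:\;f'(0)=0\}$, respectively. Then, for every such $\xi$ and for real $\alpha$: 1. For $\alpha\ge 1$, $L_\alpha^{\min}=H_{\sqrt\alpha}$, and $L_\alpha$ is essentially self-adjoint on $C_{\rm c}^\infty]0,\infty[$. 2. For $\alpha<1$, $L_\alpha^{\min}$ is Hermitian, but $L_\alpha$ is not essentially self-adjoint on $C_{\rm c}^\infty]0,\infty[$; the deficiency indices of $L_\alpha^{\min}$ are $(1,1)$. 3. For $0\le\alpha<1$, $L_\alpha^{\min}$ is nonnegative, $H_{\sqrt\alpha}$ is its Friedrichs extension and $H_{-\sqrt\alpha}$ is its Krein extension. 4. $H_{\frac12}$ is the Dirichlet Laplacian and $H_{-\frac12}$ is the Neumann Laplacian on the half-line. 5. For $\alpha<0$, $L_\alpha^{\min}$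 has no homogeneous self-adjoint extension. -/

import Mathlib

open Set Filter Topology MeasureTheory
open scoped ContDiff InnerProductSpace LinearPMap

noncomputable section

namespace InverseSquare

/-! ### Symmetric operators and their extensions -/

section Abstract

variable {E : Type*} [NormedAddCommGroup E] [InnerProductSpace ℂ E]

/-- Hermitian (symmetric) operators: densely defined, `⟪T f, g⟫ = ⟪f, T g⟫` on the domain. -/
def IsHermitianOp (T : E →ₗ.[ℂ] E) : Prop :=
  Dense (T.domain : Set E) ∧ T.IsFormalAdjoint T

/-- The real part of the quadratic form `⟪f, T f⟫` on the domain of `T`. -/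
def quadForm (T : E →ₗ.[ℂ] E) (f : T.domain) : ℝ :=
  RCLike.re ⟪(f : E), T f⟫_ℂ

/-- Nonnegative operators: Hermitian with `⟪f, T f⟫ ≥ 0`. -/
def IsNonnegOp (T : E →ₗ.[ℂ] E) : Prop :=
  IsHermitianOp T ∧ ∀ f : T.domain, 0 ≤ quadForm T f

/-- `f` lies in the domain of the closure of the quadratic form of `T`, and the closed form takes
the value `q` at `f`. -/
def IsFormLimit (T : E →ₗ.[ℂ] E) (f : E) (q : ℝ) : Prop :=
  ∃ u : ℕ → T.domain,
    Tendsto (fun n => (u n : E)) atTop (𝓝 f) ∧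
    Tendsto (fun p : ℕ × ℕ => quadForm T (u p.1 - u p.2)) atTop (𝓝 0) ∧
    Tendsto (fun n => quadForm T (u n)) atTop (𝓝 q)

/-- The form domain: the domain of the closure of the quadratic form of `T`. -/
def formDomain (T : E →ₗ.[ℂ] E) : Set E :=
  {f | ∃ q : ℝ, IsFormLimit T f q}

/-- The order `A ≤ B` between nonnegative self-adjoint operators, in the sense of forms: the form
domain of `B` is contained in that of `A`, and there the form of `A` is at most that of `B`. -/
def FormLE (A B : E →ₗ.[ℂ] E) : Prop :=
  ∀ (f : E) (s : ℝ), IsFormLimit B f s → ∃ r : ℝ, IsFormLimit A f r ∧ r ≤ s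

variable [CompleteSpace E]

/-- `T` is essentially self-adjoint (on its domain): its closure is self-adjoint. -/
def IsEssentiallySelfAdjoint (T : E →ₗ.[ℂ] E) : Prop :=
  IsSelfAdjoint T.closure

/-- The eigenspace `Ker (T† - z)`, i.e. the space of all `f` with `(f, z f)` in the graph of the
adjoint. -/
def deficiencySpace (T : E →ₗ.[ℂ] E) (z : ℂ) : Submodule ℂ E :=
  T†.graph.comap (LinearMap.id.prod (z • LinearMap.id))

/-- The deficiency indices `(dim Ker (T† - i), dim Ker (T† + i))`. -/
def deficiencyIndices (T : E →ₗ.[ℂ] E) : Cardinal × Cardinal :=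
  (Module.rank ℂ (deficiencySpace T Complex.I), Module.rank ℂ (deficiencySpace T (-Complex.I)))

/-- `F` is the Friedrichs extension of the nonnegative operator `T`: the self-adjoint extension
that is the restriction of the adjoint of `T` to the form domain of `T`. -/
def IsFriedrichsExtension (T F : E →ₗ.[ℂ] E) : Prop :=
  IsNonnegOp T ∧ IsSelfAdjoint F ∧ T ≤ F ∧
    ∀ f : E, f ∈ F.domain ↔ f ∈ T†.domain ∧ f ∈ formDomain T

/-- `K` is the Krein extension of the nonnegative operator `T`: the smallest nonnegative
self-adjoint extension of `T`. -/
def IsKreinExtension (T K : E →ₗ.[ℂ] E) : Prop :=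
  IsNonnegOp T ∧ IsSelfAdjoint K ∧ IsNonnegOp K ∧ T ≤ K ∧
    ∀ S : E →ₗ.[ℂ] E, IsSelfAdjoint S → IsNonnegOp S → T ≤ S → FormLE K S

end Abstract

/-! ### The half-line -/

/-- Lebesgue measure on the half-line. -/
abbrev halfLine : Measure ℝ := volume.restrict (Ioi 0)

/-- The Hilbert space `L²[0,∞[`. -/
abbrev L2 : Type := Lp ℂ 2 halfLine

/-- The space `C_c^∞]0,∞[`, each function being extended by zero to the real line. -/
structure IsTest (φ : ℝ → ℂ) : Prop where
  smooth : ContDiff ℝ ∞ φ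
  compact : HasCompactSupport φ
  supp : tsupport φ ⊆ Ioi 0

/-- The differential expression `-φ'' + (-1/4 + α) x⁻² φ`. -/
def expr (α : ℂ) (φ : ℝ → ℂ) (x : ℝ) : ℂ :=
  -deriv (deriv φ) x + (-1 / 4 + α) * (1 / (x : ℂ) ^ 2) * φ x

theorem IsTest.add {φ ψ : ℝ → ℂ} (h : IsTest φ) (k : IsTest ψ) : IsTest (φ + ψ) :=
  ⟨h.smooth.add k.smooth, h.compact.add k.compact,
    (tsupport_add φ ψ).trans (union_subset h.supp k.supp)⟩

theorem IsTest.smul {φ : ℝ → ℂ} (h : IsTest φ) (c : ℂ) : IsTest (c • φ) :=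
  ⟨h.smooth.const_smul c, h.compact.smul_left (f := fun _ => c),
    (tsupport_smul_subset_right (fun _ => c) φ).trans h.supp⟩

theorem isTest_zero : IsTest 0 :=
  ⟨contDiff_const, HasCompactSupport.zero, by simp [tsupport]⟩

theorem IsTest.deriv {φ : ℝ → ℂ} (h : IsTest φ) : IsTest (deriv φ) :=
  ⟨(contDiff_infty_iff_deriv.1 h.smooth).2, h.compact.deriv,
    tsupport_deriv_subset.trans h.supp⟩

theorem IsTest.differentiable {φ : ℝ → ℂ} (h : IsTest φ) : Differentiable ℝ φ :=
  h.smooth.differentiable (by simp)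

theorem expr_add (α : ℂ) {φ ψ : ℝ → ℂ} (h : IsTest φ) (k : IsTest ψ) :
    expr α (φ + ψ) = expr α φ + expr α ψ := by
  have h1 : _root_.deriv (φ + ψ) = _root_.deriv φ + _root_.deriv ψ := by
    ext x; exact deriv_add (h.differentiable x) (k.differentiable x)
  ext x
  have h2 := deriv_add (h.deriv.differentiable x) (k.deriv.differentiable x)
  simp only [expr, h1, h2, Pi.add_apply]
  ring

theorem expr_smul (α c : ℂ) {φ : ℝ → ℂ} (h : IsTest φ) : expr α (c • φ) = c • expr α φ := by
  have h1 : _root_.deriv (c • φ) = c • _root_.deriv φ := by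
    ext x; exact deriv_const_smul c (h.differentiable x)
  ext x
  have h2 := deriv_const_smul c (h.deriv.differentiable x)
  simp only [expr, h1, h2, Pi.smul_apply, smul_eq_mul]
  ring

theorem expr_zero (α : ℂ) : expr α 0 = 0 := by
  ext x
  have h1 : _root_.deriv (0 : ℝ → ℂ) = 0 := by ext x; simp
  simp [expr, h1]

/-- A test function vanishing almost everywhere on the half-line is zero. -/
theorem IsTest.eq_zero {φ : ℝ → ℂ} (h : IsTest φ) (h0 : φ =ᵐ[halfLine] 0) : φ = 0 := by
  have := Measure.eqOn_open_of_ae_eq h0 isOpen_Ioi h.smooth.continuous.continuousOn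
    continuousOn_const
  ext x
  by_cases hx : x ∈ Ioi (0 : ℝ)
  · exact this hx
  · exact image_eq_zero_of_notMem_tsupport fun hx' => hx (h.supp hx')

/-- `expr α` maps test functions to test functions. -/
theorem IsTest.expr {φ : ℝ → ℂ} (h : IsTest φ) (α : ℂ) : IsTest (expr α φ) := by
  have hV : IsTest fun x : ℝ => (-1 / 4 + α) * (1 / (x : ℂ) ^ 2) * φ x := by
    refine ⟨contDiff_iff_contDiffAt.2 fun x => ?_, h.compact.mul_left,
      (tsupport_mul_subset_right).trans h.supp⟩
    by_cases hx : x = 0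
    · have h0 : x ∉ tsupport φ := fun h' => absurd (h.supp h') (by simp [hx])
      refine (contDiffAt_const (c := (0 : ℂ))).congr_of_eventuallyEq ?_
      filter_upwards [notMem_tsupport_iff_eventuallyEq.1 h0] with y hy
      simp [hy]
    · have hx2 : (x : ℂ) ^ 2 ≠ 0 := by simpa using hx
      have hc : ContDiffAt ℝ ∞ (fun y : ℝ => (y : ℂ)) x := Complex.ofRealCLM.contDiff.contDiffAt
      have hq : ContDiffAt ℝ ∞ (fun y : ℝ => 1 / (y : ℂ) ^ 2) x := by
        simp only [one_div]
        exact ContDiffAt.inv (hc.pow 2) hx2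
      exact (contDiffAt_const.mul hq).mul h.smooth.contDiffAt
  have hD := h.deriv.deriv.smul (-1)
  have := hD.add hV
  convert this using 1
  ext x
  simp [InverseSquare.expr]

/-- Test functions are square integrable. -/
theorem IsTest.memLp {φ : ℝ → ℂ} (h : IsTest φ) : MemLp φ 2 halfLine :=
  (h.smooth.continuous.memLp_of_hasCompactSupport h.compact).restrict _

/-- An `L²` function orthogonal to all test functions vanishes. -/
theorem eq_zero_of_test {f : L2}
    (h : ∀ φ, IsTest φ → ∫ x in Ioi (0 : ℝ), f x * φ x = 0) : f = 0 := by
  rw [Lp.eq_zero_iff_ae_eq_zero]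
  have hloc : LocallyIntegrableOn f (Ioi (0 : ℝ)) volume := by
    intro x hx
    have h0 : MemLp f 2 (halfLine.restrict (Icc (x / 2) (2 * x))) := (Lp.memLp f).restrict _
    have hs : Icc (x / 2) (2 * x) ⊆ Ioi 0 := fun y hy => lt_of_lt_of_le (half_pos hx) hy.1
    rw [Measure.restrict_restrict measurableSet_Icc, inter_eq_left.2 hs] at h0
    have h1 : IntegrableOn f (Icc (x / 2) (2 * x)) volume := h0.integrable (by norm_num)
    have hx' : (0 : ℝ) < x := hx
    exact ⟨_, mem_nhdsWithin_of_mem_nhds (Icc_mem_nhds (by linarith) (by linarith)), h1⟩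
  refine (ae_restrict_iff' measurableSet_Ioi).2
    (isOpen_Ioi.ae_eq_zero_of_integral_contDiff_smul_eq_zero hloc fun g hg hc hs => ?_)
  have ht : IsTest fun x => (g x : ℂ) :=
    ⟨Complex.ofRealCLM.contDiff.comp hg, hc.comp_left Complex.ofReal_zero,
      (closure_mono fun x hx => by simpa using hx).trans hs⟩
  rw [← h _ ht, ← setIntegral_eq_integral_of_forall_compl_eq_zero (s := Ioi (0 : ℝ))]
  · refine integral_congr_ae (ae_of_all _ fun x => ?_)
    simp [mul_comm]
  · intro x hx
    rw [image_eq_zero_of_notMem_tsupport fun h' => hx (hs h'), zero_smul]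

/-! ### The minimal and the maximal operator -/

/-- The graph of `L_α` on `C_c^∞]0,∞[`. -/
def testGraph (α : ℂ) : Submodule ℂ (L2 × L2) where
  carrier := {p | ∃ φ, IsTest φ ∧ p.1 =ᵐ[halfLine] φ ∧ p.2 =ᵐ[halfLine] expr α φ}
  zero_mem' := ⟨0, isTest_zero, Lp.coeFn_zero _ _ _, by rw [expr_zero]; exact Lp.coeFn_zero _ _ _⟩
  add_mem' := by
    rintro p q ⟨φ, hφ, h1, h2⟩ ⟨ψ, hψ, k1, k2⟩
    refine ⟨φ + ψ, hφ.add hψ, (Lp.coeFn_add _ _).trans (h1.add k1), ?_⟩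
    rw [expr_add α hφ hψ]
    exact (Lp.coeFn_add _ _).trans (h2.add k2)
  smul_mem' := by
    rintro c p ⟨φ, hφ, h1, h2⟩
    refine ⟨c • φ, hφ.smul c, (Lp.coeFn_smul _ _).trans (h1.const_smul c), ?_⟩
    rw [expr_smul α c hφ]
    exact (Lp.coeFn_smul _ _).trans (h2.const_smul c)

/-- The operator `L_α` with domain `C_c^∞]0,∞[`. -/
def LTest (α : ℂ) : L2 →ₗ.[ℂ] L2 := (testGraph α).toLinearPMap

/-- The minimal operator: the closure of `L_α` on `C_c^∞]0,∞[`. -/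
def LMin (α : ℂ) : L2 →ₗ.[ℂ] L2 := (LTest α).closure

/-- Products of square integrable and test functions are integrable. -/
theorem integrable_mul_test (f : L2) {φ : ℝ → ℂ} (h : IsTest φ) :
    Integrable (fun x => f x * φ x) halfLine :=
  (Lp.memLp f).integrable_mul h.memLp

theorem integral_add_test (f g : L2) {φ : ℝ → ℂ} (h : IsTest φ) :
    ∫ x in Ioi (0 : ℝ), (f + g : L2) x * φ x =
      (∫ x in Ioi (0 : ℝ), f x * φ x) + ∫ x in Ioi (0 : ℝ), g x * φ x := by
  rw [← integral_add (integrable_mul_test f h) (integrable_mul_test g h)]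
  refine integral_congr_ae ?_
  filter_upwards [Lp.coeFn_add f g] with x hx
  rw [hx, Pi.add_apply, add_mul]

theorem integral_smul_test (c : ℂ) (f : L2) (φ : ℝ → ℂ) :
    ∫ x in Ioi (0 : ℝ), (c • f : L2) x * φ x = c * ∫ x in Ioi (0 : ℝ), f x * φ x := by
  rw [← integral_const_mul]
  refine integral_congr_ae ?_
  filter_upwards [Lp.coeFn_smul c f] with x hx
  rw [hx, Pi.smul_apply, smul_eq_mul, mul_assoc]

theorem integral_zero_test (φ : ℝ → ℂ) :
    ∫ x in Ioi (0 : ℝ), (0 : L2) x * φ x = 0 := by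
  simpa using integral_smul_test 0 0 φ

/-- The graph of the maximal operator: all pairs `(f, g)` of square integrable functions with
`L_α f = g` in the sense of distributions on `]0,∞[`. -/
def maxGraph (α : ℂ) : Submodule ℂ (L2 × L2) where
  carrier := {p | ∀ φ, IsTest φ →
    ∫ x in Ioi (0 : ℝ), p.1 x * expr α φ x = ∫ x in Ioi (0 : ℝ), p.2 x * φ x}
  zero_mem' φ _ := by
    simp only [Prod.fst_zero, Prod.snd_zero, integral_zero_test]
  add_mem' := by
    intro p q hp hq φ hφ
    simp only [Prod.fst_add, Prod.snd_add]
    rw [integral_add_test _ _ (hφ.expr α), integral_add_test _ _ hφ, hp φ hφ, hq φ hφ]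
  smul_mem' := by
    intro c p hp φ hφ
    simp only [Prod.smul_fst, Prod.smul_snd]
    rw [integral_smul_test, integral_smul_test, hp φ hφ]

/-- The maximal operator: `L_α` on all `f ∈ L²` with `L_α f ∈ L²`. -/
def LMax (α : ℂ) : L2 →ₗ.[ℂ] L2 := (maxGraph α).toLinearPMap

theorem graph_LTest (α : ℂ) : (LTest α).graph = testGraph α := by
  refine Submodule.toLinearPMap_graph_eq _ ?_
  rintro ⟨f, g⟩ ⟨φ, hφ, h1, h2⟩ (rfl : f = 0)
  have : φ = 0 := hφ.eq_zero (h1.symm.trans (Lp.coeFn_zero _ _ _))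
  subst this
  rw [expr_zero] at h2
  exact (Lp.eq_zero_iff_ae_eq_zero).2 h2

theorem graph_LMax (α : ℂ) : (LMax α).graph = maxGraph α := by
  refine Submodule.toLinearPMap_graph_eq _ ?_
  rintro ⟨f, g⟩ h (rfl : f = 0)
  refine eq_zero_of_test fun φ hφ => ?_
  rw [← h φ hφ]
  exact integral_zero_test _

/-- Integration by parts for test functions. -/
theorem integral_test_deriv {φ ψ : ℝ → ℂ} (h : IsTest φ) (k : IsTest ψ) :
    ∫ x in Ioi (0 : ℝ), φ x * deriv ψ x = -∫ x in Ioi (0 : ℝ), deriv φ x * ψ x := by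
  have e : ∀ {u v : ℝ → ℂ}, IsTest v →
      ∫ x in Ioi (0 : ℝ), u x * v x = ∫ x, u x * v x := fun {u v} hv =>
    setIntegral_eq_integral_of_forall_compl_eq_zero fun x hx => by
      rw [image_eq_zero_of_notMem_tsupport fun h' => hx (hv.supp h'), mul_zero]
  have i : ∀ {u v : ℝ → ℂ}, IsTest u → IsTest v → Integrable (u * v) := fun {u v} hu hv =>
    (hu.smooth.continuous.mul hv.smooth.continuous).integrable_of_hasCompactSupport
      hu.compact.mul_right
  rw [e k.deriv, e k]
  exact integral_mul_deriv_eq_deriv_mul_of_integrable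
    (fun x _ => (h.differentiable x).hasDerivAt) (fun x _ => (k.differentiable x).hasDerivAt)
    (i h k.deriv) (i h.deriv k) (i h k)

theorem LTest_le_LMax (α : ℂ) : LTest α ≤ LMax α := by
  refine LinearPMap.le_of_le_graph ?_
  rw [graph_LTest, graph_LMax]
  rintro ⟨f, g⟩ ⟨φ, hφ, h1, h2⟩ ψ hψ
  have e1 : ∫ x in Ioi (0 : ℝ), f x * expr α ψ x = ∫ x in Ioi (0 : ℝ), φ x * expr α ψ x :=
    integral_congr_ae (h1.mono fun x hx => by simp only [hx])
  have e2 : ∫ x in Ioi (0 : ℝ), g x * ψ x = ∫ x in Ioi (0 : ℝ), expr α φ x * ψ x :=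
    integral_congr_ae (h2.mono fun x hx => by simp only [hx])
  have i : ∀ {u v : ℝ → ℂ}, IsTest u → IsTest v → Integrable (fun x => u x * v x) halfLine :=
    fun hu hv => hu.memLp.integrable_mul hv.memLp
  have e3 : ∫ x in Ioi (0 : ℝ), φ x * deriv (deriv ψ) x =
      ∫ x in Ioi (0 : ℝ), deriv (deriv φ) x * ψ x := by
    rw [integral_test_deriv hφ hψ.deriv, integral_test_deriv hφ.deriv hψ, neg_neg]
  change ∫ x in Ioi (0 : ℝ), f x * expr α ψ x = ∫ x in Ioi (0 : ℝ), g x * ψ x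
  rw [e1, e2, ← sub_eq_zero, ← integral_sub (i hφ (hψ.expr α)) (i (hφ.expr α) hψ)]
  rw [← sub_eq_zero, ← integral_sub (i hφ hψ.deriv.deriv) (i hφ.deriv.deriv hψ)] at e3
  rw [← neg_eq_zero, ← integral_neg, ← e3]
  congr 1
  ext x
  simp only [expr]
  ring

theorem continuous_integral_test {φ : ℝ → ℂ} (h : IsTest φ) :
    Continuous fun f : L2 => ∫ x in Ioi (0 : ℝ), f x * φ x := by
  have hφ : MemLp (fun x => star (φ x)) 2 halfLine := h.memLp.star
  have : (fun f : L2 => ∫ x in Ioi (0 : ℝ), f x * φ x) = fun f => ⟪hφ.toLp _, f⟫_ℂ := by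
    ext f
    rw [L2.inner_def]
    refine integral_congr_ae ?_
    filter_upwards [hφ.coeFn_toLp] with x hx
    rw [hx]
    simp
  rw [this]
  fun_prop

theorem isClosed_LMax (α : ℂ) : (LMax α).IsClosed := by
  have : ((LMax α).graph : Set (L2 × L2)) = ⋂ (φ : ℝ → ℂ) (_ : IsTest φ),
      {p | ∫ x in Ioi (0 : ℝ), p.1 x * expr α φ x = ∫ x in Ioi (0 : ℝ), p.2 x * φ x} := by
    rw [graph_LMax]
    ext p
    simp [maxGraph]
  rw [LinearPMap.IsClosed, this]
  exact isClosed_biInter fun φ hφ => isClosed_eq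
    ((continuous_integral_test (hφ.expr α)).comp continuous_fst)
    ((continuous_integral_test hφ).comp continuous_snd)

/-- `L_α` on `C_c^∞]0,∞[` is closable, so that `LMin` is its genuine closure. -/
theorem isClosable_LTest (α : ℂ) : (LTest α).IsClosable :=
  (isClosed_LMax α).isClosable.leIsClosable (LTest_le_LMax α)

/-! ### The operators `H_m` -/

/-- A smooth compactly supported cutoff equal to `1` around `0`. -/
structure IsCutoff (ξ : ℝ → ℝ) : Prop where
  smooth : ContDiff ℝ ∞ ξ
  compact : HasCompactSupport ξ
  one : ∀ᶠ x in 𝓝 (0 : ℝ), ξ x = 1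

/-- The subspace `Dom L_{m²}^min + ℂ x^{1/2+m} ξ`. -/
def HDomain (ξ : ℝ → ℝ) (m : ℂ) : Submodule ℂ L2 where
  carrier := {f | ∃ g ∈ (LMin (m ^ 2)).domain, ∃ c : ℂ,
    f =ᵐ[halfLine] fun x => g x + c * ((x : ℂ) ^ (1 / 2 + m) * (ξ x : ℂ))}
  zero_mem' := ⟨0, Submodule.zero_mem _, 0, by simp⟩
  add_mem' := by
    rintro f f' ⟨g, hg, c, h⟩ ⟨g', hg', c', h'⟩
    refine ⟨g + g', Submodule.add_mem _ hg hg', c + c', ?_⟩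
    filter_upwards [Lp.coeFn_add f f', Lp.coeFn_add g g', h, h'] with x h1 h2 h3 h4
    rw [h1, h2, Pi.add_apply, Pi.add_apply, h3, h4]
    ring
  smul_mem' := by
    rintro a f ⟨g, hg, c, h⟩
    refine ⟨a • g, Submodule.smul_mem _ a hg, a * c, ?_⟩
    filter_upwards [Lp.coeFn_smul a f, Lp.coeFn_smul a g, h] with x h1 h2 h3
    rw [h1, h2, Pi.smul_apply, Pi.smul_apply, h3, smul_eq_mul, smul_eq_mul]
    ring

/-- The operator `H_m` (for `Re m > -1`): the restriction of `L_{m²}^max` to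
`Dom L_{m²}^min + ℂ x^{1/2+m} ξ`. -/
def H (ξ : ℝ → ℝ) (m : ℂ) : L2 →ₗ.[ℂ] L2 := (LMax (m ^ 2)).domRestrict (HDomain ξ m)

/-! ### The Dirichlet and Neumann Laplacians -/

/-- `g` is the weak derivative of `f` on `]0,∞[`. -/
def HasWeakDeriv (f g : L2) : Prop :=
  ∀ φ, IsTest φ →
    ∫ x in Ioi (0 : ℝ), f x * deriv φ x = -∫ x in Ioi (0 : ℝ), g x * φ x

/-- `f` has a representative that is continuous on `[0,∞[` and vanishes at `0`. -/
def VanishesAtZero (f : L2) : Prop :=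
  ∃ F : ℝ → ℂ, ContinuousOn F (Ici 0) ∧ F 0 = 0 ∧ f =ᵐ[halfLine] F

theorem HasWeakDeriv.zero : HasWeakDeriv 0 0 := fun φ _ => by
  simp only [integral_zero_test, neg_zero]

theorem HasWeakDeriv.add {f g f' g' : L2} (h : HasWeakDeriv f g) (h' : HasWeakDeriv f' g') :
    HasWeakDeriv (f + f') (g + g') := fun φ hφ => by
  rw [integral_add_test _ _ hφ.deriv, integral_add_test _ _ hφ, h φ hφ, h' φ hφ]
  ring

theorem HasWeakDeriv.smul {f g : L2} (h : HasWeakDeriv f g) (c : ℂ) :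
    HasWeakDeriv (c • f) (c • g) := fun φ hφ => by
  rw [integral_smul_test, integral_smul_test, h φ hφ]
  ring

theorem HasWeakDeriv.eq_zero {g : L2} (h : HasWeakDeriv 0 g) : g = 0 :=
  eq_zero_of_test fun φ hφ => by
    have := h φ hφ
    rw [integral_zero_test] at this
    exact neg_eq_zero.1 this.symm

theorem VanishesAtZero.zero : VanishesAtZero 0 :=
  ⟨0, continuousOn_const, rfl, Lp.coeFn_zero _ _ _⟩

theorem VanishesAtZero.add {f g : L2} (h : VanishesAtZero f) (k : VanishesAtZero g) :
    VanishesAtZero (f + g) := by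
  obtain ⟨F, hF, hF0, hfF⟩ := h
  obtain ⟨G, hG, hG0, hgG⟩ := k
  exact ⟨F + G, hF.add hG, by simp [hF0, hG0], (Lp.coeFn_add _ _).trans (hfF.add hgG)⟩

theorem VanishesAtZero.smul {f : L2} (h : VanishesAtZero f) (c : ℂ) :
    VanishesAtZero (c • f) := by
  obtain ⟨F, hF, hF0, hfF⟩ := h
  exact ⟨c • F, hF.const_smul c, by simp [hF0], (Lp.coeFn_smul _ _).trans (hfF.const_smul c)⟩

/-- The graph of the Dirichlet Laplacian: pairs `(f, -f'')` with `f` in the Sobolev space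
`H²]0,∞[` (`f, f', f'' ∈ L²`) and `f(0) = 0`. -/
def dirichletGraph : Submodule ℂ (L2 × L2) where
  carrier := {p | ∃ d : L2, HasWeakDeriv p.1 d ∧ HasWeakDeriv d (-p.2) ∧ VanishesAtZero p.1}
  zero_mem' := ⟨0, HasWeakDeriv.zero, by simpa using HasWeakDeriv.zero, VanishesAtZero.zero⟩
  add_mem' := by
    rintro p q ⟨d, h1, h2, h3⟩ ⟨e, k1, k2, k3⟩
    refine ⟨d + e, h1.add k1, ?_, h3.add k3⟩
    rw [Prod.snd_add, neg_add]
    exact h2.add k2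
  smul_mem' := by
    rintro c p ⟨d, h1, h2, h3⟩
    refine ⟨c • d, h1.smul c, ?_, h3.smul c⟩
    rw [Prod.smul_snd, ← smul_neg]
    exact h2.smul c

/-- The graph of the Neumann Laplacian: pairs `(f, -f'')` with `f` in the Sobolev space
`H²]0,∞[` (`f, f', f'' ∈ L²`) and `f'(0) = 0`. -/
def neumannGraph : Submodule ℂ (L2 × L2) where
  carrier := {p | ∃ d : L2, HasWeakDeriv p.1 d ∧ HasWeakDeriv d (-p.2) ∧ VanishesAtZero d}
  zero_mem' := ⟨0, HasWeakDeriv.zero, by simpa using HasWeakDeriv.zero, VanishesAtZero.zero⟩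
  add_mem' := by
    rintro p q ⟨d, h1, h2, h3⟩ ⟨e, k1, k2, k3⟩
    refine ⟨d + e, h1.add k1, ?_, h3.add k3⟩
    rw [Prod.snd_add, neg_add]
    exact h2.add k2
  smul_mem' := by
    rintro c p ⟨d, h1, h2, h3⟩
    refine ⟨c • d, h1.smul c, ?_, h3.smul c⟩
    rw [Prod.smul_snd, ← smul_neg]
    exact h2.smul c

/-- The Dirichlet Laplacian `-∂_x²` on the half-line. -/
def dirichletLaplacian : L2 →ₗ.[ℂ] L2 := dirichletGraph.toLinearPMap

/-- The Neumann Laplacian `-∂_x²` on the half-line. -/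
def neumannLaplacian : L2 →ₗ.[ℂ] L2 := neumannGraph.toLinearPMap

theorem graph_dirichletLaplacian : dirichletLaplacian.graph = dirichletGraph := by
  refine Submodule.toLinearPMap_graph_eq _ ?_
  rintro ⟨f, g⟩ ⟨d, h1, h2, -⟩ (rfl : f = 0)
  obtain rfl := h1.eq_zero
  exact neg_eq_zero.1 h2.eq_zero

theorem graph_neumannLaplacian : neumannLaplacian.graph = neumannGraph := by
  refine Submodule.toLinearPMap_graph_eq _ ?_
  rintro ⟨f, g⟩ ⟨d, h1, h2, -⟩ (rfl : f = 0)
  obtain rfl := h1.eq_zero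
  exact neg_eq_zero.1 h2.eq_zero

/-! ### Dilations and homogeneity -/

theorem map_halfLine (τ : ℝ) :
    Measure.map (fun x => Real.exp τ * x) halfLine ≤
      ENNReal.ofReal |(Real.exp τ)⁻¹| • halfLine := by
  have he := Real.exp_pos τ
  have hpre : Ioi (0 : ℝ) = (fun x => Real.exp τ * x) ⁻¹' Ioi 0 := by
    ext x; simp [he]
  have hm : Measurable fun x : ℝ => Real.exp τ * x := by fun_prop
  conv_lhs => rw [halfLine, hpre, ← Measure.restrict_map hm measurableSet_Ioi,
    Real.map_volume_mul_left he.ne', Measure.restrict_smul]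

theorem quasi_dilation (τ : ℝ) :
    Measure.QuasiMeasurePreserving (fun x => Real.exp τ * x) halfLine halfLine :=
  ⟨by fun_prop, Measure.absolutelyContinuous_of_le_smul (map_halfLine τ)⟩

theorem memLp_dilation (τ : ℝ) (f : L2) :
    MemLp (fun x => (Real.exp (τ / 2) : ℂ) * f (Real.exp τ * x)) 2 halfLine :=
  (MemLp.comp_of_map ((Lp.memLp f).of_measure_le_smul ENNReal.ofReal_ne_top (map_halfLine τ))
    (by fun_prop)).const_mul _

/-- The dilation `(U_τ f)(x) = e^{τ/2} f(e^τ x)` on `L²[0,∞[`. -/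
def dilation (τ : ℝ) : L2 →ₗ[ℂ] L2 where
  toFun f := (memLp_dilation τ f).toLp _
  map_add' f g := by
    ext1
    filter_upwards [(memLp_dilation τ (f + g)).coeFn_toLp, (memLp_dilation τ f).coeFn_toLp,
      (memLp_dilation τ g).coeFn_toLp, Lp.coeFn_add ((memLp_dilation τ f).toLp _)
      ((memLp_dilation τ g).toLp _), (quasi_dilation τ).ae (Lp.coeFn_add f g)]
      with x h1 h2 h3 h4 h5
    rw [h1, h4, Pi.add_apply, h2, h3, h5, Pi.add_apply, mul_add]
  map_smul' c f := by
    ext1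
    filter_upwards [(memLp_dilation τ (c • f)).coeFn_toLp, (memLp_dilation τ f).coeFn_toLp,
      Lp.coeFn_smul c ((memLp_dilation τ f).toLp _), (quasi_dilation τ).ae (Lp.coeFn_smul c f)]
      with x h1 h2 h3 h4
    rw [h1, RingHom.id_apply, h3, Pi.smul_apply, h2, h4, Pi.smul_apply, smul_eq_mul, smul_eq_mul]
    ring

/-- `B` is homogeneous of degree `ν`: `U_τ B U_τ⁻¹ = e^{ντ} B` for all `τ`, an equality of
unbounded operators, domains included. The graph of `U_τ B U_τ⁻¹` is the image of the graph of `B`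
under `U_τ × U_τ`. -/
def IsHomogeneous (ν : ℝ) (B : L2 →ₗ.[ℂ] L2) : Prop :=
  ∀ τ : ℝ, B.graph.map ((dilation τ).prodMap (dilation τ)) =
    ((Real.exp (ν * τ) : ℂ) • B).graph

end InverseSquare

end

/-! Statements 1, 2, 4 and 5 are read off from the boundary form `bform`, the bilinear version of
the defect ⟪L f, g⟫ - ⟪f, L g⟫. An element of the maximal domain has a C¹ representative
(`exists_isSol`) which vanishes at infinity with its derivative (`IsSol.tendsto_atTop`), so by
Lagrange's identity `bform` is minus the limit at 0 of a Wronskian (`tendsto_wronskian_bform`). For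
real α the adjoint of L^min is L^max, and therefore L^min is the kernel of `bform` in L^max
(`mem_graph_LMin_iff`).

Let m² = α. The homogeneous solutions are x^(1/2 ± m), with √x log x as the second one for m = 0. If
α < 1, both are square integrable at 0, and the Plücker identity between Wronskians makes `bform` a
nondegenerate alternating form in two boundary values (`IsFund.bform_eq`). Thus L^min has two
boundary conditions more than L^max, the deficiency indices are (1,1), and H_m is the kernel of a
single boundary functional, which is self-adjoint when m is real. If α ≥ 1, the solution x^(1/2 - m)
with m = √α is not square integrable at 0; this forces `bform` to vanish
(`bform_eq_zero_of_one_le`), so L^min = L^max. At α = 1/4 the boundary functionals of H_{1/2} and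
H_{-1/2} are F(0) and F'(0), up to sign. If α < 0, m is imaginary and dilations rotate the two
boundary values by opposite phases; symmetry and dilation invariance together kill both values,
leaving only L^min, which is not self-adjoint.

Statement 3 rests on the factorization L = A*A with A = ∂ - (1/2 + m)/x. Since A annihilates
x^(1/2+m), it maps the cut-off solution to a test function, and the form of H_m on a core is ‖A f‖²
(`IsFactored.inner_eq`). For m ≥ 0 a logarithmic cutoff approximates x^(1/2+m) ξ by test functions
in the form norm, so H_m is the Friedrichs extension (`cut_mem_formDomain`). For m ≤ 0, a form value
s of a nonnegative extension at f gives, by Riesz, a vector w with ‖w‖² ≤ s and ⟪f, A*ψ⟫ = ⟪w, ψ⟫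
for ψ in the range of A on test functions; this range misses the test functions by one dimension,
and a dilation argument removes the gap (`inner_raise_eq`). Duality for forms then bounds the form
of H_m at f by s, which is Krein minimality (`formLE_H`). -/

noncomputable section

namespace InverseSquare

/-! ### Operators in a Hilbert space -/

section Hilbert

variable {E : Type*} [NormedAddCommGroup E] [InnerProductSpace ℂ E]

/-- The double adjoint of a graph is contained in its closure. -/
theorem adjoint_adjoint_le_topologicalClosure [CompleteSpace E] (g : Submodule ℂ (E × E)) :
    g.adjoint.adjoint ≤ g.topologicalClosure := by
  rintro x hx
  rw [Submodule.mem_adjoint_iff] at hx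
  -- The product `E × E` carries the sup norm; orthogonal complements need its ℓ² version, which has
  -- the same topology.
  let e := (WithLp.linearEquiv 2 ℂ (E × E)).symm
  let G : Submodule ℂ (WithLp 2 (E × E)) := g.map e.toLinearMap
  have h1 : WithLp.toLp 2 x ∈ Gᗮᗮ := by
    rw [Submodule.mem_orthogonal]
    intro y hy
    rw [Submodule.mem_orthogonal] at hy
    -- Up to the rotation (a, b) ↦ (b, -a), the adjoint of a graph is its orthogonal complement, so
    -- two adjoints give the double complement.
    have := hx y.ofLp.2 (-y.ofLp.1) (by
      rw [Submodule.mem_adjoint_iff]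
      intro a b hab
      have := hy (WithLp.toLp 2 (a, b)) ⟨(a, b), hab, rfl⟩
      rw [WithLp.prod_inner_apply] at this
      simp only [inner_neg_right, sub_neg_eq_add]
      rw [add_comm]
      exact this)
    rw [WithLp.prod_inner_apply]
    simp only [inner_neg_left] at this
    have h3 : -(inner ℂ y.ofLp.1 x.1 + inner ℂ y.ofLp.2 x.2) = 0 := by rw [← this]; ring
    exact neg_eq_zero.1 h3
  rw [Submodule.orthogonal_orthogonal_eq_closure] at h1
  have h2 : WithLp.toLp 2 x ∈ closure (G : Set (WithLp 2 (E × E))) := h1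
  have h3 := image_closure_subset_closure_image
    (WithLp.prod_continuous_ofLp 2 E E) ⟨_, h2, rfl⟩
  refine closure_mono ?_ h3
  rintro _ ⟨_, ⟨p, hp, rfl⟩, rfl⟩
  exact hp

theorem mem_graph_adjoint_iff [CompleteSpace E] {T : E →ₗ.[ℂ] E} (hT : Dense (T.domain : Set E))
    {f g : E} : (f, g) ∈ T†.graph ↔ ∀ a b, (a, b) ∈ T.graph → ⟪b, f⟫_ℂ = ⟪a, g⟫_ℂ := by
  rw [LinearPMap.adjoint_graph_eq_graph_adjoint hT, Submodule.mem_adjoint_iff]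
  simp only [sub_eq_zero]

theorem graph_adjoint_anti [CompleteSpace E] {S T : E →ₗ.[ℂ] E} (hS : Dense (S.domain : Set E))
    (h : S ≤ T) : T†.graph ≤ S†.graph := by
  have hT : Dense (T.domain : Set E) := hS.mono h.1
  rintro ⟨f, g⟩ hfg
  rw [mem_graph_adjoint_iff hT] at hfg
  rw [mem_graph_adjoint_iff hS]
  exact fun a b hab => hfg a b (LinearPMap.le_graph_of_le h hab)

/-- A closed operator which is bounded below after a shift, and whose adjoint has no eigenvector
at the conjugate point, is onto after the shift. -/
theorem exists_apply_add_smul_eq [CompleteSpace E] {T : E →ₗ.[ℂ] E}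
    (hT : Dense (T.domain : Set E)) (hc : T.IsClosed) (z : ℂ) {c : ℝ} (hc0 : 0 < c)
    (hb : ∀ u : T.domain, c * ‖(u : E)‖ ≤ ‖T u + z • (u : E)‖)
    (hk : ∀ f, (f, -(starRingEnd ℂ z • f)) ∈ T†.graph → f = 0) (e : E) :
    ∃ u : T.domain, T u + z • (u : E) = e := by
  let G := T.graph
  have : CompleteSpace G := (show IsClosed (G : Set (E × E)) from hc).completeSpace_coe
  let L : G →ₗ[ℂ] E := (LinearMap.snd ℂ E E + z • LinearMap.fst ℂ E E).comp G.subtype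
  have hL : ∀ p : G, L p = p.1.2 + z • p.1.1 := fun p => rfl
  have hLb : ∀ p : G, ‖p‖ ≤ (1 + (1 + ‖z‖) / c) * ‖L p‖ := by
    rintro ⟨⟨a, b⟩, hab⟩
    obtain ⟨u, hu1, hu2⟩ := (LinearPMap.mem_graph_iff _).1 hab
    have h1 := hb u
    simp only at hu1 hu2
    rw [hu1, hu2] at h1
    rw [hL]
    simp only
    set r := ‖b + z • a‖
    have hr : 0 ≤ r := norm_nonneg _
    have h2 : ‖a‖ ≤ r / c := by rw [le_div_iff₀ hc0]; linarith
    have h3 : ‖b‖ ≤ r + ‖z‖ * ‖a‖ := by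
      calc ‖b‖ = ‖(b + z • a) - z • a‖ := by rw [add_sub_cancel_right]
        _ ≤ _ := by rw [← norm_smul]; exact norm_sub_le _ _
    have h4 : ‖z‖ * ‖a‖ ≤ ‖z‖ * (r / c) := mul_le_mul_of_nonneg_left h2 (norm_nonneg _)
    have h5 : (0 : ℝ) ≤ r / c := by positivity
    have h6 : (1 + (1 + ‖z‖) / c) * r = r + r / c + ‖z‖ * (r / c) := by ring
    rw [h6]
    have h7 : 0 ≤ ‖z‖ * (r / c) := by positivity
    refine max_le ?_ ?_
    · change ‖a‖ ≤ _; linarith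
    · change ‖b‖ ≤ _; linarith
  have hcl : IsClosed (LinearMap.range L : Set E) := by
    have ha : AntilipschitzWith (Real.toNNReal (1 + (1 + ‖z‖) / c)) L := by
      refine AddMonoidHomClass.antilipschitz_of_bound L fun p => ?_
      rw [Real.coe_toNNReal _ (by positivity)]
      exact hLb p
    have hu : UniformContinuous L := by
      have : Continuous L := by
        change Continuous fun p : G => p.1.2 + z • p.1.1
        fun_prop
      exact uniformContinuous_addMonoidHom_of_continuous this
    exact ha.isClosed_range hu
  -- The complement of the range of T + z is the eigenspace of T† at minus the conjugate of z.
  have hperp : (LinearMap.range L)ᗮ = ⊥ := by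
    rw [Submodule.eq_bot_iff]
    intro f hf
    refine hk f ((mem_graph_adjoint_iff hT).2 fun a b hab => ?_)
    have h1 := (Submodule.mem_orthogonal _ _).1 hf (L ⟨(a, b), hab⟩) ⟨_, rfl⟩
    rw [hL, inner_add_left, inner_smul_left] at h1
    rw [inner_neg_right, inner_smul_right]
    exact eq_neg_of_add_eq_zero_left h1
  have htop : LinearMap.range L = ⊤ := by
    rw [← hcl.submodule_topologicalClosure_eq, Submodule.topologicalClosure_eq_top_iff]
    exact hperp
  obtain ⟨⟨⟨a, b⟩, hab⟩, hp⟩ := (htop ▸ Submodule.mem_top : e ∈ LinearMap.range L)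
  obtain ⟨u, hu1, hu2⟩ := (LinearPMap.mem_graph_iff _).1 hab
  simp only at hu1 hu2
  exact ⟨u, by rw [hu1, hu2]; exact hp⟩

theorem IsHermitianOp.le_adjoint [CompleteSpace E] {T : E →ₗ.[ℂ] E} (h : IsHermitianOp T) :
    T ≤ T† := LinearPMap.IsFormalAdjoint.le_adjoint h.1 h.2

theorem IsHermitianOp.inner_eq {T : E →ₗ.[ℂ] E} (h : IsHermitianOp T) (u v : T.domain) :
    ⟪T u, (v : E)⟫_ℂ = ⟪(u : E), T v⟫_ℂ := h.2 u v

theorem isHermitianOp_of_isSelfAdjoint [CompleteSpace E] {T : E →ₗ.[ℂ] E} (h : IsSelfAdjoint T) :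
    IsHermitianOp T := by
  refine ⟨h.dense_domain, ?_⟩
  have := LinearPMap.adjoint_isFormalAdjoint h.dense_domain
  rwa [LinearPMap.isSelfAdjoint_def.1 h] at this

theorem IsHermitianOp.im_inner_eq_zero {T : E →ₗ.[ℂ] E} (h : IsHermitianOp T) (u : T.domain) :
    (⟪(u : E), T u⟫_ℂ).im = 0 := by
  have h1 := h.inner_eq u u
  rw [← inner_conj_symm] at h1
  have := congrArg Complex.im h1
  rw [Complex.conj_im] at this
  linarith

theorem IsHermitianOp.inner_eq_quadForm {T : E →ₗ.[ℂ] E} (h : IsHermitianOp T) (u : T.domain) :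
    ⟪(u : E), T u⟫_ℂ = (quadForm T u : ℂ) := by
  apply Complex.ext
  · simp [quadForm]
  · simpa using h.im_inner_eq_zero u

/-- A closed symmetric operator without deficiency is self-adjoint. -/
theorem isSelfAdjoint_of_deficiency [CompleteSpace E] {T : E →ₗ.[ℂ] E} (h : IsHermitianOp T)
    (hc : T.IsClosed) (h1 : ∀ f, (f, Complex.I • f) ∈ T†.graph → f = 0)
    (h2 : ∀ f, (f, -(Complex.I • f)) ∈ T†.graph → f = 0) : IsSelfAdjoint T := by
  rw [LinearPMap.isSelfAdjoint_def]
  have hle := h.le_adjoint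
  refine (LinearPMap.eq_of_le_of_domain_eq hle (le_antisymm hle.1 fun f hf => ?_)).symm
  -- Von Neumann's argument: solve (T + i)u = (T† + i)f inside the domain of T. Then u - f is an
  -- eigenvector of T† at -i, so u = f. The lower bound comes from ‖(T + i)u‖² = ‖T u‖² + ‖u‖².
  have hsurj := exists_apply_add_smul_eq h.1 hc Complex.I one_pos (fun u => ?_)
    (fun g hg => h1 g (by simpa using hg)) (T† ⟨f, hf⟩ + Complex.I • f)
  · obtain ⟨u, hu⟩ := hsurj
    have hu' : ((u : E), T u) ∈ T†.graph := LinearPMap.le_graph_of_le hle (T.mem_graph u)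
    have hd := T†.graph.sub_mem hu' (T†.mem_graph ⟨f, hf⟩)
    have he : ((u : E), T u) - (f, T† ⟨f, hf⟩) = ((u : E) - f, -(Complex.I • ((u : E) - f))) := by
      rw [Prod.mk_sub_mk, smul_sub, neg_sub]
      congr 1
      rw [sub_eq_sub_iff_add_eq_add, hu]
      abel
    have h0 := h2 _ (he ▸ hd)
    rw [← sub_eq_zero.1 h0]
    exact u.2
  · have h3 : ‖T u + Complex.I • (u : E)‖ ^ 2 = ‖T u‖ ^ 2 + ‖(u : E)‖ ^ 2 := by
      rw [@norm_add_sq ℂ, norm_smul, Complex.norm_I, one_mul, inner_smul_right,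
        h.inner_eq u u, h.inner_eq_quadForm u]
      simp
    rw [one_mul]
    refine le_of_sq_le_sq ?_ (norm_nonneg _)
    rw [h3]
    nlinarith [sq_nonneg ‖T u‖]

end Hilbert

/-! ### Closures of quadratic forms. -/

section Forms

variable {E : Type*} [NormedAddCommGroup E] [InnerProductSpace ℂ E]

/-- The semi-inner product `⟪u, T v⟫` of a nonnegative operator. -/
@[reducible]
def IsNonnegOp.core {T : E →ₗ.[ℂ] E} (h : IsNonnegOp T) : PreInnerProductSpace.Core ℂ T.domain where
  inner u v := ⟪(u : E), T v⟫_ℂ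
  conj_inner_symm u v := by rw [inner_conj_symm]; exact h.1.inner_eq u v
  re_inner_nonneg u := h.2 u
  add_left u v w := by rw [Submodule.coe_add, inner_add_left]
  smul_left u v c := by rw [Submodule.coe_smul, inner_smul_left]

theorem IsNonnegOp.norm_inner_sq_le {T : E →ₗ.[ℂ] E} (h : IsNonnegOp T) (u v : T.domain) :
    ‖⟪(u : E), T v⟫_ℂ‖ ^ 2 ≤ quadForm T u * quadForm T v := by
  have h1 := @InnerProductSpace.Core.inner_mul_inner_self_le ℂ T.domain _ _ _ h.core u v
  have h2 : ‖⟪(v : E), T u⟫_ℂ‖ = ‖⟪(u : E), T v⟫_ℂ‖ := by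
    rw [← h.1.inner_eq v u, norm_inner_symm]
  have h3 : ‖⟪(u : E), T v⟫_ℂ‖ * ‖⟪(v : E), T u⟫_ℂ‖ ≤ quadForm T u * quadForm T v := h1
  rw [h2] at h3
  rw [sq]
  exact h3

theorem IsNonnegOp.norm_inner_le {T : E →ₗ.[ℂ] E} (h : IsNonnegOp T) (u v : T.domain) :
    ‖⟪(u : E), T v⟫_ℂ‖ ≤ √(quadForm T u) * √(quadForm T v) := by
  rw [← Real.sqrt_mul (h.2 u)]
  exact Real.le_sqrt_of_sq_le (h.norm_inner_sq_le u v)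

theorem quadForm_smul (T : E →ₗ.[ℂ] E) (c : ℂ) (u : T.domain) :
    quadForm T (c • u) = ‖c‖ ^ 2 * quadForm T u := by
  simp only [quadForm, LinearPMap.map_smul, Submodule.coe_smul, inner_smul_left, inner_smul_right]
  rw [← mul_assoc, Complex.mul_conj']
  norm_cast
  exact Complex.re_ofReal_mul _ _

theorem quadForm_neg (T : E →ₗ.[ℂ] E) (u : T.domain) : quadForm T (-u) = quadForm T u := by
  simp [quadForm, LinearPMap.map_neg]

theorem IsHermitianOp.quadForm_add {T : E →ₗ.[ℂ] E} (h : IsHermitianOp T) (u v : T.domain) :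
    quadForm T (u + v) = quadForm T u + quadForm T v + 2 * (⟪(u : E), T v⟫_ℂ).re := by
  have h1 : (⟪(v : E), T u⟫_ℂ).re = (⟪(u : E), T v⟫_ℂ).re := by
    rw [← h.inner_eq v u, ← inner_conj_symm, Complex.conj_re]
  simp only [quadForm, LinearPMap.map_add, Submodule.coe_add, inner_add_left, inner_add_right,
    RCLike.re_to_complex, Complex.add_re]
  rw [h1]
  ring

theorem IsNonnegOp.sqrt_quadForm_add_le {T : E →ₗ.[ℂ] E} (h : IsNonnegOp T) (u v : T.domain) :
    √(quadForm T (u + v)) ≤ √(quadForm T u) + √(quadForm T v) := by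
  rw [Real.sqrt_le_left (by positivity), h.1.quadForm_add, add_sq, Real.sq_sqrt (h.2 u),
    Real.sq_sqrt (h.2 v)]
  have := (Complex.re_le_norm _).trans (h.norm_inner_le u v)
  nlinarith

theorem IsNonnegOp.abs_sqrt_quadForm_sub_le {T : E →ₗ.[ℂ] E} (h : IsNonnegOp T) (u v : T.domain) :
    |√(quadForm T u) - √(quadForm T v)| ≤ √(quadForm T (u - v)) := by
  rw [abs_sub_le_iff]
  constructor
  · have := h.sqrt_quadForm_add_le (u - v) v
    rw [sub_add_cancel] at this
    linarith
  · have := h.sqrt_quadForm_add_le (v - u) u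
    rw [sub_add_cancel, ← quadForm_neg T (v - u), neg_sub] at this
    linarith

/-- A form-Cauchy sequence has a convergent sequence of form values. -/
theorem IsNonnegOp.mem_formDomain {T : E →ₗ.[ℂ] E} (h : IsNonnegOp T) {f : E} {u : ℕ → T.domain}
    (hu : Tendsto (fun n => (u n : E)) atTop (𝓝 f))
    (hq : Tendsto (fun p : ℕ × ℕ => quadForm T (u p.1 - u p.2)) atTop (𝓝 0)) :
    f ∈ formDomain T := by
  have hs : Tendsto (fun p : ℕ × ℕ => √(quadForm T (u p.1 - u p.2))) atTop (𝓝 0) := by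
    simpa using hq.sqrt
  have hC : CauchySeq fun n => √(quadForm T (u n)) := by
    rw [cauchySeq_iff_tendsto_dist_atTop_0]
    refine squeeze_zero (fun _ => dist_nonneg) (fun p => ?_) hs
    rw [Real.dist_eq]
    exact h.abs_sqrt_quadForm_sub_le _ _
  obtain ⟨r, hr⟩ := cauchySeq_tendsto_of_complete hC
  refine ⟨r ^ 2, u, hu, hq, ?_⟩
  convert hr.pow 2 using 2 with n
  rw [Real.sq_sqrt (h.2 _)]

theorem coe_mem_formDomain {T : E →ₗ.[ℂ] E} (u : T.domain) : (u : E) ∈ formDomain T := by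
  refine ⟨quadForm T u, fun _ => u, tendsto_const_nhds, ?_, tendsto_const_nhds⟩
  simp [quadForm]

theorem IsNonnegOp.add_mem_formDomain {T : E →ₗ.[ℂ] E} (h : IsNonnegOp T) {f g : E}
    (hf : f ∈ formDomain T) (hg : g ∈ formDomain T) : f + g ∈ formDomain T := by
  obtain ⟨_, u, hu, hqu, -⟩ := hf
  obtain ⟨_, v, hv, hqv, -⟩ := hg
  refine h.mem_formDomain (u := fun n => u n + v n) (by simpa using hu.add hv) ?_
  have hs : Tendsto (fun p : ℕ × ℕ => (√(quadForm T (u p.1 - u p.2)) +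
      √(quadForm T (v p.1 - v p.2))) ^ 2) atTop (𝓝 0) := by
    simpa using (hqu.sqrt.add hqv.sqrt).pow 2
  refine squeeze_zero (fun p => h.2 _) (fun p => ?_) hs
  rw [add_sub_add_comm]
  exact (Real.sqrt_le_left (by positivity)).1 (h.sqrt_quadForm_add_le _ _)

theorem IsNonnegOp.smul_mem_formDomain {T : E →ₗ.[ℂ] E} (h : IsNonnegOp T) (c : ℂ) {f : E}
    (hf : f ∈ formDomain T) : c • f ∈ formDomain T := by
  obtain ⟨_, u, hu, hqu, -⟩ := hf
  refine h.mem_formDomain (u := fun n => c • u n) (by simpa using hu.const_smul c) ?_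
  simp only [← smul_sub, quadForm_smul]
  simpa using hqu.const_mul (‖c‖ ^ 2)

/-- Form limits of an extension dominate the functionals `⟪f, T u⟫`. -/
theorem IsFormLimit.norm_inner_sq_le {T S : E →ₗ.[ℂ] E} (hS : IsNonnegOp S) (hle : T ≤ S)
    {f : E} {s : ℝ} (h : IsFormLimit S f s) (u : T.domain) :
    0 ≤ s ∧ ‖⟪f, T u⟫_ℂ‖ ^ 2 ≤ s * quadForm T u := by
  obtain ⟨v, hv, -, hq⟩ := h
  refine ⟨ge_of_tendsto' hq fun n => hS.2 _, ?_⟩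
  obtain ⟨w, hw1, hw2⟩ := LinearPMap.exists_of_le hle u
  have hqw : quadForm T u = quadForm S w := by rw [quadForm, quadForm, hw1, hw2]
  rw [hqw, hw2]
  refine le_of_tendsto_of_tendsto' ((hv.inner tendsto_const_nhds).norm.pow 2)
    (hq.mul_const _) fun n => hS.norm_inner_sq_le _ _

variable [CompleteSpace E]

/-- The adjoint is real on the form domain. -/
theorem IsNonnegOp.im_inner_eq_zero_of_mem_formDomain {T : E →ₗ.[ℂ] E} (h : IsNonnegOp T) {f g : E}
    (hf : f ∈ formDomain T) (hfg : (f, g) ∈ T†.graph) : (⟪f, g⟫_ℂ).im = 0 := by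
  obtain ⟨q, u, hu, hqu, hq⟩ := hf
  have hadj : ∀ n, ⟪T (u n), f⟫_ℂ = ⟪(u n : E), g⟫_ℂ := fun n =>
    (mem_graph_adjoint_iff h.1.1).1 hfg _ _ (T.mem_graph _)
  have hlim : Tendsto (fun n => (⟪(u n : E), g⟫_ℂ).im) atTop (𝓝 (⟪f, g⟫_ℂ).im) :=
    (Complex.continuous_im.tendsto _).comp (hu.inner tendsto_const_nhds)
  refine tendsto_nhds_unique hlim ?_
  -- Since ⟪u n, g⟫ = ⟪T (u n), f⟫ = lim_k ⟪T (u n), u k⟫, and this inner product differs from the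
  -- real number `quadForm T (u n)` by at most the displayed product (Cauchy–Schwarz for the form),
  -- the imaginary part vanishes in the limit.
  have hs : Tendsto (fun p : ℕ × ℕ => √(quadForm T (u p.1)) * √(quadForm T (u p.2 - u p.1)))
      atTop (𝓝 0) := by
    have h1 : Tendsto (fun p : ℕ × ℕ => √(quadForm T (u p.1))) atTop (𝓝 √q) :=
      hq.sqrt.comp (Filter.prod_atTop_atTop_eq (α := ℕ) (β := ℕ) ▸ tendsto_fst)
    have h2 : Tendsto (fun p : ℕ × ℕ => √(quadForm T (u p.2 - u p.1))) atTop (𝓝 √0) := by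
      refine Tendsto.sqrt (hqu.congr fun p => ?_)
      rw [← quadForm_neg, neg_sub]
    simpa using h1.mul h2
  rw [Metric.tendsto_atTop]
  intro ε hε
  obtain ⟨⟨N, M⟩, hN⟩ := Metric.tendsto_atTop.1 hs (ε / 2) (half_pos hε)
  refine ⟨max N M, fun n hn => ?_⟩
  have hk : ∀ k ≥ max N M, |(⟪T (u n), (u k : E)⟫_ℂ).im| ≤ ε / 2 := by
    intro k hk
    have h1 : ⟪T (u n), (u k : E)⟫_ℂ = ⟪(u n : E), T (u n)⟫_ℂ + ⟪(u n : E), T (u k - u n)⟫_ℂ := by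
      rw [h.1.inner_eq, ← inner_add_right, ← LinearPMap.map_add, add_sub_cancel]
    rw [h1, Complex.add_im, h.1.im_inner_eq_zero, zero_add]
    refine (Complex.abs_im_le_norm _).trans ((h.norm_inner_le _ _).trans ?_)
    have := hN (n, k) ⟨(le_max_left _ _).trans hn, (le_max_right _ _).trans hk⟩
    rw [Real.dist_eq, sub_zero] at this
    exact (le_abs_self _).trans this.le
  have hl : Tendsto (fun k => |(⟪T (u n), (u k : E)⟫_ℂ).im|) atTop (𝓝 |(⟪T (u n), f⟫_ℂ).im|) :=
    ((Complex.continuous_im.tendsto _).comp (tendsto_const_nhds.inner hu)).abs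
  have := le_of_tendsto hl (eventually_atTop.2 ⟨_, hk⟩)
  rw [hadj] at this
  rw [Real.dist_eq, sub_zero]
  linarith

/-- A self-adjoint extension whose domain lies in the form domain is the Friedrichs extension. -/
theorem isFriedrichsExtension_of_subset {T F : E →ₗ.[ℂ] E} (h : IsNonnegOp T)
    (hF : IsSelfAdjoint F) (hle : T ≤ F) (hdom : ∀ f ∈ F.domain, f ∈ formDomain T) :
    IsFriedrichsExtension T F := by
  have hFT : F.graph ≤ T†.graph := by
    have := graph_adjoint_anti h.1.1 hle
    rwa [LinearPMap.isSelfAdjoint_def.1 hF] at this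
  refine ⟨h, hF, hle, fun f => ⟨fun hf => ⟨?_, hdom f hf⟩, ?_⟩⟩
  · exact LinearPMap.mem_domain_of_mem_graph (hFT (F.mem_graph ⟨f, hf⟩))
  · rintro ⟨hf, hff⟩
    set g := T† ⟨f, hf⟩
    have hg : (f, g) ∈ T†.graph := T†.mem_graph ⟨f, hf⟩
    suffices (f, g) ∈ F†.graph by
      rw [LinearPMap.isSelfAdjoint_def.1 hF] at this
      exact LinearPMap.mem_domain_of_mem_graph this
    rw [mem_graph_adjoint_iff hF.dense_domain]
    intro a b hab
    have haf : a ∈ formDomain T := hdom a (LinearPMap.mem_domain_of_mem_graph hab)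
    -- Polarization: the values c = 0, ±1, ±i recover the full identity ⟪b, f⟫ = ⟪a, g⟫ from the
    -- reality of the diagonal.
    have key : ∀ c : ℂ, (⟪f + c • a, g + c • b⟫_ℂ).im = 0 := fun c =>
      h.im_inner_eq_zero_of_mem_formDomain
        (h.add_mem_formDomain hff (h.smul_mem_formDomain c haf))
        (T†.graph.add_mem hg (T†.graph.smul_mem c (hFT hab)))
    have k0 := key 0
    have k1 := key 1
    have k2 := key (-1)
    have k3 := key Complex.I
    have k4 := key (-Complex.I)
    simp only [inner_add_left, inner_add_right, inner_smul_left, inner_smul_right, map_neg, map_one,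
      Complex.conj_I, Complex.add_im, Complex.mul_im, Complex.neg_re, Complex.neg_im, Complex.I_re,
      Complex.I_im, Complex.one_re, Complex.one_im, Complex.mul_re, Complex.add_re, zero_smul, inner_zero_left,
      inner_zero_right, Complex.zero_im] at k0 k1 k2 k3 k4
    rw [← inner_conj_symm]
    apply Complex.ext
    · rw [Complex.conj_re]; linarith
    · rw [Complex.conj_im]; linarith

/-- The form domain of a nonnegative self-adjoint operator, by duality. -/
theorem exists_isFormLimit_of_norm_inner_le {K : E →ₗ.[ℂ] E} (hK : IsSelfAdjoint K)
    (hn : IsNonnegOp K) {f : E} {s : ℝ}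
    (hs : ∀ u : K.domain, ‖⟪f, K u⟫_ℂ‖ ^ 2 ≤ s * quadForm K u) (hs0 : 0 ≤ s) :
    ∃ r, IsFormLimit K f r ∧ r ≤ s := by
  have hlow : ∀ (t : ℝ), 0 < t → ∀ u : K.domain, t * ‖(u : E)‖ ≤ ‖K u + (t : ℂ) • (u : E)‖ := by
    intro t ht u
    by_cases hu : ‖(u : E)‖ = 0
    · rw [hu, mul_zero]; exact norm_nonneg _
    have h1 := re_inner_le_norm (𝕜 := ℂ) (u : E) (K u + (t : ℂ) • (u : E))
    rw [inner_add_right, inner_smul_right, inner_self_eq_norm_sq_to_K] at h1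
    have h2 : RCLike.re (⟪(u : E), K u⟫_ℂ + (t : ℂ) * ((‖(u : E)‖ : ℂ)) ^ 2) =
        quadForm K u + t * ‖(u : E)‖ ^ 2 := by
      rw [map_add]
      congr 1
      norm_cast
    have h3 := hn.2 u
    have h4 : 0 < ‖(u : E)‖ := lt_of_le_of_ne (norm_nonneg _) (Ne.symm hu)
    erw [h2] at h1
    refine le_of_mul_le_mul_left ?_ h4
    nlinarith
  have hker : ∀ (t : ℝ), 0 < t → ∀ g, (g, -(starRingEnd ℂ (t : ℂ) • g)) ∈ K†.graph → g = 0 := by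
    intro t ht g hg
    rw [LinearPMap.isSelfAdjoint_def.1 hK] at hg
    obtain ⟨u, hu1, hu2⟩ := (LinearPMap.mem_graph_iff _).1 hg
    simp only [Complex.conj_ofReal] at hu1 hu2
    have h1 := hlow t ht u
    rw [hu2, hu1, neg_add_cancel, norm_zero] at h1
    exact norm_eq_zero.1 (le_antisymm (nonpos_of_mul_nonpos_right h1 ht) (norm_nonneg _))
  -- The approximants are the Yosida regularizations u n = (1 + ε K)⁻¹ f with ε = 1/(n + 1).
  have hres : ∀ n : ℕ, ∃ u : K.domain, K u + ((n + 1 : ℝ) : ℂ) • (u : E) = ((n + 1 : ℝ) : ℂ) • f :=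
    fun n => exists_apply_add_smul_eq hn.1.1 hK.isClosed _ (by positivity : (0 : ℝ) < n + 1)
      (hlow _ (by positivity)) (hker _ (by positivity)) _
  choose u hu using hres
  set ε : ℕ → ℝ := fun n => ((n : ℝ) + 1)⁻¹ with hε
  have hε0 : ∀ n, 0 < ε n := fun n => by positivity
  have hf : ∀ n, f = (u n : E) + (ε n : ℂ) • K (u n) := by
    intro n
    have h1 : ((n + 1 : ℝ) : ℂ) ≠ 0 := by exact_mod_cast (by positivity : (n + 1 : ℝ) ≠ 0)
    have h2 := congrArg (fun v => (ε n : ℂ) • v) (hu n)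
    simp only [smul_add, smul_smul] at h2
    rw [show (ε n : ℂ) * ((n + 1 : ℝ) : ℂ) = 1 by
      rw [hε]; push_cast at h1 ⊢; field_simp] at h2
    rw [one_smul, one_smul, add_comm] at h2
    exact h2.symm
  have hin : ∀ n, ⟪f, K (u n)⟫_ℂ = ((quadForm K (u n) + ε n * ‖K (u n)‖ ^ 2 : ℝ) : ℂ) := by
    intro n
    conv_lhs => rw [hf n]
    rw [inner_add_left, inner_smul_left, hn.1.inner_eq_quadForm, inner_self_eq_norm_sq_to_K,
      Complex.conj_ofReal]
    push_cast
    rfl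
  have hbd : ∀ n, quadForm K (u n) ≤ s ∧ ε n * ‖K (u n)‖ ^ 2 ≤ s := by
    intro n
    have h1 := hs (u n)
    have h2 : 0 ≤ ε n * ‖K (u n)‖ ^ 2 := by have := hε0 n; positivity
    have h3 := hn.2 (u n)
    rw [hin, Complex.norm_real, Real.norm_eq_abs, sq_abs] at h1
    set q := quadForm K (u n)
    set x := ε n * ‖K (u n)‖ ^ 2
    -- The hypothesis at u n reads (q + x)² ≤ s q ≤ s (q + x).
    have h4 : q + x ≤ s := by
      by_contra! hcon
      nlinarith
    exact ⟨by linarith, by linarith⟩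
  have hconv : Tendsto (fun n => (u n : E)) atTop (𝓝 f) := by
    rw [tendsto_iff_norm_sub_tendsto_zero]
    have h1 : Tendsto (fun n => √(ε n * s)) atTop (𝓝 0) := by
      have : Tendsto ε atTop (𝓝 0) := by
        simpa [hε, one_div] using tendsto_one_div_add_atTop_nhds_zero_nat (𝕜 := ℝ)
      simpa using (this.mul_const s).sqrt
    refine squeeze_zero (fun _ => norm_nonneg _) (fun n => Real.le_sqrt_of_sq_le ?_) h1
    have h2 : (u n : E) - f = -((ε n : ℂ) • K (u n)) := by
      conv_lhs => rw [hf n]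
      abel
    rw [h2, norm_neg, norm_smul, Complex.norm_real, Real.norm_eq_abs, abs_of_pos (hε0 n), mul_pow]
    have := (hbd n).2
    nlinarith [hε0 n]
  -- Subtracting the equations f = u + ε K u for n and k and pairing with u k - u n shows that Re ⟪u
  -- k - u n, K (u n)⟫ ≥ 0. Expanding the form then bounds the form of a difference by the
  -- difference of the forms, so a bounded increasing sequence of form values is form-Cauchy.
  have hmono' : ∀ n k, n ≤ k →
      quadForm K (u k - u n) ≤ quadForm K (u k) - quadForm K (u n) := by
    intro n k hnk
    have h1 := hn.1.quadForm_add (u k - u n) (u n)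
    rw [sub_add_cancel] at h1
    rcases hnk.eq_or_lt with rfl | hlt
    · simp [quadForm]
    have hεlt : ε k < ε n := by
      have : (n : ℝ) < k := by exact_mod_cast hlt
      exact inv_strictAnti₀ (by positivity) (by linarith)
    have h2 : ((ε n - ε k : ℝ) : ℂ) • K (u n) =
        ((u k - u n : K.domain) : E) + (ε k : ℂ) • K (u k - u n) := by
      have e1 : (u n : E) + (ε n : ℂ) • K (u n) = (u k : E) + (ε k : ℂ) • K (u k) := by
        rw [← hf, ← hf]
      rw [LinearPMap.map_sub, Submodule.coe_sub, Complex.ofReal_sub, sub_smul, smul_sub,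
        sub_eq_iff_eq_add, ← sub_eq_zero]
      rw [← sub_eq_zero] at e1
      rw [← e1]
      abel
    have h3 : (ε n - ε k) * (⟪((u k - u n : K.domain) : E), K (u n)⟫_ℂ).re =
        ‖((u k - u n : K.domain) : E)‖ ^ 2 + ε k * quadForm K (u k - u n) := by
      have h4 := congrArg (fun v => (⟪((u k - u n : K.domain) : E), v⟫_ℂ).re) h2
      simp only [inner_smul_right, inner_add_right, hn.1.inner_eq_quadForm,
        inner_self_eq_norm_sq_to_K] at h4
      rw [Complex.re_ofReal_mul] at h4
      rw [h4]
      simp only [Complex.add_re]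
      congr 1
      · norm_cast
      · norm_cast
    have h5 : 0 ≤ (⟪((u k - u n : K.domain) : E), K (u n)⟫_ℂ).re := by
      have h6 : 0 ≤ ε k * quadForm K (u k - u n) := mul_nonneg (hε0 k).le (hn.2 _)
      have h7 : 0 < ε n - ε k := by linarith
      refine nonneg_of_mul_nonneg_right ?_ h7
      rw [h3]; positivity
    linarith
  have hmono : Monotone fun n => quadForm K (u n) := fun n k hnk => by
    have := hmono' n k hnk
    have := hn.2 (u k - u n)
    simp only
    linarith
  have hbdd : BddAbove (range fun n => quadForm K (u n)) := ⟨s, by rintro _ ⟨n, rfl⟩; exact (hbd n).1⟩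
  have hq := tendsto_atTop_ciSup hmono hbdd
  refine ⟨_, ⟨u, hconv, ?_, hq⟩, ciSup_le fun n => (hbd n).1⟩
  have hd := cauchySeq_iff_tendsto_dist_atTop_0.1 hq.cauchySeq
  refine squeeze_zero (fun p => hn.2 _) (fun p => ?_) hd
  rw [Real.dist_eq]
  rcases le_total p.1 p.2 with hp | hp
  · rw [← quadForm_neg, neg_sub, abs_sub_comm]
    exact (hmono' _ _ hp).trans (le_abs_self _)
  · exact (hmono' _ _ hp).trans (le_abs_self _)

end Forms

/-! ### Calculus on the half-line -/

/-- Integration by parts against the primitive of an integrable function. -/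
theorem integral_deriv_mul_primitive {a b : ℝ} (hab : a ≤ b) {u u' v k : ℝ → ℂ}
    (hu : ∀ x ∈ Icc a b, HasDerivAt u (u' x) x) (hu' : ContinuousOn u' (Icc a b))
    (hk : IntervalIntegrable k volume a b)
    (hv : ∀ x ∈ Icc a b, v x = v a + ∫ t in a..x, k t) :
    u b * v b - u a * v a = ∫ x in a..b, (u' x * v x + u x * k x) := by
  have hkI : IntegrableOn k (Ioc a b) := (intervalIntegrable_iff_integrableOn_Ioc_of_le hab).1 hk
  have huI : IntegrableOn u' (Ioc a b) :=
    (hu'.integrableOn_Icc).mono_set Ioc_subset_Icc_self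
  have hucont : ContinuousOn u (Icc a b) := fun x hx => (hu x hx).continuousAt.continuousWithinAt
  have hukI : IntegrableOn (fun x => u x * k x) (Ioc a b) := by
    have : IntervalIntegrable (fun x => u x * k x) volume a b :=
      hk.continuousOn_mul (by rwa [uIcc_of_le hab])
    exact (intervalIntegrable_iff_integrableOn_Ioc_of_le hab).1 this
  have hprim : ContinuousOn (fun x => ∫ t in a..x, k t) (Icc a b) := by
    have := intervalIntegral.continuousOn_primitive_interval' hk left_mem_uIcc
    rwa [uIcc_of_le hab] at this
  have hvcont : ContinuousOn v (Icc a b) :=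
    (continuousOn_const.add hprim).congr hv
  have ftc : ∀ t ∈ Icc a b, ∫ x in t..b, u' x = u b - u t := by
    intro t ht
    refine intervalIntegral.integral_eq_sub_of_hasDerivAt (fun x hx => ?_) ?_
    · rw [uIcc_of_le ht.2] at hx
      exact hu x ⟨ht.1.trans hx.1, hx.2⟩
    · refine ContinuousOn.intervalIntegrable ?_
      rw [uIcc_of_le ht.2]
      exact hu'.mono (Icc_subset_Icc_left ht.1)
  -- As `k` is only integrable, `v` need not be differentiable. The product rule is replaced by
  -- Fubini for u'(x) k(t) on the triangle t ≤ x.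
  let Φ : ℝ → ℝ → ℂ := fun x t => (Ici t).indicator (fun x => u' x * k t) x
  have hΦ : Integrable (Function.uncurry Φ)
      ((volume.restrict (Ioc a b)).prod (volume.restrict (Ioc a b))) := by
    have h1 := Integrable.mul_prod huI hkI
    have : Function.uncurry Φ = {z : ℝ × ℝ | z.2 ≤ z.1}.indicator fun z => u' z.1 * k z.2 := by
      ext ⟨x, t⟩
      simp only [Function.uncurry, Φ, indicator, mem_Ici, mem_ofPred_eq]
    rw [this]
    exact h1.indicator (measurableSet_le measurable_snd measurable_fst)
  have hswap := integral_integral_swap hΦ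
  have hl : ∫ x in Ioc a b, ∫ t in Ioc a b, Φ x t = ∫ x in Ioc a b, u' x * ∫ t in a..x, k t := by
    refine setIntegral_congr_fun measurableSet_Ioc fun x hx => ?_
    have : ∀ t, Φ x t = (Iic x).indicator (fun t => u' x * k t) t := fun t => by
      simp only [Φ, indicator, mem_Ici, mem_Iic]
    simp only [this]
    rw [setIntegral_indicator measurableSet_Iic, Ioc_inter_Iic, min_eq_right hx.2,
      integral_const_mul, intervalIntegral.integral_of_le hx.1.le]
  have hr : ∫ t in Ioc a b, ∫ x in Ioc a b, Φ x t = ∫ t in Ioc a b, (u b * k t - u t * k t) := by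
    refine setIntegral_congr_fun measurableSet_Ioc fun t ht => ?_
    simp only [Φ]
    rw [setIntegral_indicator measurableSet_Ici]
    have : Ioc a b ∩ Ici t = Icc t b := by
      ext x
      simp only [mem_inter_iff, mem_Ioc, mem_Ici, mem_Icc]
      exact ⟨fun h => ⟨h.2, h.1.2⟩, fun h => ⟨⟨ht.1.trans_le h.1, h.2⟩, h.1⟩⟩
    rw [this, integral_Icc_eq_integral_Ioc, integral_mul_const,
      ← intervalIntegral.integral_of_le ht.2, ftc t ⟨ht.1.le, ht.2⟩]
    ring
  rw [hl, hr, integral_sub (hkI.const_mul _) hukI, integral_const_mul] at hswap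
  have e1 : ∫ x in a..b, (u' x * v x + u x * k x) =
      (∫ x in Ioc a b, u' x * v a) + (∫ x in Ioc a b, u' x * ∫ t in a..x, k t) +
        ∫ x in Ioc a b, u x * k x := by
    have i1 : IntegrableOn (fun x => u' x * v a) (Ioc a b) := huI.mul_const _
    have i2 : IntegrableOn (fun x => u' x * ∫ t in a..x, k t) (Ioc a b) :=
      ((hu'.mul hprim).integrableOn_Icc).mono_set Ioc_subset_Icc_self
    have i3 : IntegrableOn (fun x => u' x * v x) (Ioc a b) :=
      ((hu'.mul hvcont).integrableOn_Icc).mono_set Ioc_subset_Icc_self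
    rw [intervalIntegral.integral_of_le hab, integral_add i3 hukI, ← integral_add i1 i2]
    congr 1
    refine setIntegral_congr_fun measurableSet_Ioc fun x hx => ?_
    rw [← mul_add, ← hv x ⟨hx.1.le, hx.2⟩]
  rw [e1, hswap, integral_mul_const, ← intervalIntegral.integral_of_le hab,
    ← intervalIntegral.integral_of_le hab, ftc a ⟨le_rfl, hab⟩, hv b ⟨hab, le_rfl⟩]
  ring

/-- The potential `(-1/4 + α) x⁻²`. -/
def pot (α : ℂ) (x : ℝ) : ℂ := (-1 / 4 + α) * (1 / (x : ℂ) ^ 2)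

theorem continuousOn_pot (α : ℂ) : ContinuousOn (pot α) (Ioi 0) := by
  intro x hx
  have hx2 : (x : ℂ) ^ 2 ≠ 0 := pow_ne_zero _ (by exact_mod_cast (ne_of_gt hx))
  refine ContinuousAt.continuousWithinAt ?_
  unfold pot
  exact continuousAt_const.mul (continuousAt_const.div (by fun_prop) hx2)

/-- At α = 1/4 the operator is -∂². This is the reference case for regularity and decay as well as
the Dirichlet and Neumann case. -/
theorem pot_quarter (x : ℝ) : pot (1 / 4) x = 0 := by
  rw [pot]; norm_num

/-- `F` is continuously differentiable on `]0,∞[` with derivative `D`, which is locally absolutely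
continuous, and `-F'' + (-1/4 + α) x⁻² F = g`. -/
structure IsSol (α : ℂ) (g F D : ℝ → ℂ) : Prop where
  hasDerivAt : ∀ x, 0 < x → HasDerivAt F (D x) x
  intervalIntegrable : ∀ a b, 0 < a → 0 < b → IntervalIntegrable g volume a b
  sub_eq : ∀ a b, 0 < a → 0 < b → D b - D a = ∫ x in a..b, (pot α x * F x - g x)

theorem uIcc_subset_Ioi {a b : ℝ} (ha : 0 < a) (hb : 0 < b) : uIcc a b ⊆ Ioi 0 := fun _ hx =>
  (lt_min ha hb).trans_le hx.1

namespace IsSol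

variable {α : ℂ} {g F D : ℝ → ℂ}

theorem continuousOn (h : IsSol α g F D) : ContinuousOn F (Ioi 0) := fun x hx =>
  (h.hasDerivAt x hx).continuousAt.continuousWithinAt

theorem intervalIntegrable_rhs (h : IsSol α g F D) {a b : ℝ} (ha : 0 < a) (hb : 0 < b) :
    IntervalIntegrable (fun x => pot α x * F x - g x) volume a b :=
  (ContinuousOn.intervalIntegrable (((continuousOn_pot α).mul h.continuousOn).mono
    (uIcc_subset_Ioi ha hb))).sub (h.intervalIntegrable a b ha hb)

theorem continuousOn_deriv (h : IsSol α g F D) : ContinuousOn D (Ioi 0) := by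
  intro x hx
  have hx : 0 < x := hx
  have h1 : ContinuousOn (fun y => D (x / 2) + ∫ t in (x / 2)..y, (pot α t * F t - g t))
      (Icc (x / 2) (2 * x)) := by
    have := intervalIntegral.continuousOn_primitive_interval'
      (h.intervalIntegrable_rhs (half_pos hx) (by linarith : 0 < 2 * x)) left_mem_uIcc
    rw [uIcc_of_le (by linarith)] at this
    exact continuousOn_const.add this
  have h2 : ContinuousOn D (Icc (x / 2) (2 * x)) := h1.congr fun y hy => by
    simp only
    rw [← h.sub_eq _ _ (half_pos hx) ((half_pos hx).trans_le hy.1)]; ring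
  exact (h2.continuousAt (Icc_mem_nhds (by linarith) (by linarith))).continuousWithinAt

theorem congr_right {g' : ℝ → ℂ} (h : IsSol α g F D) (hg : g =ᵐ[halfLine] g') :
    IsSol α g' F D := by
  have hae : ∀ a b, 0 < a → 0 < b → ∀ᵐ x, x ∈ uIoc a b → g x = g' x := by
    intro a b ha hb
    filter_upwards [(ae_restrict_iff' measurableSet_Ioi).1 hg] with x hx hx'
    exact hx (uIcc_subset_Ioi ha hb (uIoc_subset_uIcc hx'))
  refine ⟨h.hasDerivAt, fun a b ha hb => ?_, fun a b ha hb => ?_⟩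
  · exact (h.intervalIntegrable a b ha hb).congr_ae
      ((ae_restrict_iff' measurableSet_uIoc).2 (hae a b ha hb))
  · rw [h.sub_eq a b ha hb]
    refine intervalIntegral.integral_congr_ae ?_
    filter_upwards [hae a b ha hb] with x hx hx'
    rw [hx hx']

/-- Moving the potential to the right-hand side. -/
theorem free (h : IsSol α g F D) : IsSol (1 / 4) (fun x => g x - pot α x * F x) F D := by
  refine ⟨h.hasDerivAt, fun a b ha hb => ?_, fun a b ha hb => ?_⟩
  · have := (h.intervalIntegrable_rhs ha hb).neg
    convert this using 1
    ext x
    simp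
  · rw [h.sub_eq a b ha hb]
    simp only [pot_quarter, zero_mul, zero_sub, neg_sub]

theorem of_hasDerivAt {S : ℝ → ℂ} (h1 : ∀ x, 0 < x → HasDerivAt F (D x) x)
    (h2 : ∀ x, 0 < x → HasDerivAt D (S x) x) (hS : ContinuousOn S (Ioi 0)) (α : ℂ) :
    IsSol α (fun x => pot α x * F x - S x) F D := by
  have hF : ContinuousOn F (Ioi 0) := fun x hx => (h1 x hx).continuousAt.continuousWithinAt
  refine ⟨h1, fun a b ha hb => ?_, fun a b ha hb => ?_⟩
  · exact ContinuousOn.intervalIntegrable ((((continuousOn_pot α).mul hF).sub hS).mono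
      (uIcc_subset_Ioi ha hb))
  · simp only [sub_sub_cancel]
    refine (intervalIntegral.integral_eq_sub_of_hasDerivAt (fun x hx => h2 x ?_) ?_).symm
    · exact uIcc_subset_Ioi ha hb hx
    · exact ContinuousOn.intervalIntegrable (hS.mono (uIcc_subset_Ioi ha hb))

end IsSol

/-- The Wronskian `F₁ F₂' - F₁' F₂`. -/
def wronskian (F₁ D₁ F₂ D₂ : ℝ → ℂ) (x : ℝ) : ℂ := F₁ x * D₂ x - D₁ x * F₂ x

/-- Lagrange's identity on a compact interval: in the two integrations by parts the terms D₁ D₂ and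
the potential terms cancel. -/
theorem IsSol.wronskian_sub {α : ℂ} {g₁ F₁ D₁ g₂ F₂ D₂ : ℝ → ℂ} (h₁ : IsSol α g₁ F₁ D₁)
    (h₂ : IsSol α g₂ F₂ D₂) {a b : ℝ} (ha : 0 < a) (hab : a ≤ b) :
    wronskian F₁ D₁ F₂ D₂ b - wronskian F₁ D₁ F₂ D₂ a =
      ∫ x in a..b, (g₁ x * F₂ x - F₁ x * g₂ x) := by
  have hb : 0 < b := ha.trans_le hab
  have hsub : Icc a b ⊆ Ioi 0 := fun x hx => ha.trans_le hx.1
  have e1 := integral_deriv_mul_primitive hab (fun x hx => h₁.hasDerivAt x (hsub hx))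
    (h₁.continuousOn_deriv.mono hsub) (h₂.intervalIntegrable_rhs ha hb) (v := D₂)
    (fun x hx => by rw [← h₂.sub_eq a x ha (hsub hx)]; ring)
  have e2 := integral_deriv_mul_primitive hab (fun x hx => h₂.hasDerivAt x (hsub hx))
    (h₂.continuousOn_deriv.mono hsub) (h₁.intervalIntegrable_rhs ha hb) (v := D₁)
    (fun x hx => by rw [← h₁.sub_eq a x ha (hsub hx)]; ring)
  have i : ∀ {g F D g' F' D' : ℝ → ℂ}, IsSol α g F D → IsSol α g' F' D' → IntervalIntegrable
      (fun x => D x * D' x + F x * (pot α x * F' x - g' x)) volume a b := by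
    intro g F D g' F' D' h h'
    refine IntervalIntegrable.add ?_ ?_
    · exact ContinuousOn.intervalIntegrable ((h.continuousOn_deriv.mul h'.continuousOn_deriv).mono
        (uIcc_subset_Ioi ha hb))
    · exact (h'.intervalIntegrable_rhs ha hb).continuousOn_mul
        (h.continuousOn.mono (uIcc_subset_Ioi ha hb))
  have e3 : wronskian F₁ D₁ F₂ D₂ b - wronskian F₁ D₁ F₂ D₂ a =
      (F₁ b * D₂ b - F₁ a * D₂ a) - (F₂ b * D₁ b - F₂ a * D₁ a) := by
    simp only [wronskian]; ring
  rw [e3, e1, e2, ← intervalIntegral.integral_sub (i h₁ h₂) (i h₂ h₁)]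
  congr 1
  ext x
  ring

/-! ### Test functions -/

theorem IsTest.exists_Ioo {φ : ℝ → ℂ} (h : IsTest φ) :
    ∃ a b, 0 < a ∧ a < b ∧ tsupport φ ⊆ Ioo a b := by
  rcases (tsupport φ).eq_empty_or_nonempty with he | hne
  · exact ⟨1, 2, one_pos, one_lt_two, by simp [he]⟩
  obtain ⟨p, hp, hp'⟩ := IsCompact.exists_isLeast h.compact hne
  obtain ⟨q, hq, hq'⟩ := IsCompact.exists_isGreatest h.compact hne
  have hp0 : 0 < p := h.supp hp
  have hpq : p ≤ q := hp' hq
  refine ⟨p / 2, q + 1, half_pos hp0, by linarith, fun x hx => ⟨?_, ?_⟩⟩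
  · have := hp' hx; linarith
  · have := hq' hx; linarith

theorem setIntegral_mul_eq_intervalIntegral {a b : ℝ} (ha : 0 < a) (hab : a < b) (u : ℝ → ℂ)
    {v : ℝ → ℂ} (hv : ∀ x ∉ Ioo a b, v x = 0) :
    ∫ x in Ioi (0 : ℝ), u x * v x = ∫ x in a..b, u x * v x := by
  rw [intervalIntegral.integral_of_le hab.le]
  refine setIntegral_eq_of_subset_of_forall_sdiff_eq_zero measurableSet_Ioi
    (fun x hx => ha.trans hx.1) fun x hx => ?_
  rw [hv x fun h => hx.2 ⟨h.1, h.2.le⟩, mul_zero]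

theorem IsTest.conj {φ : ℝ → ℂ} (h : IsTest φ) : IsTest fun x => starRingEnd ℂ (φ x) := by
  refine ⟨Complex.conjCLE.contDiff.comp h.smooth, h.compact.comp_left (map_zero _), ?_⟩
  refine (closure_mono fun x hx => ?_).trans h.supp
  simpa using hx

theorem deriv_conj (φ : ℝ → ℂ) (x : ℝ) :
    deriv (fun x => starRingEnd ℂ (φ x)) x = starRingEnd ℂ (deriv φ x) := by
  have := deriv.star (𝕜 := ℝ) (f := φ) (x := x)
  exact this

theorem expr_conj (a : ℝ) (φ : ℝ → ℂ) (x : ℝ) :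
    expr (a : ℂ) (fun x => starRingEnd ℂ (φ x)) x = starRingEnd ℂ (expr (a : ℂ) φ x) := by
  have h4 : starRingEnd ℂ (4 : ℂ) = 4 := Complex.conj_ofNat 4
  have h1 : deriv (fun x => starRingEnd ℂ (φ x)) = fun x => starRingEnd ℂ (deriv φ x) :=
    funext (deriv_conj φ)
  simp only [expr, h1, deriv_conj, map_add, map_neg, map_mul, map_div₀, map_one, map_pow,
    Complex.conj_ofReal, h4]

/-- Test functions solve the equation with right-hand side `expr α φ`. -/
theorem IsTest.isSol {φ : ℝ → ℂ} (h : IsTest φ) (α : ℂ) :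
    IsSol α (InverseSquare.expr α φ) φ (_root_.deriv φ) := by
  have := IsSol.of_hasDerivAt (fun x _ => (h.differentiable x).hasDerivAt)
    (fun x _ => (h.deriv.differentiable x).hasDerivAt)
    (h.deriv.deriv.smooth.continuous.continuousOn) α
  convert this using 1
  ext x
  simp only [InverseSquare.expr, pot]
  ring

theorem isTest_of_contDiffOn {φ : ℝ → ℂ} {a b : ℝ} (ha : 0 < a)
    (hφ : ContDiffOn ℝ ∞ φ (Ioi 0)) (h0 : ∀ x ∉ Icc a b, φ x = 0) : IsTest φ := by
  have hsupp : tsupport φ ⊆ Icc a b := closure_minimal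
    (fun x hx => by by_contra hn; exact hx (h0 x hn)) isClosed_Icc
  refine ⟨contDiff_iff_contDiffAt.2 fun x => ?_,
    HasCompactSupport.of_support_subset_isCompact isCompact_Icc (subset_tsupport φ |>.trans hsupp),
    hsupp.trans fun x hx => ha.trans_le hx.1⟩
  by_cases hx : 0 < x
  · exact hφ.contDiffAt (Ioi_mem_nhds hx)
  · refine (contDiffAt_const (c := (0 : ℂ))).congr_of_eventuallyEq ?_
    filter_upwards [Iio_mem_nhds (lt_of_le_of_lt (not_lt.1 hx) ha)] with y hy
    exact h0 y fun h => absurd h.1 (not_le.2 hy)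

/-- A test function with vanishing integral is the derivative of a test function. -/
theorem IsTest.exists_primitive {χ : ℝ → ℂ} (h : IsTest χ)
    (h0 : ∫ x in Ioi (0 : ℝ), χ x = 0) : ∃ φ, IsTest φ ∧ _root_.deriv φ = χ := by
  obtain ⟨a, b, ha, hab, hs⟩ := h.exists_Ioo
  have hz : ∀ x ∉ Ioo a b, χ x = 0 := fun x hx => image_eq_zero_of_notMem_tsupport fun h' => hx (hs h')
  have hcont := h.smooth.continuous
  have hd : ∀ x, HasDerivAt (fun x => ∫ t in a..x, χ t) (χ x) x := fun x =>
    intervalIntegral.integral_hasDerivAt_right (hcont.intervalIntegrable _ _)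
      (hcont.stronglyMeasurableAtFilter _ _) hcont.continuousAt
  have hder : _root_.deriv (fun x => ∫ t in a..x, χ t) = χ := funext fun x => (hd x).deriv
  have hI : ∫ t in a..b, χ t = 0 := by
    have := setIntegral_mul_eq_intervalIntegral ha hab (fun _ => 1) hz
    simp only [one_mul] at this
    rw [← this, h0]
  refine ⟨fun x => ∫ t in a..x, χ t, isTest_of_contDiffOn (a := a) (b := b) ha ?_ ?_, hder⟩
  · refine ContDiff.contDiffOn (contDiff_infty_iff_deriv.2 ⟨fun x => (hd x).differentiableAt, ?_⟩)
    rw [hder]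
    exact h.smooth
  · intro x hx
    have hzero : ∀ p q : ℝ, (∀ t ∈ uIoc p q, t ∉ Ioo a b) → ∫ t in p..q, χ t = 0 := by
      intro p q hpq
      refine intervalIntegral.integral_zero_ae (ae_of_all _ fun t ht => hz t (hpq t ht))
    by_cases hxa : x < a
    · refine hzero _ _ fun t ht ht' => ?_
      rw [uIoc_of_ge hxa.le] at ht
      exact absurd ht.2 (not_le.2 ht'.1)
    · have hxb : b < x := by
        by_contra hn
        exact hx ⟨not_lt.1 hxa, not_lt.1 hn⟩
      rw [← intervalIntegral.integral_add_adjacent_intervals (hcont.intervalIntegrable a b)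
        (hcont.intervalIntegrable b x), hI, zero_add]
      refine hzero _ _ fun t ht ht' => ?_
      rw [uIoc_of_le hxb.le] at ht
      exact absurd ht.1 (not_lt.2 ht'.2.le)

theorem exists_isTest_integral_eq_one : ∃ χ : ℝ → ℂ, IsTest χ ∧ ∫ x in Ioi (0 : ℝ), χ x = 1 := by
  let B : ContDiffBump (2 : ℝ) := ⟨1 / 2, 1, by norm_num, by norm_num⟩
  have hsupp : ∀ x ∉ Ioo (1 : ℝ) 3, B.normed volume x = 0 := by
    intro x hx
    rw [← Function.notMem_support, B.support_normed_eq, Real.ball_eq_Ioo]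
    convert hx using 2
    norm_num [B]
  have ht : IsTest fun x => ((B.normed volume x : ℝ) : ℂ) := by
    refine isTest_of_contDiffOn (a := 1) (b := 3) one_pos ?_ ?_
    · exact (Complex.ofRealCLM.contDiff.comp B.contDiff_normed).contDiffOn
    · intro x hx
      rw [hsupp x fun h => hx ⟨h.1.le, h.2.le⟩, Complex.ofReal_zero]
  refine ⟨_, ht, ?_⟩
  rw [setIntegral_eq_integral_of_forall_compl_eq_zero, integral_complex_ofReal, B.integral_normed,
    Complex.ofReal_one]
  intro x hx
  rw [hsupp x fun h => hx (mem_Ioi.2 (by linarith [h.1])), Complex.ofReal_zero]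

/-- The fundamental lemma of the calculus of variations on the half-line. -/
theorem ae_eq_zero_of_test {u : ℝ → ℂ} (hu : LocallyIntegrableOn u (Ioi (0 : ℝ)) volume)
    (h : ∀ φ, IsTest φ → ∫ x in Ioi (0 : ℝ), u x * φ x = 0) : u =ᵐ[halfLine] 0 := by
  refine (ae_restrict_iff' measurableSet_Ioi).2
    (isOpen_Ioi.ae_eq_zero_of_integral_contDiff_smul_eq_zero hu fun g hg hc hs => ?_)
  have ht : IsTest fun x => (g x : ℂ) :=
    ⟨Complex.ofRealCLM.contDiff.comp hg, hc.comp_left Complex.ofReal_zero,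
      (closure_mono fun x hx => by simpa using hx).trans hs⟩
  rw [← h _ ht, ← setIntegral_eq_integral_of_forall_compl_eq_zero (s := Ioi (0 : ℝ))]
  · refine integral_congr_ae (ae_of_all _ fun x => ?_)
    simp [mul_comm]
  · intro x hx
    rw [image_eq_zero_of_notMem_tsupport fun h' => hx (hs h'), zero_smul]

theorem IsTest.integrable_mul {φ u : ℝ → ℂ} (h : IsTest φ)
    (hu : LocallyIntegrableOn u (Ioi (0 : ℝ)) volume) :
    IntegrableOn (fun x => u x * φ x) (Ioi 0) volume := by
  obtain ⟨a, b, ha, hab, hs⟩ := h.exists_Ioo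
  have hsub : Icc a b ⊆ Ioi 0 := fun x hx => ha.trans_le hx.1
  have h1 : IntegrableOn u (Icc a b) := hu.integrableOn_compact_subset hsub isCompact_Icc
  have h2 : IntegrableOn (fun x => u x * φ x) (Icc a b) :=
    h1.mul_continuousOn h.smooth.continuous.continuousOn isCompact_Icc
  refine h2.of_forall_sdiff_eq_zero measurableSet_Ioi fun x hx => ?_
  rw [image_eq_zero_of_notMem_tsupport fun h' => hx.2 ⟨(hs h').1.le, (hs h').2.le⟩, mul_zero]

/-- A functional on test functions which vanishes on derivatives is a multiple of the integral. -/
theorem exists_eq_mul_integral (L : (ℝ → ℂ) → ℂ)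
    (hL : ∀ φ ψ : ℝ → ℂ, IsTest φ → IsTest ψ → ∀ c : ℂ, L (φ + c • ψ) = L φ + c * L ψ)
    (h0 : ∀ φ, IsTest φ → L (deriv φ) = 0) :
    ∃ c : ℂ, ∀ χ, IsTest χ → L χ = c * ∫ x in Ioi (0 : ℝ), χ x := by
  obtain ⟨χ₀, hχ₀, hI⟩ := exists_isTest_integral_eq_one
  refine ⟨L χ₀, fun χ hχ => ?_⟩
  set r := ∫ x in Ioi (0 : ℝ), χ x
  -- Subtracting the multiple of `χ₀` with the same integral leaves a derivative of a test function,
  -- on which the functional vanishes.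
  have ht : IsTest (χ + (-r) • χ₀) := hχ.add (hχ₀.smul _)
  have i : ∀ {φ}, IsTest φ → IntegrableOn φ (Ioi (0 : ℝ)) volume := fun {φ} h => by
    exact (h.smooth.continuous.integrable_of_hasCompactSupport h.compact).integrableOn
  obtain ⟨φ, hφ, hd⟩ := ht.exists_primitive (by
    simp only [Pi.add_apply, Pi.smul_apply, smul_eq_mul]
    rw [integral_add (i hχ) ((i hχ₀).const_mul (-r)), integral_const_mul, hI]
    simp [r])
  have := h0 φ hφ
  rw [hd, hL χ χ₀ hχ hχ₀] at this
  linear_combination this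

/-- A locally integrable function with vanishing weak derivative is constant. -/
theorem exists_ae_eq_const {u : ℝ → ℂ} (hu : LocallyIntegrableOn u (Ioi (0 : ℝ)) volume)
    (h : ∀ φ, IsTest φ → ∫ x in Ioi (0 : ℝ), u x * deriv φ x = 0) :
    ∃ c : ℂ, u =ᵐ[halfLine] fun _ => c := by
  obtain ⟨c, hc⟩ := exists_eq_mul_integral (fun χ => ∫ x in Ioi (0 : ℝ), u x * χ x)
    (fun φ ψ hφ hψ c => by
      rw [← integral_const_mul, ← integral_add (hφ.integrable_mul hu)
        ((hψ.integrable_mul hu).const_mul c)]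
      congr 1
      ext x
      simp only [Pi.add_apply, Pi.smul_apply, smul_eq_mul]
      ring) h
  have hloc : LocallyIntegrableOn (fun _ : ℝ => c) (Ioi (0 : ℝ)) volume :=
    (locallyIntegrable_const c).locallyIntegrableOn _
  refine ⟨c, ?_⟩
  have := ae_eq_zero_of_test (u := fun x => u x - c) (hu.sub hloc) fun φ hφ => by
    simp only [sub_mul]
    rw [integral_sub (hφ.integrable_mul hu) (hφ.integrable_mul hloc), hc φ hφ, integral_const_mul,
      sub_self]
  filter_upwards [this] with x hx
  exact sub_eq_zero.1 hx

/-- A locally integrable function with vanishing second weak derivative is affine. -/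
theorem exists_ae_eq_affine {u : ℝ → ℂ} (hu : LocallyIntegrableOn u (Ioi (0 : ℝ)) volume)
    (h : ∀ φ, IsTest φ → ∫ x in Ioi (0 : ℝ), u x * deriv (deriv φ) x = 0) :
    ∃ c d : ℂ, u =ᵐ[halfLine] fun x => c + d * x := by
  obtain ⟨d, hd⟩ := exists_eq_mul_integral (fun χ => ∫ x in Ioi (0 : ℝ), u x * deriv χ x)
    (fun φ ψ hφ hψ c => by
      rw [← integral_const_mul, ← integral_add (hφ.deriv.integrable_mul hu)
        ((hψ.deriv.integrable_mul hu).const_mul c)]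
      congr 1
      ext x
      rw [deriv_add (hφ.differentiable x) ((hψ.smul c).differentiable x),
        deriv_const_smul c (hψ.differentiable x), smul_eq_mul]
      ring) h
  have hloc : LocallyIntegrableOn (fun x : ℝ => d * (x : ℂ)) (Ioi (0 : ℝ)) volume :=
    (Continuous.locallyIntegrable (by fun_prop)).locallyIntegrableOn _
  -- Here `d` is minus the weak derivative of `u`, so adding d x makes the weak derivative zero.
  obtain ⟨c, hc⟩ := exists_ae_eq_const (u := fun x => u x + d * x) (hu.add hloc) fun φ hφ => by
    simp only [add_mul]
    rw [integral_add (hφ.deriv.integrable_mul hu) (hφ.deriv.integrable_mul hloc), hd φ hφ]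
    obtain ⟨a, b, ha, hab, hs⟩ := hφ.exists_Ioo
    have e1 := setIntegral_mul_eq_intervalIntegral ha hab (fun x => d * (x : ℂ)) (v := deriv φ)
      fun x hx => image_eq_zero_of_notMem_tsupport fun h' => hx (hs (tsupport_deriv_subset h'))
    have e2 := setIntegral_mul_eq_intervalIntegral ha hab (fun x => d) (v := φ)
      fun x hx => image_eq_zero_of_notMem_tsupport fun h' => hx (hs h')
    rw [← integral_const_mul, e1, e2, ← intervalIntegral.integral_add]
    · have hz : ∀ x ∉ Ioo a b, φ x = 0 := fun x hx =>
        image_eq_zero_of_notMem_tsupport fun h' => hx (hs h')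
      rw [intervalIntegral.integral_eq_sub_of_hasDerivAt (f := fun x : ℝ => d * (x : ℂ) * φ x)]
      · rw [hz a (by simp), hz b (by simp)]; simp
      · intro x _
        have h1 : HasDerivAt (fun x : ℝ => d * (x : ℂ)) (d * 1) x :=
          (HasDerivAt.ofReal_comp (hasDerivAt_id x)).const_mul d
        exact (h1.mul (hφ.differentiable x).hasDerivAt).congr_deriv (by ring)
      · have := hφ.smooth.continuous
        have := hφ.deriv.smooth.continuous
        exact Continuous.intervalIntegrable (by fun_prop) _ _
    · have := hφ.smooth.continuous
      exact Continuous.intervalIntegrable (by fun_prop) _ _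
    · have := hφ.deriv.smooth.continuous
      exact Continuous.intervalIntegrable (by fun_prop) _ _
  refine ⟨c, -d, ?_⟩
  filter_upwards [hc] with x hx
  rw [← hx]
  ring

/-! ### Regularity of the elements of the maximal domain -/

theorem MemLp.locallyIntegrableOn_Ioi {f : ℝ → ℂ} (hf : MemLp f 2 halfLine) :
    LocallyIntegrableOn f (Ioi (0 : ℝ)) volume := by
  intro x hx
  have h0 : MemLp f 2 (halfLine.restrict (Icc (x / 2) (2 * x))) := hf.restrict _
  have hs : Icc (x / 2) (2 * x) ⊆ Ioi 0 := fun y hy => lt_of_lt_of_le (half_pos hx) hy.1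
  rw [Measure.restrict_restrict measurableSet_Icc, inter_eq_left.2 hs] at h0
  have h1 : IntegrableOn f (Icc (x / 2) (2 * x)) volume := h0.integrable (by norm_num)
  have hx' : (0 : ℝ) < x := hx
  exact ⟨_, mem_nhdsWithin_of_mem_nhds (Icc_mem_nhds (by linarith) (by linarith)), h1⟩

theorem intervalIntegrable_of_locallyIntegrableOn {f : ℝ → ℂ}
    (hf : LocallyIntegrableOn f (Ioi (0 : ℝ)) volume) {a b : ℝ} (ha : 0 < a) (hb : 0 < b) :
    IntervalIntegrable f volume a b :=
  (hf.integrableOn_compact_subset (uIcc_subset_Ioi ha hb) isCompact_uIcc).intervalIntegrable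

/-- Solutions are weak solutions. -/
theorem IsSol.integral_mul_expr {α : ℂ} {g F D : ℝ → ℂ} (h : IsSol α g F D) {φ : ℝ → ℂ}
    (hφ : IsTest φ) :
    ∫ x in Ioi (0 : ℝ), F x * expr α φ x = ∫ x in Ioi (0 : ℝ), g x * φ x := by
  obtain ⟨a, b, ha, hab, hs⟩ := hφ.exists_Ioo
  have hz : ∀ x ∉ Ioo a b, φ x = 0 := fun x hx =>
    image_eq_zero_of_notMem_tsupport fun h' => hx (hs h')
  have hz' : ∀ x ∉ Ioo a b, deriv φ x = 0 := fun x hx =>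
    image_eq_zero_of_notMem_tsupport fun h' => hx (hs (tsupport_deriv_subset h'))
  have hz'' : ∀ x ∉ Ioo a b, expr α φ x = 0 := fun x hx => by
    have : deriv (deriv φ) x = 0 := image_eq_zero_of_notMem_tsupport fun h' =>
      hx (hs (tsupport_deriv_subset (tsupport_deriv_subset h')))
    simp [expr, hz x hx, this]
  have hw := h.wronskian_sub (hφ.isSol α) ha hab.le
  simp only [wronskian, hz a (by simp), hz b (by simp), hz' a (by simp), hz' b (by simp), mul_zero,
    sub_zero] at hw
  rw [setIntegral_mul_eq_intervalIntegral ha hab _ hz,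
    setIntegral_mul_eq_intervalIntegral ha hab _ hz'']
  rw [intervalIntegral.integral_sub] at hw
  · exact (sub_eq_zero.1 hw.symm).symm
  · exact (h.intervalIntegrable a b ha (ha.trans hab)).mul_continuousOn
      hφ.smooth.continuous.continuousOn
  · exact ContinuousOn.intervalIntegrable ((h.continuousOn.mono
      (uIcc_subset_Ioi ha (ha.trans hab))).mul (hφ.expr α).smooth.continuous.continuousOn)

theorem IsSol.mem_maxGraph {α : ℂ} {g F D : ℝ → ℂ} (h : IsSol α g F D) {p : L2 × L2}
    (h1 : p.1 =ᵐ[halfLine] F) (h2 : p.2 =ᵐ[halfLine] g) : p ∈ maxGraph α := by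
  intro φ hφ
  rw [integral_congr_ae (h1.mono fun x hx => by simp only [hx] :
      (fun x => p.1 x * expr α φ x) =ᵐ[halfLine] fun x => F x * expr α φ x),
    integral_congr_ae (h2.mono fun x hx => by simp only [hx] :
      (fun x => p.2 x * φ x) =ᵐ[halfLine] fun x => g x * φ x)]
  exact h.integral_mul_expr hφ

/-- The twice iterated primitive. -/
theorem exists_isSol_quarter {k : ℝ → ℂ} (hk : LocallyIntegrableOn k (Ioi (0 : ℝ)) volume) :
    ∃ F D, IsSol (1 / 4) (fun x => -k x) F D := by
  set D : ℝ → ℂ := fun x => ∫ t in (1 : ℝ)..x, k t with hD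
  have hki : ∀ {a b}, 0 < a → 0 < b → IntervalIntegrable k volume a b := fun ha hb =>
    intervalIntegrable_of_locallyIntegrableOn hk ha hb
  have hDsub : ∀ a b, 0 < a → 0 < b → D b - D a = ∫ x in a..b, k x := fun a b ha hb =>
    intervalIntegral.integral_interval_sub_left (hki one_pos hb) (hki one_pos ha)
  have hDc : ∀ x, 0 < x → ContinuousAt D x := by
    intro x hx
    have h1 := intervalIntegral.continuousOn_primitive_interval'
      (hki (half_pos hx) (by linarith : 0 < 2 * x)) left_mem_uIcc
    rw [uIcc_of_le (by linarith)] at h1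
    have h2 : ContinuousOn D (Icc (x / 2) (2 * x)) :=
      (continuousOn_const.add h1 : ContinuousOn (fun y => D (x / 2) + ∫ t in (x / 2)..y, k t)
        (Icc (x / 2) (2 * x))).congr fun y hy => by
          change D y = D (x / 2) + ∫ t in (x / 2)..y, k t
          rw [← hDsub _ _ (half_pos hx) ((half_pos hx).trans_le hy.1)]; ring
    exact h2.continuousAt (Icc_mem_nhds (by linarith) (by linarith))
  have hDcont : ContinuousOn D (Ioi 0) := fun x hx => (hDc x hx).continuousWithinAt
  refine ⟨fun x => ∫ t in (1 : ℝ)..x, D t, D, fun x hx => ?_, fun a b ha hb => (hki ha hb).neg,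
    fun a b ha hb => ?_⟩
  · refine intervalIntegral.integral_hasDerivAt_right ?_ ?_ (hDc x hx)
    · exact ContinuousOn.intervalIntegrable (hDcont.mono (uIcc_subset_Ioi one_pos hx))
    · exact hDcont.stronglyMeasurableAtFilter isOpen_Ioi x hx
  · rw [hDsub a b ha hb]
    simp [pot_quarter, -one_div]

/-- Elements of the maximal graph have a regular representative. -/
theorem exists_isSol {α : ℂ} {p : L2 × L2} (hp : p ∈ maxGraph α) :
    ∃ F D, p.1 =ᵐ[halfLine] F ∧ IsSol α p.2 F D := by
  have hf := MemLp.locallyIntegrableOn_Ioi (Lp.memLp p.1)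
  have hg := MemLp.locallyIntegrableOn_Ioi (Lp.memLp p.2)
  have hVf : LocallyIntegrableOn (fun x => pot α x * p.1 x) (Ioi (0 : ℝ)) volume :=
    hf.continuousOn_mul (continuousOn_pot α) isOpen_Ioi.isLocallyClosed
  have hk : LocallyIntegrableOn (fun x => pot α x * p.1 x - p.2 x) (Ioi (0 : ℝ)) volume := hVf.sub hg
  obtain ⟨F₀, D₀, h₀⟩ := exists_isSol_quarter hk
  have hF₀ : LocallyIntegrableOn F₀ (Ioi (0 : ℝ)) volume :=
    h₀.continuousOn.locallyIntegrableOn measurableSet_Ioi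
  -- Weyl's lemma in dimension one: `F₀` is a second primitive of V f - g, hence f - F₀ has zero
  -- second weak derivative and is affine.
  obtain ⟨c, d, hcd⟩ := exists_ae_eq_affine (u := fun x => p.1 x - F₀ x) (hf.sub hF₀) (by
    intro φ hφ
    have e1 := h₀.integral_mul_expr hφ
    have e2 := hp φ hφ
    have i1 := hφ.deriv.deriv.integrable_mul hf
    have i2 := hφ.deriv.deriv.integrable_mul hF₀
    have i3 := hφ.integrable_mul hg
    have i4 := hφ.integrable_mul hVf
    have e3 : ∫ x in Ioi (0 : ℝ), p.1 x * expr α φ x =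
        -(∫ x in Ioi (0 : ℝ), p.1 x * deriv (deriv φ) x) +
          ∫ x in Ioi (0 : ℝ), pot α x * p.1 x * φ x := by
      rw [← integral_neg, ← integral_add (f := fun x => -(p.1 x * deriv (deriv φ) x)) i1.neg i4]
      congr 1
      ext x
      simp only [expr, pot]
      ring
    have e4 : ∫ x in Ioi (0 : ℝ), F₀ x * expr (1 / 4) φ x =
        -∫ x in Ioi (0 : ℝ), F₀ x * deriv (deriv φ) x := by
      rw [← integral_neg]
      congr 1
      ext x
      simp only [expr]
      ring
    have e5 : ∫ x in Ioi (0 : ℝ), -(pot α x * p.1 x - p.2 x) * φ x =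
        -(∫ x in Ioi (0 : ℝ), pot α x * p.1 x * φ x) + ∫ x in Ioi (0 : ℝ), p.2 x * φ x := by
      rw [← integral_neg, ← integral_add (f := fun x => -(pot α x * p.1 x * φ x)) i4.neg i3]
      congr 1
      ext x
      ring
    simp only [sub_mul]
    rw [integral_sub i1 i2]
    rw [e3] at e2
    rw [e4, e5] at e1
    linear_combination e1 - e2)
  have hae : p.1 =ᵐ[halfLine] fun x => F₀ x + (c + d * x) := by
    filter_upwards [hcd] with x hx
    linear_combination hx
  refine ⟨fun x => F₀ x + (c + d * x), fun x => D₀ x + d, hae, fun x hx => ?_,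
    fun a b ha hb => intervalIntegrable_of_locallyIntegrableOn hg ha hb, fun a b ha hb => ?_⟩
  · refine (h₀.hasDerivAt x hx).add ?_
    have h1 : HasDerivAt (fun x : ℝ => d * (x : ℂ)) (d * 1) x :=
      (HasDerivAt.ofReal_comp (hasDerivAt_id x)).const_mul d
    exact (h1.const_add c).congr_deriv (mul_one d)
  · rw [add_sub_add_right_eq_sub, h₀.sub_eq a b ha hb]
    refine intervalIntegral.integral_congr_ae ?_
    filter_upwards [(ae_restrict_iff' measurableSet_Ioi).1 hae] with x hx hx'
    rw [← hx (uIcc_subset_Ioi ha hb (uIoc_subset_uIcc hx')), pot_quarter]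
    ring

/-! ### Behaviour at infinity and the Lagrange identity -/

theorem tendsto_intervalIntegral_unit {w : ℝ → ℝ} (hw : IntegrableOn w (Ioi 0) volume) :
    Tendsto (fun x => ∫ t in x..(x + 1), w t) atTop (𝓝 0) := by
  have h1 := intervalIntegral_tendsto_integral_Ioi 0 hw tendsto_id
  have h2 := intervalIntegral_tendsto_integral_Ioi 0 hw (tendsto_atTop_add_const_right atTop 1
    (tendsto_id (α := ℝ)))
  have h3 := h2.sub h1
  rw [sub_self] at h3
  refine h3.congr' ?_
  filter_upwards [eventually_gt_atTop 0] with x hx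
  have i : ∀ {y : ℝ}, 0 < y → IntervalIntegrable w volume 0 y := fun {y} hy =>
    (intervalIntegrable_iff_integrableOn_Ioc_of_le hy.le).2 (hw.mono_set Ioc_subset_Ioi_self)
  simp only [id]
  rw [intervalIntegral.integral_interval_sub_left (i (by linarith)) (i hx)]

theorem tendsto_intervalIntegral_norm {f : ℝ → ℂ} (hf : MemLp f 2 halfLine) :
    Tendsto (fun x => ∫ t in x..(x + 1), ‖f t‖) atTop (𝓝 0) := by
  have hsq : IntegrableOn (fun x => ‖f x‖ ^ 2) (Ioi 0) volume := hf.integrable_norm_pow (by norm_num)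
  have h1 := tendsto_intervalIntegral_unit hsq
  have hloc := MemLp.locallyIntegrableOn_Ioi hf
  rw [Metric.tendsto_atTop] at h1 ⊢
  intro ε hε
  obtain ⟨N, hN⟩ := h1 (ε ^ 2 / 2) (by positivity)
  refine ⟨max N 1, fun x hx => ?_⟩
  have hx0 : 0 < x := lt_of_lt_of_le one_pos ((le_max_right _ _).trans hx)
  have h2 := hN x ((le_max_left _ _).trans hx)
  have hle : x ≤ x + 1 := by linarith
  have i1 : IntervalIntegrable (fun t => ‖f t‖) volume x (x + 1) :=
    (intervalIntegrable_of_locallyIntegrableOn hloc hx0 (by linarith)).norm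
  have i2 : IntervalIntegrable (fun t => ‖f t‖ ^ 2) volume x (x + 1) :=
    (intervalIntegrable_iff_integrableOn_Ioc_of_le hle).2
      (hsq.mono_set fun t ht => hx0.trans ht.1)
  -- Young's inequality y ≤ ε/2 + y²/(2ε) replaces Hölder. With the L² mass below ε²/2 the total is
  -- below ε/2 + ε/4.
  have h3 : ∫ t in x..(x + 1), ‖f t‖ ≤ ∫ t in x..(x + 1), (ε / 2 + 1 / (2 * ε) * ‖f t‖ ^ 2) := by
    refine intervalIntegral.integral_mono_on hle i1 (intervalIntegrable_const.add (i2.const_mul _))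
      fun t _ => ?_
    have : 0 ≤ (ε - ‖f t‖) ^ 2 / (2 * ε) := by positivity
    have h4 : (ε - ‖f t‖) ^ 2 / (2 * ε) = ε / 2 + 1 / (2 * ε) * ‖f t‖ ^ 2 - ‖f t‖ := by
      field_simp
      ring
    linarith
  rw [intervalIntegral.integral_add intervalIntegrable_const (i2.const_mul _),
    intervalIntegral.integral_const_mul, intervalIntegral.integral_const] at h3
  have h5 : 0 ≤ ∫ t in x..(x + 1), ‖f t‖ := intervalIntegral.integral_nonneg hle fun t _ => norm_nonneg _
  have h6 : 0 ≤ ∫ t in x..(x + 1), ‖f t‖ ^ 2 := intervalIntegral.integral_nonneg hle fun t _ => by positivity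
  rw [Real.dist_eq, sub_zero, abs_of_nonneg h5]
  rw [Real.dist_eq, sub_zero, abs_of_nonneg h6] at h2
  have h7 : 1 / (2 * ε) * ∫ t in x..(x + 1), ‖f t‖ ^ 2 < 1 / (2 * ε) * (ε ^ 2 / 2) :=
    mul_lt_mul_of_pos_left h2 (by positivity)
  have h8 : 1 / (2 * ε) * (ε ^ 2 / 2) = ε / 4 := by field_simp; ring
  simp only [add_sub_cancel_left, one_smul] at h3
  linarith

/-- Lagrange's identity on [x, x + 1] against a function vanishing to first order at x + 1 leaves
only the boundary term at x. This controls F and D at x by local integrals of F and g, with no a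
priori bound on D. The constants 1 and 6 fit the two cubics used later. -/
theorem IsSol.norm_boundary_le {α : ℂ} {g F D : ℝ → ℂ} (h : IsSol α g F D) {x : ℝ} (hx : 1 ≤ x)
    {u u' u'' : ℝ → ℂ} (hu : ∀ y, HasDerivAt u (u' y) y) (hu' : ∀ y, HasDerivAt u' (u'' y) y)
    (hu'' : Continuous u'') (hb : ∀ y ∈ Icc x (x + 1), ‖u y‖ ≤ 1)
    (hb'' : ∀ y ∈ Icc x (x + 1), ‖u'' y‖ ≤ 6) (h0 : u (x + 1) = 0) (h0' : u' (x + 1) = 0) :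
    ‖F x * u' x - D x * u x‖ ≤ (‖-1 / 4 + α‖ + 6) * (∫ t in x..(x + 1), ‖F t‖) +
      ∫ t in x..(x + 1), ‖g t‖ := by
  have hx0 : 0 < x := by linarith
  have hle : x ≤ x + 1 := by linarith
  have hx1 : 0 < x + 1 := by linarith
  have hw := h.free.wronskian_sub (IsSol.of_hasDerivAt (fun y _ => hu y) (fun y _ => hu' y)
    hu''.continuousOn (1 / 4)) hx0 hle
  simp only [wronskian, h0, h0', mul_zero, sub_zero, zero_sub, pot_quarter, zero_mul] at hw
  rw [← norm_neg, hw]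
  have iF : IntervalIntegrable (fun t => ‖F t‖) volume x (x + 1) :=
    ContinuousOn.intervalIntegrable (h.continuousOn.norm.mono (uIcc_subset_Ioi hx0 hx1))
  have ig : IntervalIntegrable (fun t => ‖g t‖) volume x (x + 1) :=
    (h.intervalIntegrable x (x + 1) hx0 hx1).norm
  rw [← intervalIntegral.integral_const_mul, ← intervalIntegral.integral_add (iF.const_mul _) ig]
  refine intervalIntegral.norm_integral_le_of_norm_le hle (ae_of_all _ fun t ht => ?_)
    ((iF.const_mul _).add ig)
  have ht' : t ∈ Icc x (x + 1) := ⟨ht.1.le, ht.2⟩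
  have ht1 : 1 ≤ t := hx.trans ht'.1
  have hpot : ‖pot α t‖ ≤ ‖-1 / 4 + α‖ := by
    rw [pot, norm_mul]
    refine mul_le_of_le_one_right (norm_nonneg _) ?_
    rw [norm_div, norm_one, norm_pow, Complex.norm_real, Real.norm_eq_abs, abs_of_pos (by linarith)]
    exact (div_le_one (by positivity)).2 (one_le_pow₀ ht1)
  calc ‖(g t - pot α t * F t) * u t - F t * -u'' t‖
      ≤ ‖(g t - pot α t * F t) * u t‖ + ‖F t * -u'' t‖ := norm_sub_le _ _
    _ ≤ (‖g t‖ + ‖-1 / 4 + α‖ * ‖F t‖) * 1 + ‖F t‖ * 6 := by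
        rw [norm_mul, norm_mul, norm_neg]
        refine add_le_add (mul_le_mul ?_ (hb t ht') (norm_nonneg _) (by positivity))
          (mul_le_mul_of_nonneg_left (hb'' t ht') (norm_nonneg _))
        refine (norm_sub_le _ _).trans (add_le_add_right ?_ _)
        rw [norm_mul]
        exact mul_le_mul_of_nonneg_right hpot (norm_nonneg _)
    _ = (‖-1 / 4 + α‖ + 6) * ‖F t‖ + ‖g t‖ := by ring

/-- A cubic polynomial in `y - x`, with its first two derivatives. -/
theorem hasDerivAt_cubic (x a b c d y : ℝ) :
    HasDerivAt (fun y : ℝ => ((a + b * (y - x) + c * (y - x) ^ 2 + d * (y - x) ^ 3 : ℝ) : ℂ))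
      ((b + (2 * c) * (y - x) + (3 * d) * (y - x) ^ 2 + 0 * (y - x) ^ 3 : ℝ) : ℂ) y := by
  refine HasDerivAt.ofReal_comp ?_
  have h1 : HasDerivAt (fun y : ℝ => y - x) 1 y := (hasDerivAt_id y).sub_const x
  refine ((((h1.const_mul b).const_add a).add ((h1.pow 2).const_mul c)).add
    ((h1.pow 3).const_mul d)).congr_deriv ?_
  norm_num
  ring

/-- A square integrable solution with square integrable right-hand side tends to zero at infinity,
together with its derivative. -/
theorem IsSol.tendsto_atTop {α : ℂ} {g F D : ℝ → ℂ} (h : IsSol α g F D) (hF : MemLp F 2 halfLine)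
    (hg : MemLp g 2 halfLine) : Tendsto F atTop (𝓝 0) ∧ Tendsto D atTop (𝓝 0) := by
  have hlim : Tendsto (fun x => (‖-1 / 4 + α‖ + 6) * (∫ t in x..(x + 1), ‖F t‖) +
      ∫ t in x..(x + 1), ‖g t‖) atTop (𝓝 0) := by
    simpa using ((tendsto_intervalIntegral_norm hF).const_mul (‖-1 / 4 + α‖ + 6)).add
      (tendsto_intervalIntegral_norm hg)
  have key : ∀ a b c d : ℝ, (∀ s ∈ Icc (0 : ℝ) 1, |a + b * s + c * s ^ 2 + d * s ^ 3| ≤ 1) →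
      (∀ s ∈ Icc (0 : ℝ) 1, |2 * c + 2 * (3 * d) * s| ≤ 6) → a + b + c + d = 0 →
      b + 2 * c + 3 * d = 0 →
      ∀ᶠ x in atTop, ‖F x * b - D x * a‖ ≤ (‖-1 / 4 + α‖ + 6) * (∫ t in x..(x + 1), ‖F t‖) +
        ∫ t in x..(x + 1), ‖g t‖ := by
    intro a b c d h1 h2 h3 h4
    filter_upwards [eventually_ge_atTop 1] with x hx
    -- The derivative of the cubic is again written as a cubic, with last coefficient 0, so the same
    -- lemma supplies the second derivative.
    have := h.norm_boundary_le hx (hasDerivAt_cubic x a b c d)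
      (hasDerivAt_cubic x b (2 * c) (3 * d) 0) (by fun_prop)
      (fun y hy => ?_) (fun y hy => ?_) ?_ ?_
    · simpa using this
    · rw [Complex.norm_real, Real.norm_eq_abs]
      exact h1 (y - x) ⟨by linarith [hy.1], by linarith [hy.2]⟩
    · rw [Complex.norm_real, Real.norm_eq_abs]
      have := h2 (y - x) ⟨by linarith [hy.1], by linarith [hy.2]⟩
      refine le_trans (le_of_eq ?_) this
      congr 1
      ring
    · norm_cast
      linear_combination h3
    · norm_cast
      linear_combination h4
  -- The Hermite cubics s(1 - s)² and (1 - s)²(1 + 2s) have a double zero at s = 1. The first has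
  -- value 0 and slope 1 at s = 0 and isolates F(x); the second has value 1 and slope 0 and isolates
  -- D(x).
  have b1 : ∀ s ∈ Icc (0 : ℝ) 1, |0 + 1 * s + -2 * s ^ 2 + 1 * s ^ 3| ≤ 1 := by
    intro s hs
    have h1 : 0 + 1 * s + -2 * s ^ 2 + 1 * s ^ 3 = s * (1 - s) ^ 2 := by ring
    have h2 := hs.1
    have h3 := hs.2
    have h4 : (1 - s) ^ 2 ≤ 1 := by nlinarith
    rw [h1, abs_of_nonneg (by positivity)]
    nlinarith [sq_nonneg (1 - s)]
  have b2 : ∀ s ∈ Icc (0 : ℝ) 1, |1 + 0 * s + -3 * s ^ 2 + 2 * s ^ 3| ≤ 1 := by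
    intro s hs
    have h1 : 1 + 0 * s + -3 * s ^ 2 + 2 * s ^ 3 = (1 - s) ^ 2 * (1 + 2 * s) := by ring
    have h2 := hs.1
    have h3 := hs.2
    rw [h1, abs_of_nonneg (by positivity)]
    nlinarith [mul_nonneg (sq_nonneg s) h2, mul_nonneg (sq_nonneg s) (sub_nonneg.2 h3)]
  constructor
  · rw [tendsto_zero_iff_norm_tendsto_zero]
    refine squeeze_zero' (Eventually.of_forall fun _ => norm_nonneg _) ?_ hlim
    filter_upwards [key 0 1 (-2) 1 b1 (fun s hs => by
      rw [abs_le]; constructor <;> linarith [hs.1, hs.2]) (by norm_num) (by norm_num)] with x hx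
    simpa using hx
  · rw [tendsto_zero_iff_norm_tendsto_zero]
    refine squeeze_zero' (Eventually.of_forall fun _ => norm_nonneg _) ?_ hlim
    filter_upwards [key 1 0 (-3) 2 b2 (fun s hs => by
      rw [abs_le]; constructor <;> linarith [hs.1, hs.2]) (by norm_num) (by norm_num)] with x hx
    simpa using hx

theorem tendsto_intervalIntegral_zero {w : ℝ → ℂ} (hw : IntegrableOn w (Ioc 0 1) volume) :
    Tendsto (fun a => ∫ t in a..1, w t) (𝓝[>] 0) (𝓝 (∫ t in (0 : ℝ)..1, w t)) := by
  have h1 : IntegrableOn w (uIcc 0 1) volume := by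
    rw [uIcc_of_le zero_le_one]
    exact (integrableOn_Icc_iff_integrableOn_Ioc).2 hw
  have h2 := intervalIntegral.continuousOn_primitive_interval_left h1 0 (left_mem_uIcc)
  refine h2.tendsto.mono_left ?_
  rw [uIcc_of_le zero_le_one, ← nhdsWithin_Ioc_eq_nhdsGT zero_lt_one]
  exact nhdsWithin_mono _ Ioc_subset_Icc_self

/-- **Lagrange identity**: the Wronskian of two elements of the maximal domain has a limit at
zero, which expresses the lack of symmetry. -/
theorem IsSol.tendsto_wronskian {α : ℂ} {g₁ F₁ D₁ g₂ F₂ D₂ : ℝ → ℂ} (h₁ : IsSol α g₁ F₁ D₁)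
    (h₂ : IsSol α g₂ F₂ D₂) (hF₁ : MemLp F₁ 2 halfLine) (hg₁ : MemLp g₁ 2 halfLine)
    (hF₂ : MemLp F₂ 2 halfLine) (hg₂ : MemLp g₂ 2 halfLine) :
    Tendsto (wronskian F₁ D₁ F₂ D₂) (𝓝[>] 0)
      (𝓝 (-∫ x in Ioi (0 : ℝ), (g₁ x * F₂ x - F₁ x * g₂ x))) := by
  have hi₀ : IntegrableOn (fun x => g₁ x * F₂ x - F₁ x * g₂ x) (Ioi 0) volume :=
    (hg₁.integrable_mul hF₂).sub (hF₁.integrable_mul hg₂)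
  have hinf : Tendsto (wronskian F₁ D₁ F₂ D₂) atTop (𝓝 0) := by
    have := ((h₁.tendsto_atTop hF₁ hg₁).1.mul (h₂.tendsto_atTop hF₂ hg₂).2).sub
      ((h₁.tendsto_atTop hF₁ hg₁).2.mul (h₂.tendsto_atTop hF₂ hg₂).1)
    rw [mul_zero, sub_zero] at this
    exact this
  -- There is no boundary term at infinity, so the Wronskian at 1 is minus the tail integral.
  have hone : wronskian F₁ D₁ F₂ D₂ 1 = -∫ x in Ioi (1 : ℝ), (g₁ x * F₂ x - F₁ x * g₂ x) := by
    have h3 := intervalIntegral_tendsto_integral_Ioi 1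
      (hi₀.mono_set (Ioi_subset_Ioi zero_le_one)) tendsto_id
    have h4 : Tendsto (fun b => ∫ x in (1 : ℝ)..b, (g₁ x * F₂ x - F₁ x * g₂ x)) atTop
        (𝓝 (0 - wronskian F₁ D₁ F₂ D₂ 1)) := by
      refine (hinf.sub_const _).congr' ?_
      filter_upwards [eventually_ge_atTop 1] with b hb
      exact h₁.wronskian_sub h₂ one_pos hb
    rw [tendsto_nhds_unique h3 h4]
    ring
  have h5 := tendsto_intervalIntegral_zero (hi₀.mono_set (Ioc_subset_Ioi_self : Ioc 0 1 ⊆ Ioi (0 : ℝ)))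
  have h6 : -∫ x in Ioi (0 : ℝ), (g₁ x * F₂ x - F₁ x * g₂ x) = wronskian F₁ D₁ F₂ D₂ 1 -
      ∫ x in (0 : ℝ)..1, (g₁ x * F₂ x - F₁ x * g₂ x) := by
    rw [hone, intervalIntegral.integral_of_le zero_le_one, ← Ioc_union_Ioi_eq_Ioi (zero_le_one (α := ℝ)),
      setIntegral_union (Ioc_disjoint_Ioi le_rfl) measurableSet_Ioi
        (hi₀.mono_set Ioc_subset_Ioi_self) (hi₀.mono_set (Ioi_subset_Ioi zero_le_one))]
    ring
  rw [h6]
  refine (tendsto_const_nhds.sub h5).congr' ?_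
  filter_upwards [Ioc_mem_nhdsGT zero_lt_one] with a ha
  rw [← h₁.wronskian_sub h₂ ha.1 ha.2]
  ring

/-! ### Adjoints of the minimal and maximal operators -/

theorem inner_eq_integral (f g : L2) :
    ⟪f, g⟫_ℂ = ∫ x in Ioi (0 : ℝ), starRingEnd ℂ (f x) * g x := by
  rw [L2.inner_def]
  refine integral_congr_ae (ae_of_all _ fun x => ?_)
  simp [mul_comm]

theorem coeFn_star_L2 (f : L2) : ⇑(star f) =ᵐ[halfLine] fun x => starRingEnd ℂ (f x) := by
  filter_upwards [Lp.coeFn_star f] with x hx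
  rw [hx]
  rfl

theorem mem_testGraph_toLp {α : ℂ} {φ : ℝ → ℂ} (h : IsTest φ) :
    (h.memLp.toLp φ, (h.expr α).memLp.toLp (expr α φ)) ∈ testGraph α :=
  ⟨φ, h, h.memLp.coeFn_toLp, (h.expr α).memLp.coeFn_toLp⟩

theorem dense_domain_LTest (α : ℂ) : Dense ((LTest α).domain : Set L2) := by
  rw [Submodule.dense_iff_topologicalClosure_eq_top, Submodule.topologicalClosure_eq_top_iff,
    Submodule.eq_bot_iff]
  intro f hf
  refine eq_zero_of_test fun φ hφ => ?_
  have hmem : hφ.conj.memLp.toLp _ ∈ (LTest α).domain := by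
    refine LinearPMap.mem_domain_of_mem_graph (y := (hφ.conj.expr α).memLp.toLp _) ?_
    rw [graph_LTest]
    exact mem_testGraph_toLp hφ.conj
  have := (Submodule.mem_orthogonal _ _).1 hf _ hmem
  rw [inner_eq_integral] at this
  rw [← this]
  refine integral_congr_ae ?_
  filter_upwards [hφ.conj.memLp.coeFn_toLp] with x hx
  rw [hx, Complex.conj_conj, mul_comm]

theorem dense_domain_LMin (α : ℂ) : Dense ((LMin α).domain : Set L2) :=
  (dense_domain_LTest α).mono (LTest α).le_closure.1

theorem graph_LMin (α : ℂ) : (LMin α).graph = (testGraph α).topologicalClosure := by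
  rw [LMin, ← (isClosable_LTest α).graph_closure_eq_closure_graph, graph_LTest]

theorem isClosed_LMin (α : ℂ) : (LMin α).IsClosed := (isClosable_LTest α).closure_isClosed

/-- The distributional equation tests bilinearly and the adjoint sesquilinearly. The two agree
because, for real α, the differential expression commutes with conjugation of the test function. -/
theorem adjoint_testGraph (a : ℝ) : (testGraph (a : ℂ)).adjoint = maxGraph (a : ℂ) := by
  ext ⟨f, g⟩
  rw [Submodule.mem_adjoint_iff]
  have key : ∀ φ u, (φ : L2 × L2).1 =ᵐ[halfLine] u → φ.2 =ᵐ[halfLine] expr (a : ℂ) u →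
      (⟪φ.2, f⟫_ℂ = ∫ x in Ioi (0 : ℝ), f x * expr (a : ℂ) (fun x => starRingEnd ℂ (u x)) x) ∧
      (⟪φ.1, g⟫_ℂ = ∫ x in Ioi (0 : ℝ), g x * starRingEnd ℂ (u x)) := by
    intro φ u h1 h2
    rw [inner_eq_integral, inner_eq_integral]
    constructor
    · refine integral_congr_ae ?_
      filter_upwards [h2] with x hx
      rw [hx, expr_conj, mul_comm]
    · refine integral_congr_ae ?_
      filter_upwards [h1] with x hx
      rw [hx, mul_comm]
  constructor
  · intro h φ hφ
    have h1 := h _ _ (mem_testGraph_toLp (α := (a : ℂ)) hφ.conj)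
    obtain ⟨k1, k2⟩ := key (hφ.conj.memLp.toLp _, (hφ.conj.expr a).memLp.toLp _) _
      hφ.conj.memLp.coeFn_toLp (hφ.conj.expr a).memLp.coeFn_toLp
    simp only at k1 k2 h1
    rw [k1, k2, sub_eq_zero] at h1
    simpa only [Complex.conj_conj] using h1
  · rintro h a b ⟨φ, hφ, h1, h2⟩
    obtain ⟨k1, k2⟩ := key (a, b) φ h1 h2
    simp only at k1 k2
    rw [k1, k2, sub_eq_zero]
    exact h _ hφ.conj

/-- The bilinear boundary form of two pairs. -/
def bform (p q : L2 × L2) : ℂ := ∫ x in Ioi (0 : ℝ), (p.2 x * q.1 x - p.1 x * q.2 x)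

theorem integrable_mul_L2 (f g : L2) : Integrable (fun x => f x * g x) halfLine :=
  (Lp.memLp f).integrable_mul (Lp.memLp g)

theorem bform_antisymm (p q : L2 × L2) : bform p q = -bform q p := by
  rw [bform, bform, ← integral_neg]
  congr 1
  ext x
  ring

/-- Conjugating the first argument turns the sesquilinear defect of symmetry into the bilinear form
whose values are limits of Wronskians. -/
theorem inner_sub_inner_eq_bform (p q : L2 × L2) :
    ⟪p.2, q.1⟫_ℂ - ⟪p.1, q.2⟫_ℂ = bform (star p) q := by
  have i : ∀ f g : L2, Integrable (fun x => starRingEnd ℂ (f x) * g x) halfLine := fun f g => by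
    refine (integrable_mul_L2 (star f) g).congr ?_
    filter_upwards [coeFn_star_L2 f] with x hx
    rw [hx]
  rw [inner_eq_integral, inner_eq_integral, ← integral_sub (i _ _) (i _ _), bform]
  refine integral_congr_ae ?_
  filter_upwards [coeFn_star_L2 p.1, coeFn_star_L2 p.2] with x h1 h2
  rw [Prod.fst_star, Prod.snd_star, h1, h2]

theorem star_mem_maxGraph {a : ℝ} {p : L2 × L2} (h : p ∈ maxGraph (a : ℂ)) :
    star p ∈ maxGraph (a : ℂ) := by
  intro φ hφ
  have h1 := congrArg (starRingEnd ℂ) (h _ hφ.conj)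
  rw [← integral_conj, ← integral_conj] at h1
  refine Eq.trans ?_ (h1.trans ?_)
  · refine integral_congr_ae ?_
    filter_upwards [coeFn_star_L2 p.1] with x hx
    rw [Prod.fst_star, hx, expr_conj, map_mul, Complex.conj_conj]
  · refine integral_congr_ae ?_
    filter_upwards [coeFn_star_L2 p.2] with x hx
    rw [Prod.snd_star, hx, map_mul, Complex.conj_conj]

theorem graph_LMin_le_maxGraph (α : ℂ) : (LMin α).graph ≤ maxGraph α := by
  rw [graph_LMin, ← graph_LMax]
  have h1 := LinearPMap.le_graph_of_le (LTest_le_LMax α)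
  rw [graph_LTest] at h1
  exact Submodule.topologicalClosure_minimal _ h1 (isClosed_LMax α)

theorem inner_eq_of_mem_graph_LMin {a : ℝ} {p q : L2 × L2} (hp : p ∈ (LMin (a : ℂ)).graph)
    (hq : q ∈ maxGraph (a : ℂ)) : ⟪p.2, q.1⟫_ℂ = ⟪p.1, q.2⟫_ℂ := by
  rw [← adjoint_testGraph, Submodule.mem_adjoint_iff] at hq
  rw [graph_LMin] at hp
  have hcl : IsClosed {p : L2 × L2 | ⟪p.2, q.1⟫_ℂ = ⟪p.1, q.2⟫_ℂ} :=
    isClosed_eq (by fun_prop) (by fun_prop)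
  exact closure_minimal (fun p hp => sub_eq_zero.1 (hq p.1 p.2 hp)) hcl hp

/-- The minimal graph is the kernel of the boundary form. -/
theorem mem_graph_LMin_iff {a : ℝ} {p : L2 × L2} :
    p ∈ (LMin (a : ℂ)).graph ↔ p ∈ maxGraph (a : ℂ) ∧ ∀ q ∈ maxGraph (a : ℂ), bform q p = 0 := by
  constructor
  · refine fun hp => ⟨graph_LMin_le_maxGraph _ hp, fun q hq => ?_⟩
    have h1 := inner_eq_of_mem_graph_LMin hp (star_mem_maxGraph hq)
    rw [← star_star q, ← inner_sub_inner_eq_bform, sub_eq_zero]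
    have h2 := congrArg (starRingEnd ℂ) h1
    rw [inner_conj_symm, inner_conj_symm] at h2
    exact h2.symm
  · rintro ⟨-, h⟩
    rw [graph_LMin]
    -- Vanishing of the boundary form against all of L^max says that the pair lies in the adjoint of
    -- L^max, which is the double adjoint of the test graph.
    refine adjoint_adjoint_le_topologicalClosure _ ?_
    rw [adjoint_testGraph, Submodule.mem_adjoint_iff]
    intro c d hcd
    have := h _ (star_mem_maxGraph hcd)
    rw [← inner_sub_inner_eq_bform] at this
    exact this

theorem graph_adjoint_LMin (a : ℝ) : (LMin (a : ℂ))†.graph = maxGraph (a : ℂ) := by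
  refine le_antisymm ?_ ?_
  · rw [← adjoint_testGraph, ← graph_LTest, ← LinearPMap.adjoint_graph_eq_graph_adjoint
      (dense_domain_LTest _)]
    exact graph_adjoint_anti (dense_domain_LTest _) (LTest (a : ℂ)).le_closure
  · rintro ⟨f, g⟩ h
    rw [mem_graph_adjoint_iff (dense_domain_LMin _)]
    exact fun c d hcd => inner_eq_of_mem_graph_LMin hcd h

theorem isHermitianOp_LMin (a : ℝ) : IsHermitianOp (LMin (a : ℂ)) := by
  refine ⟨dense_domain_LMin _, fun u v => ?_⟩
  exact inner_eq_of_mem_graph_LMin ((LMin (a : ℂ)).mem_graph u)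
    (graph_LMin_le_maxGraph _ ((LMin (a : ℂ)).mem_graph v))

/-- The boundary form in terms of representatives. -/
theorem tendsto_wronskian_bform {α : ℂ} {p q : L2 × L2} {F D G E : ℝ → ℂ}
    (hF : p.1 =ᵐ[halfLine] F) (hp : IsSol α p.2 F D) (hG : q.1 =ᵐ[halfLine] G)
    (hq : IsSol α q.2 G E) : Tendsto (wronskian F D G E) (𝓝[>] 0) (𝓝 (-bform p q)) := by
  have := hp.tendsto_wronskian hq ((memLp_congr_ae hF).1 (Lp.memLp _)) (Lp.memLp _)
    ((memLp_congr_ae hG).1 (Lp.memLp _)) (Lp.memLp _)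
  convert this using 3
  refine integral_congr_ae ?_
  filter_upwards [hF, hG] with x h1 h2
  rw [h1, h2]

/-! ### Homogeneous solutions -/

/-- `h` solves the homogeneous equation on `]0,∞[`, with derivative `h'`. -/
structure IsHom (α : ℂ) (h h' : ℝ → ℂ) : Prop where
  hasDerivAt : ∀ x, 0 < x → HasDerivAt h (h' x) x
  hasDerivAt' : ∀ x, 0 < x → HasDerivAt h' (pot α x * h x) x

theorem IsHom.continuousOn {α : ℂ} {h h' : ℝ → ℂ} (H : IsHom α h h') : ContinuousOn h (Ioi 0) :=
  fun x hx => (H.hasDerivAt x hx).continuousAt.continuousWithinAt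

theorem IsHom.continuousOn' {α : ℂ} {h h' : ℝ → ℂ} (H : IsHom α h h') : ContinuousOn h' (Ioi 0) :=
  fun x hx => (H.hasDerivAt' x hx).continuousAt.continuousWithinAt

theorem IsHom.isSol {α : ℂ} {h h' : ℝ → ℂ} (H : IsHom α h h') : IsSol α 0 h h' := by
  have := IsSol.of_hasDerivAt H.hasDerivAt H.hasDerivAt'
    ((continuousOn_pot α).mul H.continuousOn) α
  convert this using 1
  ext x
  simp

theorem hasDerivAt_cpow {x : ℝ} (hx : 0 < x) (s : ℂ) :
    HasDerivAt (fun x : ℝ => (x : ℂ) ^ s) (s / x * (x : ℂ) ^ s) x := by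
  have hx0 : (x : ℂ) ≠ 0 := by exact_mod_cast hx.ne'
  have h1 : HasDerivAt (fun z : ℂ => z ^ s) (s * (x : ℂ) ^ (s - 1) * 1) (x : ℂ) :=
    (hasDerivAt_id (x : ℂ)).cpow_const (Or.inl (by simpa using hx))
  refine h1.comp_ofReal.congr_deriv ?_
  rw [Complex.cpow_sub _ _ hx0, Complex.cpow_one]
  field_simp

/-- The exponent s = 1/2 + m solves the indicial equation s(s - 1) = m² - 1/4. -/
theorem isHom_cpow (m : ℂ) : IsHom (m ^ 2) (fun x : ℝ => (x : ℂ) ^ (1 / 2 + m))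
    (fun x : ℝ => (1 / 2 + m) / x * (x : ℂ) ^ (1 / 2 + m)) := by
  refine ⟨fun x hx => hasDerivAt_cpow hx _, fun x hx => ?_⟩
  have hx0 : (x : ℂ) ≠ 0 := by exact_mod_cast hx.ne'
  have h1 : HasDerivAt (fun x : ℝ => (1 / 2 + m) / (x : ℂ)) (-(1 / 2 + m) / (x : ℂ) ^ 2) x := by
    have h2 : HasDerivAt (fun z : ℂ => (1 / 2 + m) / z) ((0 * (x : ℂ) - (1 / 2 + m) * 1) / (x : ℂ) ^ 2)
        (x : ℂ) := (hasDerivAt_const (x : ℂ) (1 / 2 + m)).div (hasDerivAt_id (x : ℂ)) hx0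
    exact h2.comp_ofReal.congr_deriv (by ring)
  refine (h1.mul (hasDerivAt_cpow hx (1 / 2 + m))).congr_deriv ?_
  rw [pot]
  field_simp
  ring

/-- At m = 0 the indicial equation has a double root, and the second solution acquires a logarithm.
-/
theorem isHom_log : IsHom 0 (fun x : ℝ => (x : ℂ) ^ (1 / 2 : ℂ) * (Real.log x : ℂ))
    (fun x : ℝ => (x : ℂ) ^ (1 / 2 : ℂ) * ((Real.log x / 2 + 1 : ℝ) / x : ℂ)) := by
  have hl : ∀ x : ℝ, 0 < x → HasDerivAt (fun x : ℝ => (Real.log x : ℂ)) ((x : ℂ)⁻¹) x := by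
    intro x hx
    refine (HasDerivAt.ofReal_comp (Real.hasDerivAt_log hx.ne')).congr_deriv ?_
    push_cast
    rfl
  refine ⟨fun x hx => ?_, fun x hx => ?_⟩
  · have hx0 : (x : ℂ) ≠ 0 := by exact_mod_cast hx.ne'
    refine ((hasDerivAt_cpow hx (1 / 2)).mul (hl x hx)).congr_deriv ?_
    push_cast
    field_simp
  · have hx0 : (x : ℂ) ≠ 0 := by exact_mod_cast hx.ne'
    have hid : HasDerivAt (fun x : ℝ => (x : ℂ)) 1 x := HasDerivAt.ofReal_comp (hasDerivAt_id x)
    have h1 : HasDerivAt (fun x : ℝ => ((Real.log x / 2 + 1 : ℝ) : ℂ)) ((x : ℂ)⁻¹ / 2) x := by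
      refine (HasDerivAt.ofReal_comp
        (((Real.hasDerivAt_log hx.ne').div_const 2).add_const 1)).congr_deriv ?_
      push_cast
      rfl
    refine ((hasDerivAt_cpow hx (1 / 2)).mul (h1.div hid hx0)).congr_deriv ?_
    rw [pot, Pi.div_apply]
    push_cast
    field_simp
    ring

theorem memLp_cpow {s : ℂ} (hs : -1 / 2 < s.re) :
    MemLp (fun x : ℝ => (x : ℂ) ^ s) 2 (volume.restrict (Ioc 0 1)) := by
  have hc : ContinuousOn (fun x : ℝ => (x : ℂ) ^ s) (Ioc 0 1) := fun x hx =>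
    (hasDerivAt_cpow hx.1 s).continuousAt.continuousWithinAt
  rw [memLp_two_iff_integrable_sq_norm (hc.aestronglyMeasurable measurableSet_Ioc)]
  have h1 : IntegrableOn (fun x : ℝ => x ^ (2 * s.re)) (Ioc 0 1) volume :=
    (intervalIntegrable_iff_integrableOn_Ioc_of_le zero_le_one).1
      (intervalIntegral.intervalIntegrable_rpow' (by linarith))
  refine h1.congr_fun (fun x hx => ?_) measurableSet_Ioc
  simp only
  rw [Complex.norm_cpow_eq_rpow_re_of_pos hx.1, ← Real.rpow_natCast, ← Real.rpow_mul hx.1.le]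
  congr 1
  push_cast
  ring

theorem memLp_log : MemLp (fun x : ℝ => (x : ℂ) ^ (1 / 2 : ℂ) * (Real.log x : ℂ)) 2
    (volume.restrict (Ioc 0 1)) := by
  have hc : ContinuousOn (fun x : ℝ => (x : ℂ) ^ (1 / 2 : ℂ) * (Real.log x : ℂ)) (Ioc 0 1) :=
    isHom_log.continuousOn.mono Ioc_subset_Ioi_self
  refine MemLp.of_bound (hc.aestronglyMeasurable measurableSet_Ioc) 2 ?_
  refine (ae_restrict_iff' measurableSet_Ioc).2 (ae_of_all _ fun x hx => ?_)
  have h1 := Real.abs_log_mul_self_rpow_lt x (1 / 2) hx.1 hx.2 (by norm_num)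
  rw [norm_mul, Complex.norm_cpow_eq_rpow_re_of_pos hx.1, Complex.norm_real, Real.norm_eq_abs]
  rw [abs_mul, abs_of_pos (Real.rpow_pos_of_pos hx.1 _)] at h1
  have h2 : (1 / 2 : ℂ).re = 1 / 2 := by norm_num
  rw [h2, mul_comm]
  refine h1.le.trans (by norm_num)

/-- A pair of homogeneous solutions with constant nonzero Wronskian, both square integrable at
zero. -/
structure IsFund (α : ℂ) (h₁ h₁' h₂ h₂' : ℝ → ℂ) (w : ℂ) : Prop where
  left : IsHom α h₁ h₁'
  right : IsHom α h₂ h₂'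
  memLp_left : MemLp h₁ 2 (volume.restrict (Ioc 0 1))
  memLp_right : MemLp h₂ 2 (volume.restrict (Ioc 0 1))
  wronskian_eq : ∀ x, 0 < x → wronskian h₁ h₁' h₂ h₂' x = w
  ne_zero : w ≠ 0

theorem wronskian_cpow (m : ℂ) {x : ℝ} (hx : 0 < x) :
    wronskian (fun x : ℝ => (x : ℂ) ^ (1 / 2 + m))
      (fun x : ℝ => (1 / 2 + m) / x * (x : ℂ) ^ (1 / 2 + m)) (fun x : ℝ => (x : ℂ) ^ (1 / 2 + -m))
      (fun x : ℝ => (1 / 2 + -m) / x * (x : ℂ) ^ (1 / 2 + -m)) x = -2 * m := by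
  have hx0 : (x : ℂ) ≠ 0 := by exact_mod_cast hx.ne'
  have h1 : (x : ℂ) ^ (1 / 2 + m) * (x : ℂ) ^ (1 / 2 + -m) = x := by
    rw [← Complex.cpow_add _ _ hx0]
    ring_nf
    exact Complex.cpow_one _
  simp only [wronskian]
  have h2 : (x : ℂ) ^ (1 / 2 + m) * ((1 / 2 + -m) / x * (x : ℂ) ^ (1 / 2 + -m)) -
      (1 / 2 + m) / x * (x : ℂ) ^ (1 / 2 + m) * (x : ℂ) ^ (1 / 2 + -m) =
      (-2 * m) * (((x : ℂ) ^ (1 / 2 + m) * (x : ℂ) ^ (1 / 2 + -m)) / x) := by ring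
  rw [h2, h1, div_self hx0, mul_one]

theorem isFund_cpow {m : ℂ} (h1 : -1 < m.re) (h2 : m.re < 1) (hm : m ≠ 0) :
    IsFund (m ^ 2) (fun x : ℝ => (x : ℂ) ^ (1 / 2 + m))
      (fun x : ℝ => (1 / 2 + m) / x * (x : ℂ) ^ (1 / 2 + m)) (fun x : ℝ => (x : ℂ) ^ (1 / 2 + -m))
      (fun x : ℝ => (1 / 2 + -m) / x * (x : ℂ) ^ (1 / 2 + -m)) (-2 * m) := by
  have hhalf : (1 / 2 : ℂ).re = 1 / 2 := by norm_num
  refine ⟨isHom_cpow m, ?_, memLp_cpow ?_, memLp_cpow ?_, fun x hx => wronskian_cpow m hx, ?_⟩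
  · have := isHom_cpow (-m)
    rwa [neg_sq] at this
  · rw [Complex.add_re, hhalf]; linarith
  · rw [Complex.add_re, hhalf, Complex.neg_re]; linarith
  · simpa using hm

/-- For |Re m| < 1 both exponents 1/2 ± m have real part above -1/2, the limit circle case. At m = 0
the powers coincide and the Wronskian -2m degenerates, so √x log x takes over. -/
theorem exists_isFund {m : ℂ} (h1 : -1 < m.re) (h2 : m.re < 1) :
    ∃ h₂ h₂' w, IsFund (m ^ 2) (fun x : ℝ => (x : ℂ) ^ (1 / 2 + m))
      (fun x : ℝ => (1 / 2 + m) / x * (x : ℂ) ^ (1 / 2 + m)) h₂ h₂' w := by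
  by_cases hm : m = 0
  · subst hm
    refine ⟨_, fun x : ℝ => (x : ℂ) ^ (1 / 2 : ℂ) * ((Real.log x / 2 + 1 : ℝ) / x : ℂ), 1,
      isHom_cpow 0, ?_, memLp_cpow ?_, memLp_log, fun x hx => ?_, one_ne_zero⟩
    · have := isHom_log
      rwa [← zero_pow (M₀ := ℂ) two_ne_zero] at this
    · have hhalf : (1 / 2 : ℂ).re = 1 / 2 := by norm_num
      rw [add_zero, hhalf]; norm_num
    · have hx0 : (x : ℂ) ≠ 0 := by exact_mod_cast hx.ne'
      have h3 : (x : ℂ) ^ (1 / 2 : ℂ) * (x : ℂ) ^ (1 / 2 : ℂ) = x := by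
        rw [← Complex.cpow_add _ _ hx0]
        norm_num
      simp only [wronskian, add_zero]
      have h4 : (x : ℂ) ^ (1 / 2 : ℂ) * ((x : ℂ) ^ (1 / 2 : ℂ) * ((Real.log x / 2 + 1 : ℝ) / x : ℂ)) -
          1 / 2 / x * (x : ℂ) ^ (1 / 2 : ℂ) * ((x : ℂ) ^ (1 / 2 : ℂ) * (Real.log x : ℂ)) =
          ((x : ℂ) ^ (1 / 2 : ℂ) * (x : ℂ) ^ (1 / 2 : ℂ)) / x := by
        push_cast
        ring
      rw [h4, h3, div_self hx0]
  · exact ⟨_, _, _, isFund_cpow h1 h2 hm⟩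

/-! ### Cut-off homogeneous solutions -/

theorem memLp_of_continuousOn {u : ℝ → ℂ} {δ R : ℝ} (hδ : 0 < δ) (hc : ContinuousOn u (Ioi 0))
    (h0 : ∀ x, 0 < x → x ∉ Icc δ R → u x = 0) : MemLp u 2 halfLine := by
  rw [memLp_two_iff_integrable_sq_norm (hc.aestronglyMeasurable measurableSet_Ioi)]
  have hsub : Icc δ R ⊆ Ioi 0 := fun x hx => hδ.trans_le hx.1
  have h1 : IntegrableOn (fun x => ‖u x‖ ^ 2) (Icc δ R) volume :=
    ((hc.norm.pow 2).mono hsub).integrableOn_Icc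
  refine h1.of_forall_sdiff_eq_zero measurableSet_Ioi fun x hx => ?_
  rw [h0 x hx.1 hx.2]
  simp

theorem IsCutoff.exists_bounds {ξ : ℝ → ℝ} (hξ : IsCutoff ξ) :
    ∃ δ R, 0 < δ ∧ 1 < R ∧ (∀ x, |x| < δ → ξ x = 1) ∧ (∀ x, R < x → ξ x = 0) := by
  obtain ⟨δ, hδ, h1⟩ := Metric.eventually_nhds_iff.1 hξ.one
  obtain ⟨R, hR⟩ := hξ.compact.isBounded.subset_closedBall 0
  refine ⟨δ, max R 2, hδ, lt_of_lt_of_le one_lt_two (le_max_right _ _),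
    fun x hx => h1 (by simpa using hx), fun x hx => ?_⟩
  refine image_eq_zero_of_notMem_tsupport fun h => ?_
  have h2 := hR h
  rw [mem_closedBall_zero_iff, Real.norm_eq_abs] at h2
  have := (le_abs_self x).trans h2
  have := le_max_left R 2
  linarith

theorem IsCutoff.hasDerivAt {ξ : ℝ → ℝ} (hξ : IsCutoff ξ) (x : ℝ) :
    HasDerivAt (fun x => (ξ x : ℂ)) ((deriv ξ x : ℝ) : ℂ) x :=
  HasDerivAt.ofReal_comp ((hξ.smooth.differentiable (by simp)) x).hasDerivAt

theorem IsCutoff.hasDerivAt_deriv {ξ : ℝ → ℝ} (hξ : IsCutoff ξ) (x : ℝ) :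
    HasDerivAt (fun x => ((deriv ξ x : ℝ) : ℂ)) ((deriv (deriv ξ) x : ℝ) : ℂ) x :=
  HasDerivAt.ofReal_comp
    (((contDiff_infty_iff_deriv.1 hξ.smooth).2.differentiable (by simp)) x).hasDerivAt

/-- A pair in the maximal graph whose first component is the cut-off of `h`. -/
structure IsCutPair (ξ : ℝ → ℝ) (α : ℂ) (h : ℝ → ℂ) (q : L2 × L2) : Prop where
  mem : q ∈ maxGraph α
  ae_eq : q.1 =ᵐ[halfLine] fun x => h x * (ξ x : ℂ)

/-- The image of a cut-off homogeneous solution. -/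
def cutImage (ξ : ℝ → ℝ) (h h' : ℝ → ℂ) (x : ℝ) : ℂ :=
  -2 * h' x * ((deriv ξ x : ℝ) : ℂ) - h x * ((deriv (deriv ξ) x : ℝ) : ℂ)

theorem IsCutoff.isSol {ξ : ℝ → ℝ} (hξ : IsCutoff ξ) {α : ℂ} {h h' : ℝ → ℂ} (H : IsHom α h h') :
    IsSol α (cutImage ξ h h') (fun x => h x * (ξ x : ℂ))
      (fun x => h' x * (ξ x : ℂ) + h x * ((deriv ξ x : ℝ) : ℂ)) := by
  have c1 : Continuous fun x => (ξ x : ℂ) := Complex.continuous_ofReal.comp hξ.smooth.continuous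
  have c2 : Continuous fun x => ((deriv ξ x : ℝ) : ℂ) := Complex.continuous_ofReal.comp
    (contDiff_infty_iff_deriv.1 hξ.smooth).2.continuous
  have c3 : Continuous fun x => ((deriv (deriv ξ) x : ℝ) : ℂ) := Complex.continuous_ofReal.comp
    (contDiff_infty_iff_deriv.1 (contDiff_infty_iff_deriv.1 hξ.smooth).2).2.continuous
  have := IsSol.of_hasDerivAt (F := fun x => h x * (ξ x : ℂ))
    (fun x hx => (H.hasDerivAt x hx).mul (hξ.hasDerivAt x))
    (fun x hx => ((H.hasDerivAt' x hx).mul (hξ.hasDerivAt x)).add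
      ((H.hasDerivAt x hx).mul (hξ.hasDerivAt_deriv x)))
    (((((continuousOn_pot α).mul H.continuousOn).mul c1.continuousOn).add
      (H.continuousOn'.mul c2.continuousOn)).add ((H.continuousOn'.mul c2.continuousOn).add
        (H.continuousOn.mul c3.continuousOn))) α
  convert this using 1
  ext x
  simp only [cutImage]
  ring

theorem IsCutoff.cutImage_eq_zero {ξ : ℝ → ℝ} {δ R : ℝ} (h1 : ∀ x, |x| < δ → ξ x = 1)
    (h2 : ∀ x, R < x → ξ x = 0) {x : ℝ} (hx : 0 < x) (hx' : x ∉ Icc (δ / 2) (R + 1)) :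
    deriv ξ x = 0 ∧ deriv (deriv ξ) x = 0 := by
  have key : ∃ c : ℝ, ξ =ᶠ[𝓝 x] fun _ => c := by
    by_cases hxδ : x < δ / 2
    · refine ⟨1, ?_⟩
      filter_upwards [Ioo_mem_nhds (by linarith : -δ < x) (by linarith : x < δ)] with y hy
      exact h1 y (abs_lt.2 hy)
    · refine ⟨0, ?_⟩
      have : R + 1 < x := by
        by_contra hn
        exact hx' ⟨not_lt.1 hxδ, not_lt.1 hn⟩
      filter_upwards [Ioi_mem_nhds (by linarith : R < x)] with y hy
      exact h2 y hy
  obtain ⟨c, hc⟩ := key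
  have hd := hc.deriv
  have hdd := hd.deriv
  refine ⟨by rw [hd.eq_of_nhds]; simp, by rw [hdd.eq_of_nhds]; simp⟩

theorem memLp_mul_cutoff {ξ : ℝ → ℝ} (hξ : IsCutoff ξ) {h : ℝ → ℂ} (hc : ContinuousOn h (Ioi 0))
    (hL : MemLp h 2 (volume.restrict (Ioc 0 1))) :
    MemLp (fun x => h x * (ξ x : ℂ)) 2 halfLine := by
  obtain ⟨δ, R, hδ, hR, h1, h2⟩ := hξ.exists_bounds
  have c1 : Continuous fun x => (ξ x : ℂ) := Complex.continuous_ofReal.comp hξ.smooth.continuous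
  have hcc : ContinuousOn (fun x => h x * (ξ x : ℂ)) (Ioi 0) := hc.mul c1.continuousOn
  obtain ⟨C, hC⟩ := hξ.compact.exists_bound_of_continuous hξ.smooth.continuous
  have i1 : MemLp (fun x => h x * (ξ x : ℂ)) 2 (volume.restrict (Ioc 0 1)) := by
    refine hL.of_le_mul (c := C) ((hcc.mono Ioc_subset_Ioi_self).aestronglyMeasurable
      measurableSet_Ioc) (ae_of_all _ fun x => ?_)
    rw [norm_mul, mul_comm, Complex.norm_real]
    exact mul_le_mul_of_nonneg_right (hC x) (norm_nonneg _)
  rw [memLp_two_iff_integrable_sq_norm (hcc.aestronglyMeasurable measurableSet_Ioi)]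
  rw [memLp_two_iff_integrable_sq_norm ((hcc.mono Ioc_subset_Ioi_self).aestronglyMeasurable
      measurableSet_Ioc)] at i1
  have i2 : IntegrableOn (fun x => ‖h x * (ξ x : ℂ)‖ ^ 2) (Icc 1 R) volume :=
    ((hcc.norm.pow 2).mono fun x hx => one_pos.trans_le hx.1).integrableOn_Icc
  refine (IntegrableOn.union i1 i2).of_forall_sdiff_eq_zero measurableSet_Ioi fun x hx => ?_
  have hxR : R < x := by
    by_contra hn
    refine hx.2 ?_
    rcases le_total x 1 with h' | h'
    · exact Or.inl ⟨hx.1, h'⟩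
    · exact Or.inr ⟨h', not_lt.1 hn⟩
  rw [h2 x hxR]
  simp

/-- Cut-off homogeneous solutions belong to the maximal domain. -/
theorem exists_isCutPair {ξ : ℝ → ℝ} (hξ : IsCutoff ξ) {α : ℂ} {h h' : ℝ → ℂ} (H : IsHom α h h')
    (hL : MemLp h 2 (volume.restrict (Ioc 0 1))) :
    ∃ q, IsCutPair ξ α h q ∧ q.2 =ᵐ[halfLine] cutImage ξ h h' := by
  obtain ⟨δ, R, hδ, hR, h1, h2⟩ := hξ.exists_bounds
  have m1 := memLp_mul_cutoff hξ H.continuousOn hL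
  have c2 : Continuous fun x => ((deriv ξ x : ℝ) : ℂ) := Complex.continuous_ofReal.comp
    (contDiff_infty_iff_deriv.1 hξ.smooth).2.continuous
  have c3 : Continuous fun x => ((deriv (deriv ξ) x : ℝ) : ℂ) := Complex.continuous_ofReal.comp
    (contDiff_infty_iff_deriv.1 (contDiff_infty_iff_deriv.1 hξ.smooth).2).2.continuous
  -- L annihilates `h`, and the derivatives of the cutoff vanish near 0, so the image lives away
  -- from 0 however singular `h` is there.
  have m2 : MemLp (cutImage ξ h h') 2 halfLine := by
    refine memLp_of_continuousOn (half_pos hδ) (R := R + 1) ?_ fun x hx hx' => ?_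
    · exact ((continuousOn_const.mul H.continuousOn').mul c2.continuousOn).sub
        (H.continuousOn.mul c3.continuousOn)
    · obtain ⟨e1, e2⟩ := IsCutoff.cutImage_eq_zero h1 h2 hx hx'
      simp [cutImage, e1, e2]
  refine ⟨(m1.toLp _, m2.toLp _), ⟨?_, m1.coeFn_toLp⟩, m2.coeFn_toLp⟩
  exact (hξ.isSol H).mem_maxGraph m1.coeFn_toLp m2.coeFn_toLp

theorem eq_of_mem_maxGraph {α : ℂ} {p q : L2 × L2} (hp : p ∈ maxGraph α) (hq : q ∈ maxGraph α)
    (h : p.1 = q.1) : p = q := by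
  rw [← graph_LMax] at hp hq
  exact Prod.ext h ((LMax α).mem_graph_snd_inj' hp hq h)

theorem IsCutPair.eq {ξ : ℝ → ℝ} {α : ℂ} {h : ℝ → ℂ} {p q : L2 × L2} (hp : IsCutPair ξ α h p)
    (hq : IsCutPair ξ α h q) : p = q :=
  eq_of_mem_maxGraph hp.mem hq.mem (Lp.ext (hp.ae_eq.trans hq.ae_eq.symm))

theorem IsCutPair.isSol {ξ : ℝ → ℝ} (hξ : IsCutoff ξ) {α : ℂ} {h h' : ℝ → ℂ} (H : IsHom α h h')
    (hL : MemLp h 2 (volume.restrict (Ioc 0 1))) {q : L2 × L2} (hq : IsCutPair ξ α h q) :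
    IsSol α q.2 (fun x => h x * (ξ x : ℂ)) (fun x => h' x * (ξ x : ℂ) + h x * ((deriv ξ x : ℝ) : ℂ)) := by
  obtain ⟨q', hq', h2⟩ := exists_isCutPair hξ H hL
  rw [hq.eq hq']
  exact (hξ.isSol H).congr_right h2.symm

/-- The boundary value against a cut-off solution is the limit of the Wronskian. -/
theorem IsCutPair.tendsto_wronskian {ξ : ℝ → ℝ} (hξ : IsCutoff ξ) {α : ℂ} {h h' : ℝ → ℂ}
    (H : IsHom α h h') (hL : MemLp h 2 (volume.restrict (Ioc 0 1))) {q : L2 × L2}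
    (hq : IsCutPair ξ α h q) {p : L2 × L2} {F D : ℝ → ℂ} (hF : p.1 =ᵐ[halfLine] F)
    (hp : IsSol α p.2 F D) : Tendsto (wronskian F D h h') (𝓝[>] 0) (𝓝 (-bform p q)) := by
  refine (tendsto_wronskian_bform hF hp hq.ae_eq (hq.isSol hξ H hL)).congr' ?_
  obtain ⟨δ, R, hδ, hR, h1, h2⟩ := hξ.exists_bounds
  have hd : deriv ξ =ᶠ[𝓝 0] deriv fun _ => (1 : ℝ) := Filter.EventuallyEq.deriv hξ.one
  filter_upwards [nhdsWithin_le_nhds hd, nhdsWithin_le_nhds hξ.one] with x e1 e2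
  simp only [wronskian, e1, e2, deriv_const]
  push_cast
  ring

/-! ### Boundary values below the threshold -/

theorem bform_add_left (p p' q : L2 × L2) : bform (p + p') q = bform p q + bform p' q := by
  rw [bform, bform, bform, ← integral_add]
  · refine integral_congr_ae ?_
    filter_upwards [Lp.coeFn_add p.1 p'.1, Lp.coeFn_add p.2 p'.2] with x h1 h2
    rw [Prod.fst_add, Prod.snd_add, h1, h2, Pi.add_apply, Pi.add_apply]
    ring
  · exact (integrable_mul_L2 _ _).sub (integrable_mul_L2 _ _)
  · exact (integrable_mul_L2 _ _).sub (integrable_mul_L2 _ _)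

theorem bform_smul_left (c : ℂ) (p q : L2 × L2) : bform (c • p) q = c * bform p q := by
  rw [bform, bform, ← integral_const_mul]
  refine integral_congr_ae ?_
  filter_upwards [Lp.coeFn_smul c p.1, Lp.coeFn_smul c p.2] with x h1 h2
  rw [Prod.smul_fst, Prod.smul_snd, h1, h2, Pi.smul_apply, Pi.smul_apply, smul_eq_mul, smul_eq_mul]
  ring

theorem bform_self (p : L2 × L2) : bform p p = 0 := by
  have := bform_antisymm p p
  linear_combination this / 2

section Plucker

variable {ξ : ℝ → ℝ} {α : ℂ} {h₁ h₁' h₂ h₂' : ℝ → ℂ} {w : ℂ} {q₁ q₂ : L2 × L2}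

/-- The boundary form in terms of the boundary values against a fundamental system. -/
theorem IsFund.bform_eq (hf : IsFund α h₁ h₁' h₂ h₂' w) (hξ : IsCutoff ξ)
    (hq₁ : IsCutPair ξ α h₁ q₁) (hq₂ : IsCutPair ξ α h₂ q₂) {p p' : L2 × L2}
    (hp : p ∈ maxGraph α) (hp' : p' ∈ maxGraph α) :
    -(w * bform p p') = bform p q₁ * bform p' q₂ - bform p q₂ * bform p' q₁ := by
  obtain ⟨F, D, hF, hFs⟩ := exists_isSol hp
  obtain ⟨G, E, hG, hGs⟩ := exists_isSol hp'
  have t0 := tendsto_wronskian_bform hF hFs hG hGs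
  have t1 := hq₁.tendsto_wronskian hξ hf.left hf.memLp_left hF hFs
  have t2 := hq₂.tendsto_wronskian hξ hf.right hf.memLp_right hF hFs
  have t3 := hq₁.tendsto_wronskian hξ hf.left hf.memLp_left hG hGs
  have t4 := hq₂.tendsto_wronskian hξ hf.right hf.memLp_right hG hGs
  -- Plücker identity for 2 × 2 determinants, taken pointwise before the limit: W(h₁,h₂) W(F,G) =
  -- W(F,h₁) W(G,h₂) - W(F,h₂) W(G,h₁).
  have t5 := (t1.mul t4).sub (t2.mul t3)
  have t6 := t0.const_mul w
  have := tendsto_nhds_unique (t6.congr' ?_) t5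
  · linear_combination this
  · filter_upwards [self_mem_nhdsWithin] with x hx
    rw [← hf.wronskian_eq x hx]
    simp only [wronskian]
    ring

theorem IsFund.bform_cut (hf : IsFund α h₁ h₁' h₂ h₂' w) (hξ : IsCutoff ξ)
    (hq₁ : IsCutPair ξ α h₁ q₁) (hq₂ : IsCutPair ξ α h₂ q₂) : bform q₁ q₂ = -w := by
  have h := hf.bform_eq hξ hq₁ hq₂ hq₁.mem hq₂.mem
  rw [bform_self, bform_self, bform_antisymm q₂ q₁] at h
  -- The Plücker identity for the pair itself gives b(b + w) = 0 for b = `bform q₁ q₂`. The root b =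
  -- 0 is excluded because the Wronskian equals w ≠ 0 near 0.
  by_cases h0 : bform q₁ q₂ = 0
  · exfalso
    have t := hq₂.tendsto_wronskian hξ hf.right hf.memLp_right hq₁.ae_eq
      (hq₁.isSol hξ hf.left hf.memLp_left)
    rw [h0, neg_zero] at t
    refine hf.ne_zero (tendsto_nhds_unique (tendsto_const_nhds.congr' ?_) t)
    have hd : deriv ξ =ᶠ[𝓝 0] deriv fun _ => (1 : ℝ) := Filter.EventuallyEq.deriv hξ.one
    filter_upwards [nhdsWithin_le_nhds hd, nhdsWithin_le_nhds hξ.one, self_mem_nhdsWithin]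
      with x e1 e2 hx
    rw [← hf.wronskian_eq x hx]
    simp only [wronskian, e1, e2, deriv_const]
    push_cast
    ring
  · have h1 : (bform q₁ q₂ + w) * bform q₁ q₂ = 0 := by linear_combination -h
    rcases mul_eq_zero.1 h1 with h2 | h2
    · linear_combination h2
    · exact absurd h2 h0

end Plucker

/-! ### The minimal operator and its deficiency spaces for α < 1. -/

section BelowThreshold

variable {ξ : ℝ → ℝ} {a : ℝ} {h₁ h₁' h₂ h₂' : ℝ → ℂ} {w : ℂ} {q₁ q₂ : L2 × L2}

/-- By the Plücker identity the whole functional `bform · p` is determined by the two numbers `bform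
p q₁` and `bform p q₂`, so two conditions cut L^min out of L^max. -/
theorem IsFund.mem_graph_LMin_iff (hf : IsFund (a : ℂ) h₁ h₁' h₂ h₂' w) (hξ : IsCutoff ξ)
    (hq₁ : IsCutPair ξ (a : ℂ) h₁ q₁) (hq₂ : IsCutPair ξ (a : ℂ) h₂ q₂) {p : L2 × L2}
    (hp : p ∈ maxGraph (a : ℂ)) :
    p ∈ (LMin (a : ℂ)).graph ↔ bform p q₁ = 0 ∧ bform p q₂ = 0 := by
  rw [InverseSquare.mem_graph_LMin_iff]
  constructor
  · rintro ⟨-, h⟩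
    exact ⟨by rw [bform_antisymm, h _ hq₁.mem, neg_zero], by rw [bform_antisymm, h _ hq₂.mem, neg_zero]⟩
  · rintro ⟨h1, h2⟩
    refine ⟨hp, fun q hq => ?_⟩
    have := hf.bform_eq hξ hq₁ hq₂ hq hp
    rw [h1, h2, mul_zero, mul_zero, sub_zero, neg_eq_zero] at this
    exact (mul_eq_zero.1 this).resolve_left hf.ne_zero

/-- Below the threshold the minimal operator is strictly smaller than the maximal one. -/
theorem IsFund.notMem_graph_LMin (hf : IsFund (a : ℂ) h₁ h₁' h₂ h₂' w) (hξ : IsCutoff ξ)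
    (hq₁ : IsCutPair ξ (a : ℂ) h₁ q₁) (hq₂ : IsCutPair ξ (a : ℂ) h₂ q₂) :
    q₁ ∉ (LMin (a : ℂ)).graph := by
  rw [hf.mem_graph_LMin_iff hξ hq₁ hq₂ hq₁.mem]
  rintro ⟨-, h⟩
  rw [hf.bform_cut hξ hq₁ hq₂, neg_eq_zero] at h
  exact hf.ne_zero h

theorem isSelfAdjoint_LMin_iff (a : ℝ) :
    IsSelfAdjoint (LMin (a : ℂ)) ↔ maxGraph (a : ℂ) ≤ (LMin (a : ℂ)).graph := by
  rw [LinearPMap.isSelfAdjoint_def, ← graph_adjoint_LMin]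
  constructor
  · intro h
    rw [h]
  · intro h
    refine LinearPMap.eq_of_eq_graph (le_antisymm h ?_)
    rw [graph_adjoint_LMin]
    exact graph_LMin_le_maxGraph _

theorem IsFund.not_isSelfAdjoint_LMin (hf : IsFund (a : ℂ) h₁ h₁' h₂ h₂' w) (hξ : IsCutoff ξ) :
    ¬ IsSelfAdjoint (LMin (a : ℂ)) := by
  obtain ⟨q₁, hq₁, -⟩ := exists_isCutPair hξ hf.left hf.memLp_left
  obtain ⟨q₂, hq₂, -⟩ := exists_isCutPair hξ hf.right hf.memLp_right
  rw [isSelfAdjoint_LMin_iff]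
  exact fun h => hf.notMem_graph_LMin hξ hq₁ hq₂ (h hq₁.mem)

theorem mem_deficiencySpace_LMin {z : ℂ} {f : L2} :
    f ∈ deficiencySpace (LMin (a : ℂ)) z ↔ (f, z • f) ∈ maxGraph (a : ℂ) := by
  rw [deficiencySpace, graph_adjoint_LMin]
  rfl

theorem star_smul_L2 (z : ℂ) (f : L2) : star (z • f) = starRingEnd ℂ z • star f := by
  refine Lp.ext ?_
  filter_upwards [coeFn_star_L2 (z • f), coeFn_star_L2 f, Lp.coeFn_smul z f,
    Lp.coeFn_smul (starRingEnd ℂ z) (star f)] with x h1 h2 h3 h4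
  rw [h1, h3, h4, Pi.smul_apply, Pi.smul_apply, h2, smul_eq_mul, smul_eq_mul, map_mul]

theorem star_mem_deficiencySpace {z : ℂ} {f : L2} (h : f ∈ deficiencySpace (LMin (a : ℂ)) z) :
    star f ∈ deficiencySpace (LMin (a : ℂ)) (starRingEnd ℂ z) := by
  rw [mem_deficiencySpace_LMin] at h ⊢
  have := star_mem_maxGraph h
  have e : star (f, z • f) = (star f, starRingEnd ℂ z • star f) := by
    refine Prod.ext rfl ?_
    rw [Prod.snd_star]
    exact star_smul_L2 z f
  rwa [e] at this

/-- The two boundary values embed the sum of the deficiency spaces into ℂ², so the indices add up to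
at most 2. Conjugation exchanges the two spaces since α is real, and they cannot both vanish because
L^min is not self-adjoint. Hence each has dimension 1. -/
theorem deficiencyIndices_LMin (hf : IsFund (a : ℂ) h₁ h₁' h₂ h₂' w) (hξ : IsCutoff ξ) :
    deficiencyIndices (LMin (a : ℂ)) = (1, 1) := by
  obtain ⟨q₁, hq₁, -⟩ := exists_isCutPair hξ hf.left hf.memLp_left
  obtain ⟨q₂, hq₂, -⟩ := exists_isCutPair hξ hf.right hf.memLp_right
  set N := deficiencySpace (LMin (a : ℂ)) Complex.I with hN
  set M := deficiencySpace (LMin (a : ℂ)) (-Complex.I) with hM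
  let pair : (N × M) →ₗ[ℂ] L2 × L2 := LinearMap.prod
    (N.subtype.coprod M.subtype) ((Complex.I • N.subtype).coprod (-(Complex.I • M.subtype)))
  have hpair : ∀ z, pair z = ((z.1 : L2) + z.2, Complex.I • (z.1 : L2) + -(Complex.I • (z.2 : L2))) :=
    fun z => rfl
  have hmem : ∀ z, pair z ∈ maxGraph (a : ℂ) := by
    intro z
    have m1 := mem_deficiencySpace_LMin.1 z.1.2
    have m2 := mem_deficiencySpace_LMin.1 z.2.2
    have := (maxGraph (a : ℂ)).add_mem m1 m2
    rw [Prod.mk_add_mk, neg_smul] at this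
    exact this
  let T : (N × M) →ₗ[ℂ] ℂ × ℂ :=
    { toFun := fun z => (bform (pair z) q₁, bform (pair z) q₂)
      map_add' := fun z z' => by simp only [map_add, bform_add_left, Prod.mk_add_mk]
      map_smul' := fun c z => by
        simp only [map_smul, bform_smul_left, RingHom.id_apply, Prod.smul_mk, smul_eq_mul] }
  have hinj : Function.Injective T := by
    rw [← LinearMap.ker_eq_bot, LinearMap.ker_eq_bot']
    intro z hz
    have hz' : bform (pair z) q₁ = 0 ∧ bform (pair z) q₂ = 0 := Prod.mk.injEq _ _ _ _ ▸ hz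
    -- A sum of eigenvectors of L^max at i and -i that lies in L^min is zero: pairing it with either
    -- summand makes the cross terms cancel and leaves ±2i times a squared norm.
    have hmin := (hf.mem_graph_LMin_iff hξ hq₁ hq₂ (hmem z)).2 hz'
    have k1 := inner_eq_of_mem_graph_LMin hmin (mem_deficiencySpace_LMin.1 z.1.2)
    have k2 := inner_eq_of_mem_graph_LMin hmin (mem_deficiencySpace_LMin.1 z.2.2)
    rw [hpair] at k1 k2
    simp only [inner_add_left, inner_neg_left, inner_smul_left, inner_smul_right, Complex.conj_I]
      at k1 k2
    have n1 : ⟪(z.1 : L2), (z.1 : L2)⟫_ℂ = 0 := by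
      have : (2 * Complex.I) * ⟪(z.1 : L2), (z.1 : L2)⟫_ℂ = 0 := by linear_combination -k1
      exact (mul_eq_zero.1 this).resolve_left (by simp)
    have n2 : ⟪(z.2 : L2), (z.2 : L2)⟫_ℂ = 0 := by
      have : (2 * Complex.I) * ⟪(z.2 : L2), (z.2 : L2)⟫_ℂ = 0 := by linear_combination k2
      exact (mul_eq_zero.1 this).resolve_left (by simp)
    exact Prod.ext (Subtype.ext (inner_self_eq_zero.1 n1)) (Subtype.ext (inner_self_eq_zero.1 n2))
  have hfd : Module.Finite ℂ (N × M) := Module.Finite.of_injective T hinj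
  have hfN : Module.Finite ℂ N := Module.Finite.of_injective (LinearMap.inl ℂ N M)
    LinearMap.inl_injective
  have hfM : Module.Finite ℂ M := Module.Finite.of_injective (LinearMap.inr ℂ N M)
    LinearMap.inr_injective
  have hle : Module.finrank ℂ N + Module.finrank ℂ M ≤ 2 := by
    have := LinearMap.finrank_le_finrank_of_injective hinj
    rwa [Module.finrank_prod, Module.finrank_prod, Module.finrank_self] at this
  have hzero : ∀ z : ℂ, deficiencySpace (LMin (a : ℂ)) z = ⊥ →
      deficiencySpace (LMin (a : ℂ)) (starRingEnd ℂ z) = ⊥ := by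
    intro z hz
    rw [Submodule.eq_bot_iff] at hz ⊢
    intro f hf
    have h1 := star_mem_deficiencySpace hf
    rw [Complex.conj_conj] at h1
    rw [← star_star f, hz _ h1, ← zero_smul ℂ (0 : L2), star_smul_L2, map_zero, zero_smul,
      zero_smul]
  have hnot : ¬ (N = ⊥ ∧ M = ⊥) := by
    rintro ⟨h1, h2⟩
    refine hf.not_isSelfAdjoint_LMin hξ (isSelfAdjoint_of_deficiency (isHermitianOp_LMin a)
      (isClosed_LMin _) (fun f hf => ?_) (fun f hf => ?_))
    · rw [Submodule.eq_bot_iff] at h1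
      exact h1 f hf
    · rw [Submodule.eq_bot_iff] at h2
      refine h2 f ?_
      rw [← neg_smul] at hf
      exact hf
  have hNpos : 1 ≤ Module.finrank ℂ N := by
    rw [Nat.one_le_iff_ne_zero, Ne, Submodule.finrank_eq_zero]
    intro h
    have := hzero _ h
    rw [Complex.conj_I] at this
    exact hnot ⟨h, this⟩
  have hMpos : 1 ≤ Module.finrank ℂ M := by
    rw [Nat.one_le_iff_ne_zero, Ne, Submodule.finrank_eq_zero]
    intro h
    have := hzero _ h
    rw [map_neg, Complex.conj_I, neg_neg] at this
    exact hnot ⟨this, h⟩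
  rw [deficiencyIndices, ← hN, ← hM]
  have e1 : Module.finrank ℂ N = 1 := by omega
  have e2 : Module.finrank ℂ M = 1 := by omega
  rw [← Module.finrank_eq_rank, ← Module.finrank_eq_rank, e1, e2, Nat.cast_one]

end BelowThreshold

/-! ### The operators `H_m` -/

theorem bform_star (p q : L2 × L2) : bform (star p) (star q) = starRingEnd ℂ (bform p q) := by
  rw [bform, bform, ← integral_conj]
  refine integral_congr_ae ?_
  filter_upwards [coeFn_star_L2 p.1, coeFn_star_L2 p.2, coeFn_star_L2 q.1, coeFn_star_L2 q.2]
    with x h1 h2 h3 h4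
  rw [Prod.fst_star, Prod.snd_star, Prod.fst_star, Prod.snd_star, h1, h2, h3, h4, map_sub, map_mul,
    map_mul]

theorem mem_graph_H {ξ : ℝ → ℝ} {m : ℂ} {p : L2 × L2} :
    p ∈ (H ξ m).graph ↔ p ∈ maxGraph (m ^ 2) ∧ p.1 ∈ HDomain ξ m := by
  rw [← graph_LMax, LinearPMap.mem_graph_iff, LinearPMap.mem_graph_iff]
  constructor
  · rintro ⟨⟨y, hy⟩, h1, h2⟩
    exact ⟨⟨⟨y, hy.2⟩, h1, h2⟩, h1 ▸ hy.1⟩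
  · rintro ⟨⟨y, h1, h2⟩, h3⟩
    exact ⟨⟨y, by rw [h1]; exact h3, y.2⟩, h1, h2⟩

theorem mem_graph_H_iff_exists {ξ : ℝ → ℝ} {m : ℂ} {q : L2 × L2}
    (hq : IsCutPair ξ (m ^ 2) (fun x : ℝ => (x : ℂ) ^ (1 / 2 + m)) q) {p : L2 × L2} :
    p ∈ (H ξ m).graph ↔ ∃ c : ℂ, p - c • q ∈ (LMin (m ^ 2)).graph := by
  rw [mem_graph_H]
  constructor
  · rintro ⟨hp, g, hg, c, h⟩
    refine ⟨c, ?_⟩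
    have h1 : (p - c • q).1 = g := by
      refine Lp.ext ?_
      rw [Prod.fst_sub, Prod.smul_fst]
      filter_upwards [Lp.coeFn_sub p.1 (c • q.1), Lp.coeFn_smul c q.1, hq.ae_eq, h]
        with x e1 e2 e3 e4
      rw [e1, Pi.sub_apply, e2, Pi.smul_apply, e3, e4, smul_eq_mul]
      ring
    have h2 := (LMin (m ^ 2)).mem_graph ⟨g, hg⟩
    rwa [eq_of_mem_maxGraph (Submodule.sub_mem _ hp (Submodule.smul_mem _ c hq.mem))
      (graph_LMin_le_maxGraph _ h2) h1]
  · rintro ⟨c, h⟩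
    have h1 := Submodule.add_mem _ (graph_LMin_le_maxGraph _ h) (Submodule.smul_mem _ c hq.mem)
    rw [sub_add_cancel] at h1
    refine ⟨h1, (p - c • q).1, LinearPMap.mem_domain_of_mem_graph h, c, ?_⟩
    rw [Prod.fst_sub, Prod.smul_fst]
    filter_upwards [Lp.coeFn_sub p.1 (c • q.1), Lp.coeFn_smul c q.1, hq.ae_eq] with x e1 e2 e3
    rw [e1, Pi.sub_apply, e2, Pi.smul_apply, e3, smul_eq_mul]
    ring

theorem LMin_le_H (ξ : ℝ → ℝ) (m : ℂ) : LMin (m ^ 2) ≤ H ξ m := by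
  refine LinearPMap.le_of_le_graph fun p hp => mem_graph_H.2 ⟨graph_LMin_le_maxGraph _ hp, ?_⟩
  exact ⟨p.1, LinearPMap.mem_domain_of_mem_graph hp, 0, by simp⟩

/-! ### `H_m` as the kernel of one boundary functional. -/

section BelowThreshold

variable {ξ : ℝ → ℝ} {m : ℂ} {a : ℝ} {h₁' h₂ h₂' : ℝ → ℂ} {w : ℂ} {q : L2 × L2}

/-- Below the threshold `H_m` is the kernel of a boundary functional. -/
theorem IsFund.mem_graph_H_iff (hm : m ^ 2 = a)
    (hf : IsFund (a : ℂ) (fun x : ℝ => (x : ℂ) ^ (1 / 2 + m)) h₁' h₂ h₂' w) (hξ : IsCutoff ξ)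
    (hq : IsCutPair ξ (a : ℂ) (fun x : ℝ => (x : ℂ) ^ (1 / 2 + m)) q) {p : L2 × L2} :
    p ∈ (H ξ m).graph ↔ p ∈ maxGraph (a : ℂ) ∧ bform p q = 0 := by
  obtain ⟨q₂, hq₂, -⟩ := exists_isCutPair hξ hf.right hf.memLp_right
  have hb := hf.bform_cut hξ hq hq₂
  rw [mem_graph_H_iff_exists (hm ▸ hq), hm]
  have hsub : ∀ c : ℂ, ∀ r, bform (p - c • q) r = bform p r - c * bform q r := fun c r => by
    rw [sub_eq_add_neg, ← neg_smul, bform_add_left, bform_smul_left]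
    ring
  constructor
  · rintro ⟨c, h⟩
    have h1 := Submodule.add_mem _ (graph_LMin_le_maxGraph _ h) (Submodule.smul_mem _ c hq.mem)
    rw [sub_add_cancel] at h1
    have h2 := ((hf.mem_graph_LMin_iff hξ hq hq₂ (graph_LMin_le_maxGraph _ h)).1 h).1
    rw [hsub, bform_self, mul_zero, sub_zero] at h2
    exact ⟨h1, h2⟩
  · rintro ⟨hp, h⟩
    -- The coefficient is forced by the second boundary value, since `bform q q₂ = -w`.
    refine ⟨-bform p q₂ / w, (hf.mem_graph_LMin_iff hξ hq hq₂
      (Submodule.sub_mem _ hp (Submodule.smul_mem _ _ hq.mem))).2 ⟨?_, ?_⟩⟩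
    · rw [hsub, bform_self, h, mul_zero, sub_zero]
    · rw [hsub, hb]
      field_simp [hf.ne_zero]
      ring

/-- The kernel of one real boundary functional is Lagrangian. An element of the adjoint tested
against `q` itself has zero boundary value; conversely, two elements with zero value have zero
boundary form by the Plücker identity. The hypothesis `star q = q` makes the functional real. -/
theorem IsFund.isSelfAdjoint_H (hm : m ^ 2 = a)
    (hf : IsFund (a : ℂ) (fun x : ℝ => (x : ℂ) ^ (1 / 2 + m)) h₁' h₂ h₂' w) (hξ : IsCutoff ξ)
    (hq : IsCutPair ξ (a : ℂ) (fun x : ℝ => (x : ℂ) ^ (1 / 2 + m)) q) (hstar : star q = q) :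
    IsSelfAdjoint (H ξ m) := by
  obtain ⟨q₂, hq₂, -⟩ := exists_isCutPair hξ hf.right hf.memLp_right
  have hle : LMin (a : ℂ) ≤ H ξ m := hm ▸ LMin_le_H ξ m
  have hd : Dense ((H ξ m).domain : Set L2) := (dense_domain_LMin (a : ℂ)).mono hle.1
  rw [LinearPMap.isSelfAdjoint_def]
  refine LinearPMap.eq_of_eq_graph (le_antisymm ?_ ?_)
  · intro p hp
    have h1 := graph_adjoint_anti (dense_domain_LMin (a : ℂ)) hle hp
    rw [graph_adjoint_LMin] at h1
    refine (hf.mem_graph_H_iff hm hξ hq).2 ⟨h1, ?_⟩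
    have h2 := (mem_graph_adjoint_iff hd).1 hp q.1 q.2
      ((hf.mem_graph_H_iff hm hξ hq).2 ⟨hq.mem, bform_self q⟩)
    rw [← sub_eq_zero, inner_sub_inner_eq_bform, hstar] at h2
    rw [bform_antisymm, h2, neg_zero]
  · intro p hp
    refine (mem_graph_adjoint_iff hd).2 fun c d hcd => ?_
    obtain ⟨k1, k2⟩ := (hf.mem_graph_H_iff hm hξ hq).1 hcd
    obtain ⟨k3, k4⟩ := (hf.mem_graph_H_iff hm hξ hq).1 hp
    have e := inner_sub_inner_eq_bform (c, d) p
    have h5 := bform_star (c, d) q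
    rw [hstar, k2, map_zero] at h5
    have h6 := hf.bform_eq hξ hq hq₂ (star_mem_maxGraph k1) k3
    rw [h5, k4, zero_mul, mul_zero, sub_zero, neg_eq_zero] at h6
    rw [(mul_eq_zero.1 h6).resolve_left hf.ne_zero] at e
    exact sub_eq_zero.1 e

end BelowThreshold

theorem cpow_eq_ofReal {m x : ℝ} (hx : 0 < x) :
    (x : ℂ) ^ (1 / 2 + (m : ℂ)) = ((x ^ (1 / 2 + m) : ℝ) : ℂ) := by
  rw [Complex.ofReal_cpow hx.le]
  push_cast
  rfl

theorem IsCutPair.star_eq {ξ : ℝ → ℝ} {a m : ℝ} {q : L2 × L2}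
    (hq : IsCutPair ξ (a : ℂ) (fun x : ℝ => (x : ℂ) ^ (1 / 2 + (m : ℂ))) q) : star q = q := by
  refine IsCutPair.eq ⟨star_mem_maxGraph hq.mem, ?_⟩ hq
  rw [Prod.fst_star]
  filter_upwards [coeFn_star_L2 q.1, hq.ae_eq, ae_restrict_mem measurableSet_Ioi] with x h1 h2 hx
  rw [h1, h2, cpow_eq_ofReal hx, map_mul, Complex.conj_ofReal, Complex.conj_ofReal]

theorem isSelfAdjoint_H {ξ : ℝ → ℝ} (hξ : IsCutoff ξ) {m : ℝ} (h1 : -1 < m) (h2 : m < 1) :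
    IsSelfAdjoint (H ξ (m : ℂ)) := by
  obtain ⟨h₂, h₂', w, hf⟩ := exists_isFund (m := (m : ℂ)) (by simpa using h1) (by simpa using h2)
  rw [← Complex.ofReal_pow] at hf
  obtain ⟨q, hq, -⟩ := exists_isCutPair hξ hf.left hf.memLp_left
  exact hf.isSelfAdjoint_H (by push_cast; rfl) hξ hq hq.star_eq

/-! ### Essential self-adjointness and deficiency indices -/

theorem exists_sq_eq {a : ℝ} (ha : a < 1) : ∃ m : ℂ, m ^ 2 = a ∧ -1 < m.re ∧ m.re < 1 := by
  rcases le_total 0 a with h | h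
  · refine ⟨(√a : ℝ), by rw [← Complex.ofReal_pow, Real.sq_sqrt h], ?_, ?_⟩
    · rw [Complex.ofReal_re]; linarith [Real.sqrt_nonneg a]
    · rw [Complex.ofReal_re, Real.sqrt_lt' one_pos]; simpa using ha
  · refine ⟨Complex.I * (√(-a) : ℝ), ?_, by simp, by simp⟩
    rw [mul_pow, ← Complex.ofReal_pow, Real.sq_sqrt (by linarith)]
    simp

theorem deficiency_LMin {ξ : ℝ → ℝ} (hξ : IsCutoff ξ) {a : ℝ} (ha : a < 1) :
    ¬ IsEssentiallySelfAdjoint (LTest (a : ℂ)) ∧ deficiencyIndices (LMin (a : ℂ)) = (1, 1) := by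
  obtain ⟨m, hm, h1, h2⟩ := exists_sq_eq ha
  obtain ⟨h₂, h₂', w, hf⟩ := exists_isFund h1 h2
  rw [hm] at hf
  exact ⟨hf.not_isSelfAdjoint_LMin hξ, deficiencyIndices_LMin hf hξ⟩

/-! ### Homogeneous extensions -/

theorem exp_mul_cpow (τ : ℝ) {x : ℝ} (hx : 0 < x) (s : ℂ) :
    ((Real.exp τ * x : ℝ) : ℂ) ^ s = Complex.exp (τ * s) * (x : ℂ) ^ s := by
  have he : ((Real.exp τ : ℝ) : ℂ) ≠ 0 := by exact_mod_cast (Real.exp_pos τ).ne'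
  rw [Complex.ofReal_mul, Complex.mul_cpow_ofReal_nonneg (Real.exp_pos τ).le hx.le,
    Complex.cpow_def_of_ne_zero he, ← Complex.ofReal_log (Real.exp_pos τ).le, Real.log_exp]

theorem tendsto_exp_mul_nhdsGT (τ : ℝ) :
    Tendsto (fun x => Real.exp τ * x) (𝓝[>] 0) (𝓝[>] 0) := by
  refine tendsto_nhdsWithin_iff.2 ⟨?_, ?_⟩
  · have : Tendsto (fun x => Real.exp τ * x) (𝓝 0) (𝓝 (Real.exp τ * 0)) :=
      (continuous_const.mul continuous_id).tendsto 0
    rw [mul_zero] at this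
    exact this.mono_left nhdsWithin_le_nhds
  · filter_upwards [self_mem_nhdsWithin] with x hx
    exact mul_pos (Real.exp_pos τ) hx

/-- Boundary values scale under dilations. -/
theorem bform_dilation {ξ : ℝ → ℝ} (hξ : IsCutoff ξ) {m : ℂ} (hm : -1 < m.re) {q p r : L2 × L2}
    (hq : IsCutPair ξ (m ^ 2) (fun x : ℝ => (x : ℂ) ^ (1 / 2 + m)) q) (hp : p ∈ maxGraph (m ^ 2))
    (hr : r ∈ maxGraph (m ^ 2)) {τ : ℝ} (hpr : r.1 = dilation τ p.1) :
    bform r q = Complex.exp (τ - τ * m) * bform p q := by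
  have hhalf : (1 / 2 : ℂ).re = 1 / 2 := by norm_num
  have hL : MemLp (fun x : ℝ => (x : ℂ) ^ (1 / 2 + m)) 2 (volume.restrict (Ioc 0 1)) :=
    memLp_cpow (by rw [Complex.add_re, hhalf]; linarith)
  obtain ⟨F, D, hF, hFs⟩ := exists_isSol hp
  obtain ⟨G, E, hG, hGs⟩ := exists_isSol hr
  have t1 := (hq.tendsto_wronskian hξ (isHom_cpow m) hL hF hFs).comp (tendsto_exp_mul_nhdsGT τ)
  have t2 := hq.tendsto_wronskian hξ (isHom_cpow m) hL hG hGs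
  have hmaps : MapsTo (fun x => Real.exp τ * x) (Ioi 0) (Ioi 0) :=
    fun x hx => mul_pos (Real.exp_pos τ) hx
  have e1 : EqOn G (fun x => (Real.exp (τ / 2) : ℂ) * F (Real.exp τ * x)) (Ioi 0) := by
    refine Measure.eqOn_open_of_ae_eq (μ := volume) ?_ isOpen_Ioi hGs.continuousOn
      (continuousOn_const.mul (hFs.continuousOn.comp (by fun_prop) hmaps))
    refine hG.symm.trans ?_
    rw [hpr]
    filter_upwards [(memLp_dilation τ p.1).coeFn_toLp, (quasi_dilation τ).ae hF] with x h1 h2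
    rw [← h2]
    exact h1
  have e2 : ∀ x, 0 < x → E x = (Real.exp (τ / 2) : ℂ) * (Real.exp τ * D (Real.exp τ * x)) := by
    intro x hx
    have d1 := hFs.hasDerivAt _ (hmaps hx)
    have d2 : HasDerivAt (fun x => Real.exp τ * x) (Real.exp τ) x := by
      simpa using (hasDerivAt_id x).const_mul (Real.exp τ)
    have d3 := (d1.scomp x d2).const_mul (Real.exp (τ / 2) : ℂ)
    have d4 := (hGs.hasDerivAt x hx).congr_of_eventuallyEq
      (e1.symm.eventuallyEq_of_mem (Ioi_mem_nhds hx))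
    refine d4.unique (d3.congr_deriv ?_)
    rw [Complex.real_smul]
  have t3 := t1.const_mul (Complex.exp (τ - τ * m))
  have := tendsto_nhds_unique (t3.congr' ?_) t2
  · linear_combination this
  · filter_upwards [self_mem_nhdsWithin] with x hx
    have hx0 : (x : ℂ) ≠ 0 := by exact_mod_cast (ne_of_gt hx : x ≠ 0)
    have he : ((Real.exp τ : ℝ) : ℂ) ≠ 0 := by exact_mod_cast (Real.exp_pos τ).ne'
    -- Source of the exponent: the dilation contributes e^(τ/2), the derivative e^τ, and rescaling
    -- x^(1/2+m) contributes e^(-τ(1/2+m)).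
    have e3 : Complex.exp (τ - τ * m) * Complex.exp (τ * (1 / 2 + m)) =
        (Real.exp τ : ℂ) * (Real.exp (τ / 2) : ℂ) := by
      push_cast
      rw [← Complex.exp_add, ← Complex.exp_add]
      ring_nf
    simp only [wronskian, Function.comp, e1 hx, e2 x hx, exp_mul_cpow τ hx]
    rw [Complex.ofReal_mul, ← div_div]
    have e4 : ∀ c d u v : ℂ, Complex.exp (τ - τ * m) *
        (u * (c / (Real.exp τ : ℂ) / x * (Complex.exp (τ * (1 / 2 + m)) * d)) -
          v * (Complex.exp (τ * (1 / 2 + m)) * d)) =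
        (Complex.exp (τ - τ * m) * Complex.exp (τ * (1 / 2 + m))) *
          (u * (c / (Real.exp τ : ℂ) / x * d) - v * d) := fun c d u v => by ring
    rw [e4, e3]
    field_simp

theorem cpow_conj_of_pos {x : ℝ} (hx : 0 < x) (s : ℂ) :
    starRingEnd ℂ ((x : ℂ) ^ s) = (x : ℂ) ^ (starRingEnd ℂ s) := by
  have := Complex.cpow_conj (x : ℂ) s (by
    rw [Complex.arg_ofReal_of_nonneg hx.le]; exact Real.pi_pos.ne)
  rw [this, Complex.conj_ofReal]

/-- Of homogeneity only the invariance of the domain under dilations is kept, which is why the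
degree plays no role afterwards. -/
theorem IsHomogeneous.exists_mem_graph {ν : ℝ} {B : L2 →ₗ.[ℂ] L2} (h : IsHomogeneous ν B) (τ : ℝ)
    {p : L2 × L2} (hp : p ∈ B.graph) : ∃ r ∈ B.graph, r.1 = dilation τ p.1 := by
  have h1 : (dilation τ p.1, dilation τ p.2) ∈ ((Real.exp (ν * τ) : ℂ) • B).graph := by
    rw [← h τ]
    exact ⟨p, hp, rfl⟩
  obtain ⟨y, hy, -⟩ := LinearPMap.mem_graph_iff _ |>.1 h1
  exact ⟨(y, B y), B.mem_graph y, hy⟩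

/-- With m = iμ the two cut-off solutions are conjugate to each other, and a dilation multiplies the
two boundary values by e^τ times opposite phases. Symmetry between an element and a suitable dilate
makes a sum of two squares vanish, so the extension has zero boundary values and equals L^min. -/
theorem not_exists_homogeneous {ξ : ℝ → ℝ} (hξ : IsCutoff ξ) {a : ℝ} (ha : a < 0) :
    ¬ ∃ (B : L2 →ₗ.[ℂ] L2) (ν : ℝ), LMin (a : ℂ) ≤ B ∧ IsSelfAdjoint B ∧ IsHomogeneous ν B := by
  rintro ⟨B, ν, hle, hB, hν⟩
  set μ := √(-a) with hμ
  have hμ0 : 0 < μ := Real.sqrt_pos.2 (by linarith)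
  set m : ℂ := Complex.I * μ with hmdef
  have hm : m ^ 2 = a := by
    rw [hmdef, mul_pow, ← Complex.ofReal_pow, Real.sq_sqrt (by linarith)]
    simp
  have hre : m.re = 0 := by simp [hmdef]
  have hm0 : m ≠ 0 := mul_ne_zero Complex.I_ne_zero (by exact_mod_cast hμ0.ne')
  have hconj : starRingEnd ℂ m = -m := by simp [hmdef]
  have hf := isFund_cpow (m := m) (by rw [hre]; norm_num) (by rw [hre]; norm_num) hm0
  rw [hm] at hf
  obtain ⟨q₁, hq₁, -⟩ := exists_isCutPair hξ hf.left hf.memLp_left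
  obtain ⟨q₂, hq₂, -⟩ := exists_isCutPair hξ hf.right hf.memLp_right
  have hstar : star q₁ = q₂ := by
    refine IsCutPair.eq ⟨star_mem_maxGraph hq₁.mem, ?_⟩ hq₂
    rw [Prod.fst_star]
    filter_upwards [coeFn_star_L2 q₁.1, hq₁.ae_eq, ae_restrict_mem measurableSet_Ioi]
      with x h1 h2 hx
    rw [h1, h2, map_mul, cpow_conj_of_pos hx, Complex.conj_ofReal, map_add, hconj, map_div₀, map_one,
      Complex.conj_ofNat 2]
  have hBmax : B.graph ≤ maxGraph (a : ℂ) := by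
    have := graph_adjoint_anti (dense_domain_LMin (a : ℂ)) hle
    rwa [LinearPMap.isSelfAdjoint_def.1 hB, graph_adjoint_LMin] at this
  have hzero : ∀ p ∈ B.graph, bform p q₁ = 0 ∧ bform p q₂ = 0 := by
    intro p hp
    -- Chosen so that τμ = π/2: the phases become ∓i, and the difference in the Plücker identity
    -- turns into a sum of squared moduli.
    set τ : ℝ := Real.pi / (2 * μ) with hτ
    obtain ⟨r, hr, hpr⟩ := hν.exists_mem_graph τ hp
    have b1 := bform_dilation hξ (m := m) (by rw [hre]; norm_num) (by rw [hm]; exact hq₁)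
      (by rw [hm]; exact hBmax hp) (by rw [hm]; exact hBmax hr) hpr
    have b2 := bform_dilation hξ (m := -m) (by rw [Complex.neg_re, hre]; norm_num)
      (by rw [neg_sq, hm]; exact hq₂)
      (by rw [neg_sq, hm]; exact hBmax hp) (by rw [neg_sq, hm]; exact hBmax hr) hpr
    have hherm := (isHermitianOp_of_isSelfAdjoint hB).2
    have s1 : bform (star p) r = 0 := by
      rw [← inner_sub_inner_eq_bform, sub_eq_zero]
      obtain ⟨u, hu1, hu2⟩ := (LinearPMap.mem_graph_iff _).1 hp
      obtain ⟨v, hv1, hv2⟩ := (LinearPMap.mem_graph_iff _).1 hr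
      rw [← hu1, ← hu2, ← hv1, ← hv2]
      exact hherm u v
    have s2 := hf.bform_eq hξ hq₁ hq₂ (star_mem_maxGraph (hBmax hp)) (hBmax hr)
    have s3 : bform (star p) q₁ = starRingEnd ℂ (bform p q₂) := by
      rw [← bform_star, ← hstar, star_star]
    have s4 : bform (star p) q₂ = starRingEnd ℂ (bform p q₁) := by
      rw [← bform_star, hstar]
    have hτm : (τ : ℂ) * m = Real.pi / 2 * Complex.I := by
      have hμc : (μ : ℂ) ≠ 0 := by exact_mod_cast hμ0.ne'
      rw [hτ, hmdef]
      push_cast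
      field_simp
    rw [s1, s3, s4, b1, b2, mul_neg, hτm, sub_neg_eq_add, Complex.exp_add, Complex.exp_sub,
      Complex.exp_pi_div_two_mul_I, Complex.div_I] at s2
    have hE : Complex.exp τ * Complex.I ≠ 0 := mul_ne_zero (Complex.exp_ne_zero _) Complex.I_ne_zero
    have s5 : Complex.exp τ * Complex.I * (starRingEnd ℂ (bform p q₂) * bform p q₂ +
        starRingEnd ℂ (bform p q₁) * bform p q₁) = 0 := by linear_combination -s2
    have s6 := (mul_eq_zero.1 s5).resolve_left hE
    rw [Complex.conj_mul', Complex.conj_mul'] at s6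
    have s7 : ‖bform p q₂‖ ^ 2 + ‖bform p q₁‖ ^ 2 = 0 := by exact_mod_cast s6
    constructor
    · rw [← norm_eq_zero]; nlinarith [sq_nonneg ‖bform p q₁‖, sq_nonneg ‖bform p q₂‖]
    · rw [← norm_eq_zero]; nlinarith [sq_nonneg ‖bform p q₁‖, sq_nonneg ‖bform p q₂‖]
  have hBle : B ≤ LMin (a : ℂ) := LinearPMap.le_of_le_graph fun p hp =>
    (hf.mem_graph_LMin_iff hξ hq₁ hq₂ (hBmax hp)).2 (hzero p hp)
  exact hf.not_isSelfAdjoint_LMin hξ (le_antisymm hle hBle ▸ hB)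

/-! ### The limit point case -/

theorem integrableOn_unit {g : ℝ → ℂ} (hg : MemLp g 2 halfLine) :
    IntegrableOn g (Ioc 0 1) volume :=
  (hg.mono_measure (Measure.restrict_mono Ioc_subset_Ioi_self le_rfl)).integrable (by norm_num)

theorem IsSol.norm_wronskian_sub_le {α : ℂ} {g F D h h' : ℝ → ℂ} (hF : IsSol α g F D)
    (hh : IsSol α 0 h h') (hg : MemLp g 2 halfLine) {x y K : ℝ} (hx : 0 < x) (hxy : x ≤ y)
    (hy : y ≤ 1) (hK : ∀ t ∈ Icc x y, ‖h t‖ ≤ K) :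
    ‖wronskian F D h h' y - wronskian F D h h' x‖ ≤ (∫ t in Ioc (0 : ℝ) 1, ‖g t‖) * K := by
  have hi : IntegrableOn (fun t => ‖g t‖) (Ioc 0 1) volume := (integrableOn_unit hg).norm
  have hsub : Ioc x y ⊆ Ioc 0 1 := Ioc_subset_Ioc hx.le hy
  have hK0 : 0 ≤ K := (norm_nonneg _).trans (hK x ⟨le_rfl, hxy⟩)
  rw [hF.wronskian_sub hh hx hxy, intervalIntegral.integral_of_le hxy]
  calc ‖∫ t in Ioc x y, (g t * h t - F t * (0 : ℝ → ℂ) t)‖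
      ≤ ∫ t in Ioc x y, ‖g t‖ * K := by
        refine norm_integral_le_of_norm_le ((hi.mono_set hsub).mul_const K) ?_
        filter_upwards [ae_restrict_mem measurableSet_Ioc] with t ht
        rw [Pi.zero_apply, mul_zero, sub_zero, norm_mul]
        exact mul_le_mul_of_nonneg_left (hK t ⟨ht.1.le, ht.2⟩) (norm_nonneg _)
    _ = (∫ t in Ioc x y, ‖g t‖) * K := integral_mul_const _ _
    _ ≤ _ := mul_le_mul_of_nonneg_right (setIntegral_mono_set hi
        (ae_of_all _ fun t => norm_nonneg _) hsub.eventuallyLE) hK0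

theorem norm_cpow_eq {m x : ℝ} (hx : 0 < x) :
    ‖(x : ℂ) ^ (1 / 2 + (m : ℂ))‖ = x ^ (1 / 2 + m) := by
  rw [cpow_eq_ofReal hx, Complex.norm_real, Real.norm_of_nonneg (Real.rpow_nonneg hx.le _)]

section LimitPoint

variable {m : ℝ} {g F D : ℝ → ℂ}

/-- The Wronskian with the singular solution grows at most like that solution. -/
theorem IsSol.norm_wronskian_singular_le (hm : 1 ≤ m) (hF : IsSol ((m : ℂ) ^ 2) g F D)
    (hg : MemLp g 2 halfLine) {h h' : ℝ → ℂ} (hh : IsSol ((m : ℂ) ^ 2) 0 h h')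
    (hn : ∀ x, 0 < x → ‖h x‖ = x ^ (1 / 2 - m)) :
    ∃ C, ∀ x ∈ Ioc (0 : ℝ) 1, ‖wronskian F D h h' x‖ ≤ C * x ^ (1 / 2 - m) := by
  refine ⟨‖wronskian F D h h' 1‖ + ∫ t in Ioc (0 : ℝ) 1, ‖g t‖, fun x hx => ?_⟩
  have h1 := hF.norm_wronskian_sub_le hh hg hx.1 hx.2 le_rfl (K := x ^ (1 / 2 - m)) fun t ht => by
    rw [hn t (hx.1.trans_le ht.1)]
    exact Real.rpow_le_rpow_of_nonpos hx.1 ht.1 (by linarith)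
  have h2 : 1 ≤ x ^ (1 / 2 - m) := Real.one_le_rpow_of_pos_of_le_one_of_nonpos hx.1 hx.2 (by linarith)
  have h3 : ‖wronskian F D h h' 1‖ ≤ ‖wronskian F D h h' 1‖ * x ^ (1 / 2 - m) :=
    le_mul_of_one_le_right (norm_nonneg _) h2
  have h4 : ‖wronskian F D h h' x‖ ≤ ‖wronskian F D h h' 1‖ +
      ‖wronskian F D h h' 1 - wronskian F D h h' x‖ := by
    have := norm_sub_le (wronskian F D h h' 1) (wronskian F D h h' 1 - wronskian F D h h' x)
    rwa [sub_sub_cancel] at this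
  linarith

/-- The increments of the Wronskian are integrals of g h. Starting from the limit 0 at the origin,
the Wronskian inherits the decay of the regular solution. -/
theorem IsSol.norm_wronskian_regular_le (hm : 1 ≤ m) (hF : IsSol ((m : ℂ) ^ 2) g F D)
    (hg : MemLp g 2 halfLine) {h h' : ℝ → ℂ} (hh : IsSol ((m : ℂ) ^ 2) 0 h h')
    (hn : ∀ x, 0 < x → ‖h x‖ = x ^ (1 / 2 + m))
    (h0 : Tendsto (wronskian F D h h') (𝓝[>] 0) (𝓝 0)) {x : ℝ} (hx : x ∈ Ioc (0 : ℝ) 1) :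
    ‖wronskian F D h h' x‖ ≤ (∫ t in Ioc (0 : ℝ) 1, ‖g t‖) * x ^ (1 / 2 + m) := by
  have t := (tendsto_const_nhds (x := wronskian F D h h' x)).sub h0
  rw [sub_zero] at t
  refine le_of_tendsto t.norm ?_
  filter_upwards [Ioc_mem_nhdsGT hx.1] with y hy
  refine hF.norm_wronskian_sub_le hh hg hy.1 hy.2 hx.2 fun t ht => ?_
  rw [hn t (hy.1.trans_le ht.1)]
  exact Real.rpow_le_rpow (hy.1.le.trans ht.1) ht.2 (by linarith)

/-- Eliminating F' between the two Wronskians W (regular solution) and V (singular solution) gives W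
x^(1/2-m) = V x^(1/2+m) + 2m F, and the V term is bounded. Wherever W stays away from 0, F must
therefore be as large as the singular solution. -/
theorem norm_wronskian_mul_le (hm : 0 ≤ m)
    (hn : ∀ x : ℝ, 0 < x → ‖(x : ℂ) ^ (1 / 2 + -(m : ℂ))‖ = x ^ (1 / 2 - m)) {C x : ℝ}
    (hx : x ∈ Ioc (0 : ℝ) 1)
    (hC : ‖wronskian F D (fun x : ℝ => (x : ℂ) ^ (1 / 2 + -(m : ℂ)))
      (fun x : ℝ => (1 / 2 + -(m : ℂ)) / x * (x : ℂ) ^ (1 / 2 + -(m : ℂ))) x‖ ≤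
        C * x ^ (1 / 2 - m)) :
    ‖wronskian F D (fun x : ℝ => (x : ℂ) ^ (1 / 2 + (m : ℂ)))
      (fun x : ℝ => (1 / 2 + (m : ℂ)) / x * (x : ℂ) ^ (1 / 2 + (m : ℂ))) x‖ * x ^ (1 / 2 - m) ≤
        |C| + 2 * m * ‖F x‖ := by
  have hx0 := hx.1
  have hw := wronskian_cpow (m : ℂ) hx0
  set W := wronskian F D (fun x : ℝ => (x : ℂ) ^ (1 / 2 + (m : ℂ)))
    (fun x : ℝ => (1 / 2 + (m : ℂ)) / x * (x : ℂ) ^ (1 / 2 + (m : ℂ))) x with hW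
  set V := wronskian F D (fun x : ℝ => (x : ℂ) ^ (1 / 2 + -(m : ℂ)))
    (fun x : ℝ => (1 / 2 + -(m : ℂ)) / x * (x : ℂ) ^ (1 / 2 + -(m : ℂ))) x with hV
  have e : W * (x : ℂ) ^ (1 / 2 + -(m : ℂ)) = V * (x : ℂ) ^ (1 / 2 + (m : ℂ)) - (-2 * m) * F x := by
    rw [← hw, hW, hV]
    simp only [wronskian]
    ring
  have := congrArg norm e
  rw [norm_mul, hn x hx0] at this
  rw [this]
  refine (norm_sub_le _ _).trans (add_le_add ?_ ?_)
  · rw [norm_mul, norm_cpow_eq hx0]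
    calc ‖V‖ * x ^ (1 / 2 + m) ≤ (C * x ^ (1 / 2 - m)) * x ^ (1 / 2 + m) :=
          mul_le_mul_of_nonneg_right hC (Real.rpow_nonneg hx0.le _)
      _ = C * x := by
          rw [mul_assoc, ← Real.rpow_add hx0]
          norm_num
      _ ≤ |C| * 1 := mul_le_mul (le_abs_self C) hx.2 hx0.le (abs_nonneg _)
      _ = |C| := mul_one _
  · rw [norm_mul, norm_mul, norm_neg, Complex.norm_ofNat, Complex.norm_real,
      Real.norm_of_nonneg hm]

theorem not_memLp_rpow (hm : 1 ≤ m) {δ : ℝ} (hδ : 0 < δ) :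
    ¬ MemLp (fun x : ℝ => x ^ (1 / 2 - m)) 2 (volume.restrict (Ioo 0 δ)) := by
  intro hmem
  have hi₀ := hmem.integrable_norm_pow (by norm_num)
  have hi₂ : IntegrableOn (fun x : ℝ => x ^ (1 - 2 * m)) (Ioo 0 δ) := by
    refine hi₀.congr ?_
    filter_upwards [ae_restrict_mem measurableSet_Ioo] with x hx
    rw [Real.norm_of_nonneg (Real.rpow_nonneg hx.1.le _), ← Real.rpow_natCast, ← Real.rpow_mul hx.1.le]
    congr 1
    push_cast
    ring
  rw [intervalIntegral.integrableOn_Ioo_rpow_iff hδ] at hi₂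
  linarith

theorem not_forall_rpow_le (hm : 1 ≤ m) {δ A B C : ℝ} (hδ : 0 < δ) (hFL : MemLp F 2 halfLine) :
    ¬ ∀ x ∈ Ioo 0 δ, ‖x ^ (1 / 2 - m)‖ ≤ A * ‖B + C * ‖F x‖‖ := by
  intro key
  have hFδ : MemLp F 2 (volume.restrict (Ioo 0 δ)) :=
    hFL.mono_measure (Measure.restrict_mono Ioo_subset_Ioi_self le_rfl)
  have hdom : MemLp (fun x => B + C * ‖F x‖) 2 (volume.restrict (Ioo 0 δ)) :=
    (memLp_const B).add (hFδ.norm.const_mul C)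
  have hcont : ContinuousOn (fun x : ℝ => x ^ (1 / 2 - m)) (Ioo 0 δ) := fun x hx =>
    (Real.continuousAt_rpow_const x _ (Or.inl hx.1.ne')).continuousWithinAt
  have hmem : MemLp (fun x : ℝ => x ^ (1 / 2 - m)) 2 (volume.restrict (Ioo 0 δ)) :=
    MemLp.of_le_mul (c := A) hdom (hcont.aestronglyMeasurable measurableSet_Ioo)
      (ae_restrict_of_forall_mem measurableSet_Ioo key)
  exact not_memLp_rpow hm hδ hmem

/-- A nonzero limit would dominate x^(1/2-m) near 0 by a square integrable function, although
x^(1-2m) is not integrable there for m ≥ 1. -/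
theorem IsSol.tendsto_wronskian_regular_zero (hm : 1 ≤ m) (hF : IsSol ((m : ℂ) ^ 2) g F D)
    (hFL : MemLp F 2 halfLine) (hg : MemLp g 2 halfLine) {b : ℂ}
    (hb : Tendsto (wronskian F D (fun x : ℝ => (x : ℂ) ^ (1 / 2 + (m : ℂ)))
      (fun x : ℝ => (1 / 2 + (m : ℂ)) / x * (x : ℂ) ^ (1 / 2 + (m : ℂ)))) (𝓝[>] 0) (𝓝 b)) :
    b = 0 := by
  by_contra hb0
  have hminus := isHom_cpow (-(m : ℂ))
  rw [neg_sq] at hminus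
  have hn : ∀ x : ℝ, 0 < x → ‖(x : ℂ) ^ (1 / 2 + -(m : ℂ))‖ = x ^ (1 / 2 - m) := fun x hx => by
    have := norm_cpow_eq (m := -m) hx
    rw [Complex.ofReal_neg] at this
    rw [this, sub_eq_add_neg]
  obtain ⟨C, hC⟩ := hF.norm_wronskian_singular_le hm hg hminus.isSol hn
  have hbpos : 0 < ‖b‖ := norm_pos_iff.2 hb0
  have ev : ∀ᶠ x in 𝓝[>] (0 : ℝ), ‖b‖ / 2 < ‖wronskian F D (fun x : ℝ => (x : ℂ) ^ (1 / 2 + (m : ℂ)))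
      (fun x : ℝ => (1 / 2 + (m : ℂ)) / x * (x : ℂ) ^ (1 / 2 + (m : ℂ))) x‖ :=
    hb.norm.eventually (lt_mem_nhds (half_lt_self hbpos))
  obtain ⟨δ, hδ0, hev⟩ := ((nhdsGT_basis (0 : ℝ)).eventually_iff).1
    (ev.and (Ioo_mem_nhdsGT (zero_lt_one (α := ℝ))))
  have key : ∀ x ∈ Ioo 0 δ, ‖x ^ (1 / 2 - m)‖ ≤ (2 / ‖b‖) * ‖|C| + 2 * m * ‖F x‖‖ := by
    intro x hx
    obtain ⟨h1, h2⟩ := hev hx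
    have hp := Real.rpow_nonneg hx.1.le (1 / 2 - m)
    have e2 := norm_wronskian_mul_le (by linarith) hn (F := F) (D := D) ⟨h2.1, h2.2.le⟩
      (hC x ⟨h2.1, h2.2.le⟩)
    have e3 := (mul_le_mul_of_nonneg_right h1.le hp).trans e2
    rw [Real.norm_of_nonneg hp, Real.norm_of_nonneg (r := |C| + 2 * m * ‖F x‖) (by positivity),
      div_mul_eq_mul_div, le_div_iff₀ hbpos]
    linarith
  exact not_forall_rpow_le hm hδ0 hFL key

/-- The Plücker identity still holds pointwise although x^(1/2-m) has no square integrable cutoff.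
Wronskians with the regular solution are O(x^(1/2+m)) and those with the singular one O(x^(1/2-m)),
so their products are O(x). -/
theorem bform_eq_zero_of_one_le {ξ : ℝ → ℝ} (hξ : IsCutoff ξ) (hm : 1 ≤ m) {p p' : L2 × L2}
    (hp : p ∈ maxGraph ((m : ℂ) ^ 2)) (hp' : p' ∈ maxGraph ((m : ℂ) ^ 2)) : bform p p' = 0 := by
  have hhalf : (1 / 2 : ℂ).re = 1 / 2 := by norm_num
  have hL : MemLp (fun x : ℝ => (x : ℂ) ^ (1 / 2 + (m : ℂ))) 2 (volume.restrict (Ioc 0 1)) :=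
    memLp_cpow (by rw [Complex.add_re, hhalf, Complex.ofReal_re]; linarith)
  have hplus := isHom_cpow (m : ℂ)
  have hminus := isHom_cpow (-(m : ℂ))
  rw [neg_sq] at hminus
  have hn : ∀ x : ℝ, 0 < x → ‖(x : ℂ) ^ (1 / 2 + -(m : ℂ))‖ = x ^ (1 / 2 - m) := fun x hx => by
    have := norm_cpow_eq (m := -m) hx
    rw [Complex.ofReal_neg] at this
    rw [this, sub_eq_add_neg]
  obtain ⟨q, hq, -⟩ := exists_isCutPair hξ hplus hL
  obtain ⟨F, D, hF, hFs⟩ := exists_isSol hp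
  obtain ⟨G, E, hG, hGs⟩ := exists_isSol hp'
  have bound : ∀ {r : L2 × L2} {F D : ℝ → ℂ}, r.1 =ᵐ[halfLine] F → IsSol ((m : ℂ) ^ 2) r.2 F D →
      ∃ B C : ℝ, ∀ x ∈ Ioc (0 : ℝ) 1,
        ‖wronskian F D (fun x : ℝ => (x : ℂ) ^ (1 / 2 + (m : ℂ)))
          (fun x : ℝ => (1 / 2 + (m : ℂ)) / x * (x : ℂ) ^ (1 / 2 + (m : ℂ))) x‖ ≤
            B * x ^ (1 / 2 + m) ∧
        ‖wronskian F D (fun x : ℝ => (x : ℂ) ^ (1 / 2 + -(m : ℂ)))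
          (fun x : ℝ => (1 / 2 + -(m : ℂ)) / x * (x : ℂ) ^ (1 / 2 + -(m : ℂ))) x‖ ≤
            C * x ^ (1 / 2 - m) := by
    intro r F D hF hFs
    have t := hq.tendsto_wronskian hξ hplus hL hF hFs
    have h0 := hFs.tendsto_wronskian_regular_zero hm ((memLp_congr_ae hF).1 (Lp.memLp _))
      (Lp.memLp _) t
    rw [h0] at t
    obtain ⟨C, hC⟩ := hFs.norm_wronskian_singular_le hm (Lp.memLp _) hminus.isSol hn
    exact ⟨_, C, fun x hx => ⟨hFs.norm_wronskian_regular_le hm (Lp.memLp _) hplus.isSol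
      (fun x hx => norm_cpow_eq hx) t hx, hC x hx⟩⟩
  obtain ⟨B₁, C₁, hb₁⟩ := bound hF hFs
  obtain ⟨B₂, C₂, hb₂⟩ := bound hG hGs
  have t := (tendsto_wronskian_bform hF hFs hG hGs).const_mul (-2 * (m : ℂ))
  have t0 : Tendsto (fun x => (-2 * (m : ℂ)) * wronskian F D G E x) (𝓝[>] 0) (𝓝 0) := by
    have lim : Tendsto (fun x : ℝ => (B₁ * C₂ + C₁ * B₂) * x) (𝓝[>] 0) (𝓝 0) := by
      have : Tendsto (fun x : ℝ => (B₁ * C₂ + C₁ * B₂) * x) (𝓝 0) (𝓝 ((B₁ * C₂ + C₁ * B₂) * 0)) :=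
        (continuous_const.mul continuous_id).tendsto 0
      rw [mul_zero] at this
      exact this.mono_left nhdsWithin_le_nhds
    refine squeeze_zero_norm' ?_ lim
    filter_upwards [Ioc_mem_nhdsGT zero_lt_one] with x hx
    have hx0 := hx.1
    obtain ⟨b1, c1⟩ := hb₁ x hx
    obtain ⟨b2, c2⟩ := hb₂ x hx
    have e := wronskian_cpow (m : ℂ) hx0
    set W₁ := wronskian F D (fun x : ℝ => (x : ℂ) ^ (1 / 2 + (m : ℂ)))
      (fun x : ℝ => (1 / 2 + (m : ℂ)) / x * (x : ℂ) ^ (1 / 2 + (m : ℂ))) x with hW₁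
    set V₁ := wronskian F D (fun x : ℝ => (x : ℂ) ^ (1 / 2 + -(m : ℂ)))
      (fun x : ℝ => (1 / 2 + -(m : ℂ)) / x * (x : ℂ) ^ (1 / 2 + -(m : ℂ))) x with hV₁
    set W₂ := wronskian G E (fun x : ℝ => (x : ℂ) ^ (1 / 2 + (m : ℂ)))
      (fun x : ℝ => (1 / 2 + (m : ℂ)) / x * (x : ℂ) ^ (1 / 2 + (m : ℂ))) x with hW₂
    set V₂ := wronskian G E (fun x : ℝ => (x : ℂ) ^ (1 / 2 + -(m : ℂ)))
      (fun x : ℝ => (1 / 2 + -(m : ℂ)) / x * (x : ℂ) ^ (1 / 2 + -(m : ℂ))) x with hV₂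
    have e2 : (-2 * (m : ℂ)) * wronskian F D G E x = W₁ * V₂ - V₁ * W₂ := by
      rw [← e, hW₁, hV₁, hW₂, hV₂]
      simp only [wronskian]
      ring
    have e3 : x ^ (1 / 2 + m) * x ^ (1 / 2 - m) = x := by
      rw [← Real.rpow_add hx0]
      norm_num
    rw [e2]
    calc ‖W₁ * V₂ - V₁ * W₂‖ ≤ ‖W₁‖ * ‖V₂‖ + ‖V₁‖ * ‖W₂‖ := by
          rw [← norm_mul, ← norm_mul]
          exact norm_sub_le _ _
      _ ≤ (B₁ * x ^ (1 / 2 + m)) * (C₂ * x ^ (1 / 2 - m)) +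
          (C₁ * x ^ (1 / 2 - m)) * (B₂ * x ^ (1 / 2 + m)) :=
        add_le_add (mul_le_mul b1 c2 (norm_nonneg _) ((norm_nonneg _).trans b1))
          (mul_le_mul c1 b2 (norm_nonneg _) ((norm_nonneg _).trans c1))
      _ = (B₁ * C₂ + C₁ * B₂) * (x ^ (1 / 2 + m) * x ^ (1 / 2 - m)) := by ring
      _ = _ := by rw [e3]
  have := tendsto_nhds_unique t t0
  have hm0 : (-2 * (m : ℂ)) ≠ 0 := mul_ne_zero (by norm_num) (by exact_mod_cast (by linarith : m ≠ 0))
  exact neg_eq_zero.1 ((mul_eq_zero.1 this).resolve_left hm0)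

end LimitPoint

theorem LMin_eq_H_of_one_le {ξ : ℝ → ℝ} (hξ : IsCutoff ξ) {a : ℝ} (ha : 1 ≤ a) :
    LMin (a : ℂ) = H ξ ((√a : ℝ) : ℂ) ∧ IsEssentiallySelfAdjoint (LTest (a : ℂ)) := by
  have hm : ((√a : ℝ) : ℂ) ^ 2 = a := by rw [← Complex.ofReal_pow, Real.sq_sqrt (by linarith)]
  have h1 : 1 ≤ √a := Real.one_le_sqrt.2 ha
  have hle : maxGraph (a : ℂ) ≤ (LMin (a : ℂ)).graph := fun p hp => by
    refine mem_graph_LMin_iff.2 ⟨hp, fun q hq => ?_⟩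
    rw [← hm] at hp hq
    exact bform_eq_zero_of_one_le hξ h1 hq hp
  refine ⟨le_antisymm ?_ (LinearPMap.le_of_le_graph fun p hp => hle ?_),
    (isSelfAdjoint_LMin_iff a).2 hle⟩
  · rw [← hm]
    exact LMin_le_H ξ _
  · rw [← hm]
    exact (mem_graph_H.1 hp).1

/-! ### The Dirichlet and Neumann Laplacians -/

theorem integral_mul_deriv_test {v k : ℝ → ℂ} (hv : ContinuousOn v (Ioi 0))
    (hk : ∀ a b, 0 < a → 0 < b → IntervalIntegrable k volume a b)
    (h : ∀ a b, 0 < a → 0 < b → v b - v a = ∫ x in a..b, k x) {φ : ℝ → ℂ} (hφ : IsTest φ) :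
    ∫ x in Ioi (0 : ℝ), v x * deriv φ x = -∫ x in Ioi (0 : ℝ), k x * φ x := by
  obtain ⟨a, b, ha, hab, hs⟩ := hφ.exists_Ioo
  have hz : ∀ x ∉ Ioo a b, φ x = 0 := fun x hx =>
    image_eq_zero_of_notMem_tsupport fun h' => hx (hs h')
  have hz' : ∀ x ∉ Ioo a b, deriv φ x = 0 := fun x hx =>
    image_eq_zero_of_notMem_tsupport fun h' => hx (hs (tsupport_deriv_subset h'))
  have hb : 0 < b := ha.trans hab
  have e := integral_deriv_mul_primitive hab.le
    (fun x _ => (hφ.differentiable x).hasDerivAt) (hφ.deriv.smooth.continuous.continuousOn)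
    (hk a b ha hb) (v := v) (fun x hx => by rw [← h a x ha (ha.trans_le hx.1)]; ring)
  have i1 : IntervalIntegrable (fun x => deriv φ x * v x) volume a b :=
    ContinuousOn.intervalIntegrable (hφ.deriv.smooth.continuous.continuousOn.mul
      (hv.mono (uIcc_subset_Ioi ha hb)))
  have i2 : IntervalIntegrable (fun x => φ x * k x) volume a b :=
    (hk a b ha hb).continuousOn_mul hφ.smooth.continuous.continuousOn
  rw [hz a (by simp), hz b (by simp), zero_mul, zero_mul, sub_zero,
    intervalIntegral.integral_add i1 i2] at e
  rw [setIntegral_mul_eq_intervalIntegral ha hab v hz',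
    setIntegral_mul_eq_intervalIntegral ha hab k hz]
  simp only [mul_comm (v _), mul_comm (k _)]
  linear_combination -e

theorem mem_maxGraph_of_hasWeakDeriv {f d g : L2} (h1 : HasWeakDeriv f d)
    (h2 : HasWeakDeriv d (-g)) : (f, g) ∈ maxGraph (1 / 4) := by
  intro φ hφ
  have e1 := h1 _ hφ.deriv
  have e2 := h2 _ hφ
  rw [e2, ← neg_one_smul ℂ g, integral_smul_test] at e1
  have e3 : ∫ x in Ioi (0 : ℝ), f x * expr (1 / 4) φ x =
      -∫ x in Ioi (0 : ℝ), f x * deriv (deriv φ) x := by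
    rw [← integral_neg]
    congr 1
    ext x
    simp only [expr]
    ring
  change ∫ x in Ioi (0 : ℝ), f x * expr (1 / 4) φ x = ∫ x in Ioi (0 : ℝ), g x * φ x
  rw [e3, e1]
  ring

theorem vanishesAtZero_iff {f : L2} {F : ℝ → ℂ} (hF : f =ᵐ[halfLine] F)
    (hc : ContinuousOn F (Ioi 0)) : VanishesAtZero f ↔ Tendsto F (𝓝[>] 0) (𝓝 0) := by
  constructor
  · rintro ⟨G, hG, hG0, hfG⟩
    have e : EqOn G F (Ioi 0) := Measure.eqOn_open_of_ae_eq (μ := volume) (hfG.symm.trans hF)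
      isOpen_Ioi (hG.mono Ioi_subset_Ici_self) hc
    have h1 : Tendsto G (𝓝[>] 0) (𝓝 (G 0)) :=
      (hG 0 self_mem_Ici).mono_left (nhdsWithin_mono _ Ioi_subset_Ici_self)
    rw [hG0] at h1
    refine h1.congr' ?_
    filter_upwards [self_mem_nhdsWithin] with x hx using e hx
  · intro h
    refine ⟨Function.update F 0 0, fun x hx => ?_, Function.update_self _ _ _, ?_⟩
    · rcases eq_or_lt_of_le (mem_Ici.1 hx) with rfl | hx0
      · rw [continuousWithinAt_update_same, Ici_sdiff_left]
        exact h
      · refine ContinuousAt.continuousWithinAt ?_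
        exact ((hc x hx0).continuousAt (Ioi_mem_nhds hx0)).congr
          (by
            filter_upwards [isOpen_ne.mem_nhds hx0.ne'] with y hy
            rw [Function.update_of_ne hy])
    · filter_upwards [hF, ae_restrict_mem measurableSet_Ioi] with x h1 hx
      rw [Function.update_of_ne (ne_of_gt hx), h1]

/-! ### Regularity for the free equation -F'' = g. -/

section Free

variable {g F D : ℝ → ℂ}

theorem IsSol.deriv_sub_eq (h : IsSol (1 / 4) g F D) {a b : ℝ} (ha : 0 < a) (hb : 0 < b) :
    D b - D a = ∫ x in a..b, -g x := by
  rw [h.sub_eq a b ha hb]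
  simp only [pot_quarter, zero_mul, zero_sub]

theorem IsSol.sub_eq_integral (h : IsSol (1 / 4) g F D) {a b : ℝ} (ha : 0 < a) (hb : 0 < b) :
    F b - F a = ∫ x in a..b, D x :=
  (intervalIntegral.integral_eq_sub_of_hasDerivAt
    (fun x hx => h.hasDerivAt x (uIcc_subset_Ioi ha hb hx))
    (ContinuousOn.intervalIntegrable (h.continuousOn_deriv.mono (uIcc_subset_Ioi ha hb)))).symm

theorem IsSol.tendsto_deriv_zero (h : IsSol (1 / 4) g F D) (hg : MemLp g 2 halfLine) :
    ∃ d, Tendsto D (𝓝[>] 0) (𝓝 d) := by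
  refine ⟨_, ((tendsto_intervalIntegral_zero (integrableOn_unit hg)).const_add (D 1)).congr' ?_⟩
  filter_upwards [self_mem_nhdsWithin] with x hx
  have := h.deriv_sub_eq hx one_pos
  rw [intervalIntegral.integral_neg] at this
  linear_combination this

theorem IsSol.norm_deriv_le (h : IsSol (1 / 4) g F D) (hg : MemLp g 2 halfLine) {x : ℝ}
    (hx : x ∈ Ioc (0 : ℝ) 1) : ‖D x‖ ≤ ‖D 1‖ + ∫ t in Ioc (0 : ℝ) 1, ‖g t‖ := by
  have hi : IntegrableOn (fun t => ‖g t‖) (Ioc 0 1) volume := (integrableOn_unit hg).norm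
  have e := h.deriv_sub_eq hx.1 one_pos
  have e1 : D x = D 1 - ∫ t in x..1, -g t := by linear_combination -e
  rw [e1]
  refine (norm_sub_le _ _).trans (add_le_add_right ?_ _)
  rw [intervalIntegral.integral_of_le hx.2]
  refine (norm_integral_le_integral_norm _).trans ?_
  simp only [norm_neg]
  exact setIntegral_mono_set hi (ae_of_all _ fun t => norm_nonneg _)
    (Ioc_subset_Ioc_left hx.1.le).eventuallyLE

/-- This energy identity converts integrability of |F'|² at infinity into convergence of F̄F' and of
the integral of F̄g. -/
theorem IsSol.integral_norm_deriv_sq (h : IsSol (1 / 4) g F D) {b : ℝ} (hb : 1 ≤ b) :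
    ((∫ x in (1 : ℝ)..b, ‖D x‖ ^ 2 : ℝ) : ℂ) = starRingEnd ℂ (F b) * D b -
      starRingEnd ℂ (F 1) * D 1 + ∫ x in (1 : ℝ)..b, starRingEnd ℂ (F x) * g x := by
  have hb0 : 0 < b := one_pos.trans_le hb
  have hsub : Icc 1 b ⊆ Ioi 0 := fun x hx => one_pos.trans_le hx.1
  have hsub' : uIcc 1 b ⊆ Ioi 0 := uIcc_subset_Ioi one_pos hb0
  have hcD : ContinuousOn (fun x => starRingEnd ℂ (D x)) (Ioi 0) :=
    Complex.continuous_conj.comp_continuousOn h.continuousOn_deriv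
  have hcF : ContinuousOn (fun x => starRingEnd ℂ (F x)) (Ioi 0) :=
    Complex.continuous_conj.comp_continuousOn h.continuousOn
  have e := integral_deriv_mul_primitive hb (u := fun x => starRingEnd ℂ (F x))
    (u' := fun x => starRingEnd ℂ (D x)) (fun x hx => (h.hasDerivAt x (hsub hx)).star)
    (hcD.mono hsub) (h.intervalIntegrable 1 b one_pos hb0).neg (v := D)
    (fun x hx => by
      have := h.deriv_sub_eq one_pos (hsub hx)
      simp only [Pi.neg_apply]
      linear_combination this)
  have i1 : IntervalIntegrable (fun x => starRingEnd ℂ (D x) * D x) volume 1 b :=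
    ContinuousOn.intervalIntegrable ((hcD.mul h.continuousOn_deriv).mono hsub')
  have i2 : IntervalIntegrable (fun x => starRingEnd ℂ (F x) * (-g) x) volume 1 b :=
    (h.intervalIntegrable 1 b one_pos hb0).neg.continuousOn_mul (hcF.mono hsub')
  rw [intervalIntegral.integral_add i1 i2] at e
  simp only [Pi.neg_apply, mul_neg, intervalIntegral.integral_neg] at e
  rw [← intervalIntegral.integral_ofReal]
  simp only [Complex.conj_mul', Complex.ofReal_pow] at e ⊢
  linear_combination -e

/-- Near 0 the derivative is bounded because g is integrable there; at infinity the energy identity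
applies. Hence the maximal domain at α = 1/4 is the Sobolev space H². -/
theorem IsSol.memLp_deriv (h : IsSol (1 / 4) g F D) (hF : MemLp F 2 halfLine)
    (hg : MemLp g 2 halfLine) : MemLp D 2 halfLine := by
  rw [memLp_two_iff_integrable_sq_norm (h.continuousOn_deriv.aestronglyMeasurable measurableSet_Ioi)]
  have hc : ContinuousOn (fun x => ‖D x‖ ^ 2) (Ioi 0) := h.continuousOn_deriv.norm.pow 2
  have i1 : IntegrableOn (fun x => ‖D x‖ ^ 2) (Ioc 0 1) volume := by
    refine Integrable.of_bound ((hc.mono Ioc_subset_Ioi_self).aestronglyMeasurable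
      measurableSet_Ioc) ((‖D 1‖ + ∫ t in Ioc (0 : ℝ) 1, ‖g t‖) ^ 2) ?_
    filter_upwards [ae_restrict_mem measurableSet_Ioc] with x hx
    rw [norm_pow, norm_norm]
    exact pow_le_pow_left₀ (norm_nonneg _) (h.norm_deriv_le hg hx) 2
  obtain ⟨t1, t2⟩ := h.tendsto_atTop hF hg
  have hFg : Integrable (fun x => starRingEnd ℂ (F x) * g x) halfLine := hF.star.integrable_mul hg
  have hFg1 : IntegrableOn (fun x => starRingEnd ℂ (F x) * g x) (Ioi 1) volume :=
    IntegrableOn.mono_set (s := Ioi 1) hFg (Ioi_subset_Ioi zero_le_one)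
  have lim : Tendsto (fun b => ((∫ x in (1 : ℝ)..b, ‖D x‖ ^ 2 : ℝ) : ℂ)) atTop
      (𝓝 (starRingEnd ℂ 0 * 0 - starRingEnd ℂ (F 1) * D 1 +
        ∫ x in Ioi (1 : ℝ), starRingEnd ℂ (F x) * g x)) := by
    refine (((((Complex.continuous_conj.tendsto 0).comp t1).mul t2).sub_const _).add
      (intervalIntegral_tendsto_integral_Ioi 1 hFg1 tendsto_id)).congr' ?_
    filter_upwards [eventually_ge_atTop 1] with b hb
    rw [h.integral_norm_deriv_sq hb]
    rfl
  have i2 : IntegrableOn (fun x => ‖D x‖ ^ 2) (Ioi 1) volume := by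
    refine integrableOn_Ioi_of_intervalIntegral_norm_tendsto (b := id)
      ((starRingEnd ℂ 0 * 0 - starRingEnd ℂ (F 1) * D 1 +
        ∫ x in Ioi (1 : ℝ), starRingEnd ℂ (F x) * g x).re) 1 (fun b => ?_) tendsto_id ?_
    · exact (hc.mono fun x hx => one_pos.trans_le hx.1).integrableOn_Icc.mono_set
        Ioc_subset_Icc_self
    · refine ((Complex.continuous_re.tendsto _).comp lim).congr fun b => ?_
      simp only [Function.comp, Complex.ofReal_re, norm_pow, norm_norm, id]
  have := i1.union i2
  rwa [Ioc_union_Ioi_eq_Ioi zero_le_one] at this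

end Free

theorem hasWeakDeriv_iff_ae_eq {p : L2 × L2} {F D : ℝ → ℂ} (hF : p.1 =ᵐ[halfLine] F)
    (h : IsSol (1 / 4) p.2 F D) (d : L2) :
    (HasWeakDeriv p.1 d ∧ HasWeakDeriv d (-p.2)) ↔ d =ᵐ[halfLine] D := by
  have hw : ∀ φ, IsTest φ →
      ∫ x in Ioi (0 : ℝ), p.1 x * deriv φ x = -∫ x in Ioi (0 : ℝ), D x * φ x := by
    intro φ hφ
    rw [← integral_mul_deriv_test h.continuousOn (fun a b ha hb => ContinuousOn.intervalIntegrable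
      (h.continuousOn_deriv.mono (uIcc_subset_Ioi ha hb)))
      (fun a b ha hb => h.sub_eq_integral ha hb) hφ]
    exact integral_congr_ae (hF.mono fun x hx => by simp only [hx])
  constructor
  · rintro ⟨h1, -⟩
    have l1 := MemLp.locallyIntegrableOn_Ioi (Lp.memLp d)
    have l2 := h.continuousOn_deriv.locallyIntegrableOn (μ := volume) measurableSet_Ioi
    have := ae_eq_zero_of_test (u := fun x => d x - D x) (l1.sub l2) fun φ hφ => by
      have e1 := h1 φ hφ
      rw [hw φ hφ, neg_inj] at e1
      simp only [sub_mul]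
      rw [integral_sub (hφ.integrable_mul l1) (hφ.integrable_mul l2), e1, sub_self]
    filter_upwards [this] with x hx using sub_eq_zero.1 hx
  · intro hd
    refine ⟨fun φ hφ => ?_, fun φ hφ => ?_⟩
    · rw [hw φ hφ]
      congr 1
      exact integral_congr_ae (hd.mono fun x hx => by simp only [hx])
    · have e1 : ∫ x in Ioi (0 : ℝ), d x * deriv φ x = ∫ x in Ioi (0 : ℝ), D x * deriv φ x :=
        integral_congr_ae (hd.mono fun x hx => by simp only [hx])
      rw [e1, integral_mul_deriv_test h.continuousOn_deriv
        (fun a b ha hb => (h.intervalIntegrable a b ha hb).neg)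
        (fun a b ha hb => h.deriv_sub_eq ha hb) hφ]
      congr 1
      refine integral_congr_ae ?_
      filter_upwards [Lp.coeFn_neg p.2] with x hx
      rw [hx]

/-- Common reduction for the Dirichlet and Neumann graphs: membership in H² becomes membership in
the maximal graph, and `P` carries the boundary condition. -/
theorem exists_hasWeakDeriv_iff {p : L2 × L2} {P : L2 → Prop} :
    (∃ d : L2, HasWeakDeriv p.1 d ∧ HasWeakDeriv d (-p.2) ∧ P d) ↔
      p ∈ maxGraph (1 / 4) ∧ ∀ F D, p.1 =ᵐ[halfLine] F → IsSol (1 / 4) p.2 F D →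
        ∀ d : L2, d =ᵐ[halfLine] D → P d := by
  constructor
  · rintro ⟨d, h1, h2, h3⟩
    refine ⟨mem_maxGraph_of_hasWeakDeriv h1 h2, fun F D hF h d' hd' => ?_⟩
    have := (hasWeakDeriv_iff_ae_eq hF h d).1 ⟨h1, h2⟩
    rwa [Lp.ext (hd'.trans this.symm)]
  · rintro ⟨hp, h⟩
    obtain ⟨F, D, hF, hs⟩ := exists_isSol hp
    have hD := hs.memLp_deriv ((memLp_congr_ae hF).1 (Lp.memLp _)) (Lp.memLp _)
    have hd := (hasWeakDeriv_iff_ae_eq hF hs (hD.toLp D)).2 hD.coeFn_toLp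
    exact ⟨_, hd.1, hd.2, h F D hF hs _ hD.coeFn_toLp⟩

theorem mem_graph_H_quarter {ξ : ℝ → ℝ} (hξ : IsCutoff ξ) {m : ℂ} (hm : m ^ 2 = 1 / 4)
    (h1 : -1 < m.re) (h2 : m.re < 1) {p : L2 × L2} {F D : ℝ → ℂ} (hp : p ∈ maxGraph (1 / 4))
    (hF : p.1 =ᵐ[halfLine] F) (h : IsSol (1 / 4) p.2 F D) :
    p ∈ (H ξ m).graph ↔ Tendsto (wronskian F D (fun x : ℝ => (x : ℂ) ^ (1 / 2 + m))
      (fun x : ℝ => (1 / 2 + m) / x * (x : ℂ) ^ (1 / 2 + m))) (𝓝[>] 0) (𝓝 0) := by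
  have hq4 : ((1 / 4 : ℝ) : ℂ) = 1 / 4 := by push_cast; rfl
  obtain ⟨h₂, h₂', w, hf⟩ := exists_isFund h1 h2
  rw [hm, ← hq4] at hf
  obtain ⟨q, hq, -⟩ := exists_isCutPair hξ hf.left hf.memLp_left
  rw [hf.mem_graph_H_iff (by rw [hm, hq4]) hξ hq, hq4]
  have t := hq.tendsto_wronskian hξ hf.left hf.memLp_left hF (by rw [hq4]; exact h)
  constructor
  · rintro ⟨-, h0⟩
    rwa [h0, neg_zero] at t
  · intro t0
    exact ⟨hp, neg_eq_zero.1 (tendsto_nhds_unique t t0)⟩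

theorem H_half_eq {ξ : ℝ → ℝ} (hξ : IsCutoff ξ) : H ξ (1 / 2) = dirichletLaplacian := by
  refine LinearPMap.eq_of_eq_graph (Submodule.ext fun p => ?_)
  rw [graph_dirichletLaplacian]
  have hm : (1 / 2 : ℂ) ^ 2 = 1 / 4 := by norm_num
  have hre : (1 / 2 : ℂ).re = 1 / 2 := by norm_num
  change _ ↔ ∃ d : L2, HasWeakDeriv p.1 d ∧ HasWeakDeriv d (-p.2) ∧ VanishesAtZero p.1
  rw [exists_hasWeakDeriv_iff (P := fun _ => VanishesAtZero p.1)]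
  have key : ∀ {F D : ℝ → ℂ}, p ∈ maxGraph (1 / 4) → p.1 =ᵐ[halfLine] F →
      IsSol (1 / 4) p.2 F D → (p ∈ (H ξ (1 / 2)).graph ↔ VanishesAtZero p.1) := by
    intro F D hp hF h
    rw [mem_graph_H_quarter hξ hm (by rw [hre]; norm_num) (by rw [hre]; norm_num) hp hF h,
      vanishesAtZero_iff hF h.continuousOn]
    obtain ⟨d, hd⟩ := h.tendsto_deriv_zero (Lp.memLp _)
    have hx : Tendsto (fun x : ℝ => (x : ℂ)) (𝓝[>] 0) (𝓝 0) := by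
      have := (Complex.continuous_ofReal.tendsto (0 : ℝ))
      rw [Complex.ofReal_zero] at this
      exact this.mono_left nhdsWithin_le_nhds
    have t := hd.mul hx
    rw [mul_zero] at t
    -- For m = 1/2 the solution is x and the Wronskian is F - xD. As D has a limit at 0, its limit
    -- is that of F.
    have e : wronskian F D (fun x : ℝ => (x : ℂ) ^ (1 / 2 + 1 / 2 : ℂ))
        (fun x : ℝ => (1 / 2 + 1 / 2) / x * (x : ℂ) ^ (1 / 2 + 1 / 2 : ℂ)) =ᶠ[𝓝[>] 0]
        fun x => F x - D x * x := by
      filter_upwards [self_mem_nhdsWithin] with x hx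
      have hx0 : (x : ℂ) ≠ 0 := by exact_mod_cast (ne_of_gt hx : x ≠ 0)
      simp only [wronskian, add_halves, Complex.cpow_one]
      field_simp
    rw [tendsto_congr' e]
    constructor
    · intro t'
      simpa using t'.add t
    · intro t'
      simpa using t'.sub t
  constructor
  · intro hp
    have hmax := (mem_graph_H.1 hp).1
    rw [hm] at hmax
    exact ⟨hmax, fun F D hF h _ _ => (key hmax hF h).1 hp⟩
  · rintro ⟨hmax, h⟩
    obtain ⟨F, D, hF, hs⟩ := exists_isSol hmax
    have hD := hs.memLp_deriv ((memLp_congr_ae hF).1 (Lp.memLp _)) (Lp.memLp _)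
    exact (key hmax hF hs).2 (h F D hF hs _ hD.coeFn_toLp)

theorem H_neg_half_eq {ξ : ℝ → ℝ} (hξ : IsCutoff ξ) : H ξ (-1 / 2) = neumannLaplacian := by
  refine LinearPMap.eq_of_eq_graph (Submodule.ext fun p => ?_)
  rw [graph_neumannLaplacian]
  have hm : (-1 / 2 : ℂ) ^ 2 = 1 / 4 := by norm_num
  have hre : (-1 / 2 : ℂ).re = -1 / 2 := by norm_num
  change _ ↔ ∃ d : L2, HasWeakDeriv p.1 d ∧ HasWeakDeriv d (-p.2) ∧ VanishesAtZero d
  rw [exists_hasWeakDeriv_iff]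
  have key : ∀ {F D : ℝ → ℂ}, p ∈ maxGraph (1 / 4) → p.1 =ᵐ[halfLine] F →
      IsSol (1 / 4) p.2 F D → ∀ d : L2, d =ᵐ[halfLine] D →
      (p ∈ (H ξ (-1 / 2)).graph ↔ VanishesAtZero d) := by
    intro F D hp hF h d hd
    rw [mem_graph_H_quarter hξ hm (by rw [hre]; norm_num) (by rw [hre]; norm_num) hp hF h,
      vanishesAtZero_iff hd h.continuousOn_deriv]
    -- For m = -1/2 the solution is the constant 1 and the Wronskian is -D.
    have e : wronskian F D (fun x : ℝ => (x : ℂ) ^ (1 / 2 + -1 / 2 : ℂ))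
        (fun x : ℝ => (1 / 2 + -1 / 2) / x * (x : ℂ) ^ (1 / 2 + -1 / 2 : ℂ)) = fun x => -D x := by
      ext x
      have h0 : (1 / 2 + -1 / 2 : ℂ) = 0 := by norm_num
      simp only [wronskian, h0, Complex.cpow_zero, zero_div]
      ring
    rw [e]
    constructor
    · intro t'
      simpa using t'.neg
    · intro t'
      simpa using t'.neg
  constructor
  · intro hp
    have hmax := (mem_graph_H.1 hp).1
    rw [hm] at hmax
    exact ⟨hmax, fun F D hF h d hd => (key hmax hF h d hd).1 hp⟩
  · rintro ⟨hmax, h⟩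
    obtain ⟨F, D, hF, hs⟩ := exists_isSol hmax
    have hD := hs.memLp_deriv ((memLp_congr_ae hF).1 (Lp.memLp _)) (Lp.memLp _)
    exact (key hmax hF hs _ hD.coeFn_toLp).2 (h F D hF hs _ hD.coeFn_toLp)

/-! ### Factorization -/

/-- `ψ = f' - (1/2 + m) x⁻¹ f`, and `g = -ψ' - (1/2 + m) x⁻¹ ψ`, where `ψ` is a test function. -/
def IsFactored (m : ℝ) (r : L2 × L2) (ψ : L2) : Prop :=
  ∃ e e' η : ℝ → ℂ, r.1 =ᵐ[halfLine] e ∧ (∀ x, 0 < x → HasDerivAt e (e' x) x) ∧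
    ContinuousOn e' (Ioi 0) ∧ IsTest η ∧ ψ =ᵐ[halfLine] η ∧
    (∀ x, 0 < x → η x = e' x - (1 / 2 + m) / x * e x) ∧
    r.2 =ᵐ[halfLine] fun x => -deriv η x - (1 / 2 + m) / x * η x

theorem IsFactored.add {m : ℝ} {r r' : L2 × L2} {ψ ψ' : L2} (h : IsFactored m r ψ)
    (h' : IsFactored m r' ψ') : IsFactored m (r + r') (ψ + ψ') := by
  obtain ⟨e, e', η, h1, h2, h3, h4, h5, h6, h7⟩ := h
  obtain ⟨f, f', θ, k1, k2, k3, k4, k5, k6, k7⟩ := h'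
  refine ⟨e + f, e' + f', η + θ, (Lp.coeFn_add _ _).trans (h1.add k1),
    fun x hx => (h2 x hx).add (k2 x hx), h3.add k3, h4.add k4, (Lp.coeFn_add _ _).trans (h5.add k5),
    fun x hx => ?_, (Lp.coeFn_add _ _).trans ((h7.add k7).trans (ae_of_all _ fun x => ?_))⟩
  · simp only [Pi.add_apply, h6 x hx, k6 x hx]
    ring
  · simp only [Pi.add_apply]
    rw [deriv_add (h4.differentiable x) (k4.differentiable x)]
    ring

theorem IsFactored.smul {m : ℝ} {r : L2 × L2} {ψ : L2} (h : IsFactored m r ψ) (c : ℂ) :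
    IsFactored m (c • r) (c • ψ) := by
  obtain ⟨e, e', η, h1, h2, h3, h4, h5, h6, h7⟩ := h
  refine ⟨c • e, c • e', c • η, (Lp.coeFn_smul _ _).trans (h1.const_smul c),
    fun x hx => (h2 x hx).const_smul c, h3.const_smul c, h4.smul c,
    (Lp.coeFn_smul _ _).trans (h5.const_smul c), fun x hx => ?_,
    (Lp.coeFn_smul _ _).trans ((h7.const_smul c).trans (ae_of_all _ fun x => ?_))⟩
  · simp only [Pi.smul_apply, smul_eq_mul, h6 x hx]
    ring
  · simp only [Pi.smul_apply, smul_eq_mul]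
    rw [deriv_const_smul c (h4.differentiable x), smul_eq_mul]
    ring

theorem IsFactored.sub {m : ℝ} {r r' : L2 × L2} {ψ ψ' : L2} (h : IsFactored m r ψ)
    (h' : IsFactored m r' ψ') : IsFactored m (r - r') (ψ - ψ') := by
  have := h.add (h'.smul (-1))
  rwa [neg_one_smul, neg_one_smul, ← sub_eq_add_neg, ← sub_eq_add_neg] at this

theorem IsTest.div_mul {φ : ℝ → ℂ} (h : IsTest φ) (c : ℂ) : IsTest fun x : ℝ => c / x * φ x := by
  obtain ⟨a, b, ha, hab, hs⟩ := h.exists_Ioo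
  refine isTest_of_contDiffOn ha (b := b) ?_ fun x hx => ?_
  · simp only [div_eq_mul_inv]
    refine ContDiffOn.mul (contDiffOn_const.mul (ContDiffOn.inv
      Complex.ofRealCLM.contDiff.contDiffOn fun x hx => ?_)) h.smooth.contDiffOn
    exact Complex.ofReal_ne_zero.2 (ne_of_gt hx)
  · rw [image_eq_zero_of_notMem_tsupport fun h' => hx ⟨(hs h').1.le, (hs h').2.le⟩, mul_zero]

/-- The quadratic form of a factored pair is a square. -/
theorem IsFactored.inner_eq {m : ℝ} {r : L2 × L2} {ψ : L2} (h : IsFactored m r ψ) :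
    ⟪r.1, r.2⟫_ℂ = ⟪ψ, ψ⟫_ℂ := by
  obtain ⟨e, e', η, h1, h2, h3, h4, h5, h6, h7⟩ := h
  rw [inner_eq_integral, inner_eq_integral]
  have hce : ContinuousOn (fun x => starRingEnd ℂ (e x)) (Ioi 0) := fun x hx =>
    (Complex.continuous_conj.continuousAt.comp (h2 x hx).continuousAt).continuousWithinAt
  have hce' : ContinuousOn (fun x => starRingEnd ℂ (e' x)) (Ioi 0) :=
    Complex.continuous_conj.comp_continuousOn h3
  have hii : ∀ a b, 0 < a → 0 < b →
      IntervalIntegrable (fun x => starRingEnd ℂ (e' x)) volume a b := fun a b ha hb =>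
    ContinuousOn.intervalIntegrable (hce'.mono (uIcc_subset_Ioi ha hb))
  -- All the regularity needed is carried by η = A e, a test function, so no boundary term arises
  -- however singular `e` is at 0.
  have hp := integral_mul_deriv_test hce hii (fun a b ha hb =>
    (intervalIntegral.integral_eq_sub_of_hasDerivAt
      (fun x hx => (h2 x (uIcc_subset_Ioi ha hb hx)).star) (hii a b ha hb)).symm) h4
  have l1 := hce.locallyIntegrableOn (μ := volume) measurableSet_Ioi
  have l2 := hce'.locallyIntegrableOn (μ := volume) measurableSet_Ioi
  have hd := h4.div_mul (1 / 2 + m)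
  have e1 : ∫ x in Ioi (0 : ℝ), starRingEnd ℂ (r.1 x) * r.2 x =
      ∫ x in Ioi (0 : ℝ), (-(starRingEnd ℂ (e x) * deriv η x) -
        starRingEnd ℂ (e x) * ((1 / 2 + m) / x * η x)) := by
    refine integral_congr_ae ?_
    filter_upwards [h1, h7] with x k1 k2
    rw [k1, k2]
    ring
  have e2 : ∫ x in Ioi (0 : ℝ), starRingEnd ℂ (ψ x) * ψ x =
      ∫ x in Ioi (0 : ℝ), (starRingEnd ℂ (e' x) * η x -
        starRingEnd ℂ (e x) * ((1 / 2 + m) / x * η x)) := by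
    refine integral_congr_ae ?_
    filter_upwards [h5, ae_restrict_mem measurableSet_Ioi] with x k1 hx
    have k2 : starRingEnd ℂ (η x) = starRingEnd ℂ (e' x) - (1 / 2 + m) / x * starRingEnd ℂ (e x) := by
      rw [h6 x hx]
      simp only [map_sub, map_mul, map_div₀, map_add, map_one, Complex.conj_ofReal,
        Complex.conj_ofNat 2]
    rw [k1, k2]
    ring
  rw [e1, e2, integral_sub (f := fun x => -(starRingEnd ℂ (e x) * deriv η x))
    (h4.deriv.integrable_mul l1).neg (hd.integrable_mul l1),
    integral_sub (h4.integrable_mul l2) (hd.integrable_mul l1), integral_neg, hp, neg_neg]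

/-- With c = 1/2 + m one has (-∂ - c/x)(∂ - c/x) = -∂² + (c² - c)/x², and c² - c = m² - 1/4. -/
theorem isFactored_test (m : ℝ) {φ : ℝ → ℂ} (h : IsTest φ) {p : L2 × L2}
    (h1 : p.1 =ᵐ[halfLine] φ) (h2 : p.2 =ᵐ[halfLine] expr ((m : ℂ) ^ 2) φ) {ψ : L2}
    (hψ : ψ =ᵐ[halfLine] fun x => deriv φ x - (1 / 2 + m) / x * φ x) : IsFactored m p ψ := by
  have ht : IsTest fun x : ℝ => deriv φ x - (1 / 2 + m) / x * φ x := by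
    have := h.deriv.add ((h.div_mul (1 / 2 + m)).smul (-1))
    convert this using 1
    ext x
    simp only [Pi.add_apply, Pi.smul_apply, smul_eq_mul]
    ring
  refine ⟨φ, deriv φ, _, h1, fun x _ => (h.differentiable x).hasDerivAt,
    h.deriv.smooth.continuous.continuousOn, ht, hψ, fun x _ => rfl, h2.trans ?_⟩
  filter_upwards [ae_restrict_mem measurableSet_Ioi] with x hx
  have hx0 : (x : ℂ) ≠ 0 := by exact_mod_cast (ne_of_gt hx : x ≠ 0)
  have d1 : HasDerivAt (fun x : ℝ => (1 / 2 + (m : ℂ)) / x) (-(1 / 2 + m) / (x : ℂ) ^ 2) x := by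
    have := ((hasDerivAt_id x).ofReal_comp.inv hx0).const_mul (1 / 2 + (m : ℂ))
    refine this.congr_deriv ?_
    simp only [id, Complex.ofReal_one]
    ring
  have d2 := (h.deriv.differentiable x).hasDerivAt.sub (d1.mul (h.differentiable x).hasDerivAt)
  have d3 := d2.deriv
  rw [show deriv (fun x : ℝ => deriv φ x - (1 / 2 + m) / x * φ x) x = _ from d3, expr]
  field_simp
  ring

theorem contDiffOn_cpow (m : ℝ) :
    ContDiffOn ℝ ∞ (fun x : ℝ => (x : ℂ) ^ (1 / 2 + (m : ℂ))) (Ioi 0) := by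
  intro x hx
  have e : (fun x : ℝ => ((x ^ (1 / 2 + m) : ℝ) : ℂ)) =ᶠ[𝓝 x]
      (fun x : ℝ => (x : ℂ) ^ (1 / 2 + (m : ℂ))) := by
    filter_upwards [Ioi_mem_nhds hx] with y hy using (cpow_eq_ofReal hy).symm
  refine ContDiffAt.contDiffWithinAt (ContDiffAt.congr_of_eventuallyEq ?_ e.symm)
  exact Complex.ofRealCLM.contDiff.contDiffAt.comp x
    (Real.contDiffAt_rpow_const_of_ne (ne_of_gt hx))

/-- The operator A = ∂ - (1/2 + m)/x annihilates x^(1/2+m), hence A(x^(1/2+m) ξ) = x^(1/2+m) ξ',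
which is supported away from 0. This ties the sign of m in the factorization to the extension H_m.
-/
theorem IsCutPair.isFactored {ξ : ℝ → ℝ} (hξ : IsCutoff ξ) {m : ℝ} (h1 : -1 < m) {q : L2 × L2}
    (hq : IsCutPair ξ ((m : ℂ) ^ 2) (fun x : ℝ => (x : ℂ) ^ (1 / 2 + (m : ℂ))) q) :
    ∃ ψ : L2, ψ =ᵐ[halfLine] (fun x : ℝ => (x : ℂ) ^ (1 / 2 + (m : ℂ)) * ((deriv ξ x : ℝ) : ℂ)) ∧
      IsFactored m q ψ := by
  have hhalf : (1 / 2 : ℂ).re = 1 / 2 := by norm_num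
  have hL : MemLp (fun x : ℝ => (x : ℂ) ^ (1 / 2 + (m : ℂ))) 2 (volume.restrict (Ioc 0 1)) :=
    memLp_cpow (by rw [Complex.add_re, hhalf, Complex.ofReal_re]; linarith)
  have hh := isHom_cpow (m : ℂ)
  obtain ⟨q', hq', hq2⟩ := exists_isCutPair hξ hh hL
  obtain rfl := hq'.eq hq
  obtain ⟨δ, R, hδ, hR, b1, b2⟩ := hξ.exists_bounds
  set η : ℝ → ℂ := (Ioi 0).indicator
    (fun x : ℝ => (x : ℂ) ^ (1 / 2 + (m : ℂ)) * ((deriv ξ x : ℝ) : ℂ)) with hη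
  have hη0 : ∀ x, 0 < x → η x = (x : ℂ) ^ (1 / 2 + (m : ℂ)) * ((deriv ξ x : ℝ) : ℂ) :=
    fun x hx => indicator_of_mem (s := Ioi 0) hx _
  have ht : IsTest η := by
    refine isTest_of_contDiffOn (half_pos hδ) (b := R + 1) ?_ fun x hx => ?_
    · refine ContDiffOn.congr ((contDiffOn_cpow m).mul (Complex.ofRealCLM.contDiff.comp
        (contDiff_infty_iff_deriv.1 hξ.smooth).2).contDiffOn) fun x hx => hη0 x hx
    · by_cases hx0 : 0 < x
      · rw [hη0 x hx0, (IsCutoff.cutImage_eq_zero b1 b2 hx0 hx).1]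
        simp
      · exact indicator_of_notMem (s := Ioi 0) hx0 _
  have hηae : η =ᵐ[halfLine]
      (fun x : ℝ => (x : ℂ) ^ (1 / 2 + (m : ℂ)) * ((deriv ξ x : ℝ) : ℂ)) := by
    filter_upwards [ae_restrict_mem measurableSet_Ioi] with x hx using hη0 x hx
  have c1 : Continuous fun x => (ξ x : ℂ) := Complex.continuous_ofReal.comp hξ.smooth.continuous
  have c2 : Continuous fun x => ((deriv ξ x : ℝ) : ℂ) := Complex.continuous_ofReal.comp
    (contDiff_infty_iff_deriv.1 hξ.smooth).2.continuous
  refine ⟨ht.memLp.toLp η, ht.memLp.coeFn_toLp.trans hηae, _, _, η, hq.ae_eq,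
    fun x hx => (hh.hasDerivAt x hx).mul (hξ.hasDerivAt x),
    (hh.continuousOn'.mul c1.continuousOn).add (hh.continuousOn.mul c2.continuousOn), ht,
    ht.memLp.coeFn_toLp, fun x hx => ?_, hq2.trans ?_⟩
  · rw [hη0 x hx]
    ring
  · filter_upwards [ae_restrict_mem measurableSet_Ioi] with x hx
    have d := ((hh.hasDerivAt x hx).mul (hξ.hasDerivAt_deriv x)).congr_of_eventuallyEq
      (f₁ := η) (by filter_upwards [Ioi_mem_nhds hx] with y hy using hη0 y hy)
    rw [d.deriv, hη0 x hx, cutImage]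
    ring

/-- A closed property of the pairs `(φ, L φ) + c q`, `φ` a test function, holds on `H_m`. -/
theorem forall_mem_graph_H {ξ : ℝ → ℝ} {m : ℂ} {q : L2 × L2}
    (hq : IsCutPair ξ (m ^ 2) (fun x : ℝ => (x : ℂ) ^ (1 / 2 + m)) q) {P : L2 × L2 → Prop}
    (hc : IsClosed {r | P r}) (h : ∀ p ∈ testGraph (m ^ 2), ∀ c : ℂ, P (p + c • q)) :
    ∀ r ∈ (H ξ m).graph, P r := by
  intro r hr
  obtain ⟨c, hr⟩ := (mem_graph_H_iff_exists hq).1 hr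
  rw [graph_LMin] at hr
  have hcl : IsClosed {l : L2 × L2 | P (l + c • q)} :=
    hc.preimage (f := fun l => l + c • q) (by fun_prop)
  have : P (r - c • q + c • q) := closure_minimal (fun p hp => h p hp c) hcl hr
  rwa [sub_add_cancel] at this

theorem exists_isFactored {m : ℝ} {p : L2 × L2} (hp : p ∈ testGraph ((m : ℂ) ^ 2)) :
    ∃ ψ, IsFactored m p ψ := by
  obtain ⟨φ, hφ, h1, h2⟩ := hp
  have ht : MemLp (fun x : ℝ => deriv φ x - (1 / 2 + m) / x * φ x) 2 halfLine :=
    hφ.deriv.memLp.sub (hφ.div_mul (1 / 2 + m)).memLp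
  exact ⟨ht.toLp _, isFactored_test m hφ h1 h2 ht.coeFn_toLp⟩

/-- On the core spanned by test functions and the cut-off solution the form is ‖A f‖²; the
inequality passes to graph limits. -/
theorem isNonnegOp_H {ξ : ℝ → ℝ} (hξ : IsCutoff ξ) {m : ℝ} (h1 : -1 < m) (h2 : m < 1) :
    IsNonnegOp (H ξ (m : ℂ)) := by
  have hhalf : (1 / 2 : ℂ).re = 1 / 2 := by norm_num
  have hL : MemLp (fun x : ℝ => (x : ℂ) ^ (1 / 2 + (m : ℂ))) 2 (volume.restrict (Ioc 0 1)) :=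
    memLp_cpow (by rw [Complex.add_re, hhalf, Complex.ofReal_re]; linarith)
  obtain ⟨q, hq, -⟩ := exists_isCutPair hξ (isHom_cpow (m : ℂ)) hL
  obtain ⟨ψ, -, hψ⟩ := hq.isFactored hξ h1
  refine ⟨isHermitianOp_of_isSelfAdjoint (isSelfAdjoint_H hξ h1 h2), fun u => ?_⟩
  refine forall_mem_graph_H hq (P := fun r => 0 ≤ RCLike.re ⟪r.1, r.2⟫_ℂ)
    (isClosed_le continuous_const (by fun_prop)) (fun p hp c => ?_) _ ((H ξ (m : ℂ)).mem_graph u)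
  obtain ⟨ψ', hψ'⟩ := exists_isFactored hp
  rw [(hψ'.add (hψ.smul c)).inner_eq]
  exact inner_self_nonneg

theorem IsNonnegOp.of_le {E : Type*} [NormedAddCommGroup E] [InnerProductSpace ℂ E]
    {T S : E →ₗ.[ℂ] E} (hS : IsNonnegOp S) (hle : T ≤ S) (hT : Dense (T.domain : Set E)) :
    IsNonnegOp T := by
  refine ⟨⟨hT, fun u v => ?_⟩, fun u => ?_⟩
  · obtain ⟨u', hu1, hu2⟩ := LinearPMap.exists_of_le hle u
    obtain ⟨v', hv1, hv2⟩ := LinearPMap.exists_of_le hle v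
    rw [hu1, hu2, hv1, hv2]
    exact hS.1.2 u' v'
  · obtain ⟨u', hu1, hu2⟩ := LinearPMap.exists_of_le hle u
    have := hS.2 u'
    rwa [quadForm, ← hu1, ← hu2] at this

/-! ### The Krein extension -/

/-- Hahn–Banach followed by Riesz. The functional is given by its graph because it lives on the
range of A, where well-definedness is itself a consequence of the bound. -/
theorem exists_inner_eq_of_bound {E : Type*} [NormedAddCommGroup E] [InnerProductSpace ℂ E]
    [CompleteSpace E] (Γ : Submodule ℂ (E × ℂ)) {s : ℝ} (hs : 0 ≤ s)
    (h : ∀ p ∈ Γ, ‖p.2‖ ^ 2 ≤ s * ‖p.1‖ ^ 2) :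
    ∃ w : E, ‖w‖ ^ 2 ≤ s ∧ ∀ p ∈ Γ, p.2 = ⟪w, p.1⟫_ℂ := by
  have hg : Γ.toLinearPMap.graph = Γ := Submodule.toLinearPMap_graph_eq _ fun p hp hp0 => by
    have := h p hp
    rw [hp0, norm_zero] at this
    have h2 : ‖p.2‖ ^ 2 = 0 := le_antisymm (by simpa using this) (sq_nonneg _)
    simpa using h2
  set T := Γ.toLinearPMap with hT
  have hb : ∀ u : T.domain, ‖T.toFun u‖ ≤ √s * ‖u‖ := fun u => by
    have h1 := T.mem_graph u
    rw [hg] at h1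
    refine abs_le_of_sq_le_sq' ?_ (by positivity) |>.2
    rw [mul_pow, Real.sq_sqrt hs]
    exact h _ h1
  obtain ⟨g, hge, hgn⟩ := exists_extension_norm_eq T.domain (T.toFun.mkContinuous (√s) hb)
  refine ⟨(InnerProductSpace.toDual ℂ E).symm g, ?_, fun p hp => ?_⟩
  · rw [LinearIsometryEquiv.norm_map, hgn]
    have := LinearMap.mkContinuous_norm_le T.toFun (Real.sqrt_nonneg s) hb
    calc _ ≤ √s ^ 2 := pow_le_pow_left₀ (norm_nonneg _) this 2
      _ = s := Real.sq_sqrt hs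
  · rw [InnerProductSpace.toDual_symm_apply]
    rw [← hg, LinearPMap.mem_graph_iff] at hp
    obtain ⟨u, hu1, hu2⟩ := hp
    rw [← hu1, ← hu2, hge u]
    rfl

theorem norm_sq_eq_integral (g : L2) : ‖g‖ ^ 2 = ∫ x in Ioi (0 : ℝ), ‖g x‖ ^ 2 := by
  have h : ∫ x in Ioi (0 : ℝ), starRingEnd ℂ (g x) * g x =
      ((∫ x in Ioi (0 : ℝ), ‖g x‖ ^ 2 : ℝ) : ℂ) := by
    rw [← integral_complex_ofReal]
    simp only [Complex.conj_mul', Complex.ofReal_pow]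
  rw [norm_sq_eq_re_inner (𝕜 := ℂ), inner_eq_integral, h]
  exact Complex.ofReal_re _

theorem norm_dilation (τ : ℝ) (f : L2) : ‖dilation τ f‖ = ‖f‖ := by
  have h1 : ‖dilation τ f‖ ^ 2 = ‖f‖ ^ 2 := by
    rw [norm_sq_eq_integral, norm_sq_eq_integral]
    have e1 : ∫ x in Ioi (0 : ℝ), ‖dilation τ f x‖ ^ 2 =
        ∫ x in Ioi (0 : ℝ), Real.exp τ * ‖f (Real.exp τ * x)‖ ^ 2 := by
      refine integral_congr_ae ?_
      filter_upwards [(memLp_dilation τ f).coeFn_toLp] with x hx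
      have : dilation τ f x = (Real.exp (τ / 2) : ℂ) * f (Real.exp τ * x) := hx
      rw [this, norm_mul, mul_pow, Complex.norm_real, Real.norm_of_nonneg (Real.exp_pos _).le,
        ← Real.exp_nat_mul]
      congr 2
      push_cast
      ring
    have e2 := integral_comp_mul_left_Ioi (fun x => ‖f x‖ ^ 2) 0 (Real.exp_pos τ)
    rw [mul_zero] at e2
    rw [e1, integral_const_mul, e2, smul_eq_mul, mul_inv_cancel_left₀ (Real.exp_pos τ).ne']
  exact (pow_left_inj₀ (norm_nonneg _) (norm_nonneg _) two_ne_zero).1 h1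

/-- Dilations of a test function converge weakly to zero. -/
theorem tendsto_inner_dilation (w : L2) {ψ : L2} {η : ℝ → ℂ} (hη : IsTest η)
    (hψ : ψ =ᵐ[halfLine] η) :
    Tendsto (fun n : ℕ => ⟪w, dilation (-(n : ℝ)) ψ⟫_ℂ) atTop (𝓝 0) := by
  rw [Metric.tendsto_atTop]
  intro ε hε
  -- `w` is replaced by a test function. The dilates of `η` move off to infinity and eventually miss
  -- its support, while their norms stay constant.
  obtain ⟨φ', hφ', hd⟩ := Metric.dense_iff.1 (dense_domain_LTest 0) w (ε / (‖ψ‖ + 1)) (by positivity)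
  have hφ'2 : φ' ∈ (LTest 0).domain := hd
  have hm := (LTest 0).mem_graph ⟨φ', hφ'2⟩
  rw [graph_LTest] at hm
  obtain ⟨φ, hφ, h1, -⟩ := hm
  have h1 : φ' =ᵐ[halfLine] φ := h1
  obtain ⟨a, b, ha, hab, hs⟩ := hη.exists_Ioo
  obtain ⟨a', b', ha', hab', hs'⟩ := hφ.exists_Ioo
  obtain ⟨N, hN⟩ := (tendsto_atTop_atTop.1 Real.tendsto_exp_atTop (b' / a))
  obtain ⟨N', hN'⟩ := exists_nat_ge N
  refine ⟨N', fun n hn => ?_⟩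
  have hexp : b' / a ≤ Real.exp n := hN n (hN'.trans (by exact_mod_cast hn))
  have hzero : ⟪φ', dilation (-(n : ℝ)) ψ⟫_ℂ = 0 := by
    rw [inner_eq_integral]
    refine integral_eq_zero_of_ae ?_
    filter_upwards [h1, (memLp_dilation (-(n : ℝ)) ψ).coeFn_toLp, (quasi_dilation (-(n : ℝ))).ae hψ]
      with x k1 k2 k3
    have k2' : dilation (-(n : ℝ)) ψ x =
      (Real.exp (-(n : ℝ) / 2) : ℂ) * ψ (Real.exp (-(n : ℝ)) * x) := k2
    rw [k1, k2', k3, Pi.zero_apply]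
    by_cases hx : x ∈ Ioo a' b'
    · have hx' : Real.exp (-(n : ℝ)) * x ∉ Ioo a b := by
        rintro ⟨hx1, -⟩
        have e1 : Real.exp n * Real.exp (-(n : ℝ)) = 1 := by rw [← Real.exp_add]; simp
        have e2 : b' ≤ Real.exp n * a := (div_le_iff₀ ha).1 hexp
        have e3 : Real.exp n * a < Real.exp n * (Real.exp (-(n : ℝ)) * x) :=
          mul_lt_mul_of_pos_left hx1 (Real.exp_pos _)
        rw [← mul_assoc, e1, one_mul] at e3
        linarith [hx.2]
      rw [image_eq_zero_of_notMem_tsupport fun h' => hx' (hs h'), mul_zero, mul_zero]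
    · rw [image_eq_zero_of_notMem_tsupport fun h' => hx (hs' h'), map_zero, zero_mul]
  rw [dist_zero_right]
  have e : ⟪w, dilation (-(n : ℝ)) ψ⟫_ℂ = ⟪w - φ', dilation (-(n : ℝ)) ψ⟫_ℂ := by
    rw [inner_sub_left, hzero, sub_zero]
  rw [e]
  refine (norm_inner_le_norm _ _).trans_lt ?_
  rw [norm_dilation]
  have h3 : ‖w - φ'‖ < ε / (‖ψ‖ + 1) := by
    rw [← dist_eq_norm, dist_comm]
    exact hφ'
  calc ‖w - φ'‖ * ‖ψ‖ ≤ ‖w - φ'‖ * (‖ψ‖ + 1) := by gcongr; linarith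
    _ < ε / (‖ψ‖ + 1) * (‖ψ‖ + 1) := by gcongr
    _ = ε := by field_simp

/-! ### A and A* in the variable χ, where ψ = x^(1/2+m) χ. -/

section Raising

variable {m : ℝ}

theorem IsTest.cpow_mul {χ : ℝ → ℂ} (hχ : IsTest χ) (m : ℝ) :
    IsTest fun x : ℝ => (x : ℂ) ^ (1 / 2 + (m : ℂ)) * χ x := by
  obtain ⟨a, b, ha, hab, hs⟩ := hχ.exists_Ioo
  refine isTest_of_contDiffOn ha (b := b) ((contDiffOn_cpow m).mul hχ.smooth.contDiffOn)
    fun x hx => ?_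
  rw [image_eq_zero_of_notMem_tsupport fun h' => hx ⟨(hs h').1.le, (hs h').2.le⟩, mul_zero]

/-- The function `-ψ' - (1/2 + m) x⁻¹ ψ` for `ψ = x^(1/2+m) χ`. -/
def raise (m : ℝ) (χ : ℝ → ℂ) (x : ℝ) : ℂ :=
  -((x : ℂ) ^ (1 / 2 + (m : ℂ)) * deriv χ x) -
    2 * ((1 / 2 + m) / x * ((x : ℂ) ^ (1 / 2 + (m : ℂ)) * χ x))

theorem IsTest.raise {χ : ℝ → ℂ} (hχ : IsTest χ) (m : ℝ) : IsTest (raise m χ) := by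
  have := ((hχ.deriv.cpow_mul m).smul (-1)).add (((hχ.cpow_mul m).div_mul (1 / 2 + m)).smul (-2))
  convert this using 1
  ext x
  simp only [InverseSquare.raise, Pi.add_apply, Pi.smul_apply, smul_eq_mul]
  ring

theorem deriv_cpow_mul {χ : ℝ → ℂ} (hχ : IsTest χ) (m : ℝ) {x : ℝ} (hx : 0 < x) :
    deriv (fun x : ℝ => (x : ℂ) ^ (1 / 2 + (m : ℂ)) * χ x) x =
      (1 / 2 + m) / x * (x : ℂ) ^ (1 / 2 + (m : ℂ)) * χ x +
        (x : ℂ) ^ (1 / 2 + (m : ℂ)) * deriv χ x :=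
  ((hasDerivAt_cpow hx _).mul (hχ.differentiable x).hasDerivAt).deriv

theorem expr_cpow_mul {χ : ℝ → ℂ} (hχ : IsTest χ) (m : ℝ) {x : ℝ} (hx : 0 < x) :
    expr ((m : ℂ) ^ 2) (fun x : ℝ => (x : ℂ) ^ (1 / 2 + (m : ℂ)) * χ x) x =
      raise m (deriv χ) x := by
  have hh := isHom_cpow (m : ℂ)
  have e : deriv (fun x : ℝ => (x : ℂ) ^ (1 / 2 + (m : ℂ)) * χ x) =ᶠ[𝓝 x] fun x : ℝ =>
      (1 / 2 + m) / x * (x : ℂ) ^ (1 / 2 + (m : ℂ)) * χ x +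
        (x : ℂ) ^ (1 / 2 + (m : ℂ)) * deriv χ x := by
    filter_upwards [Ioi_mem_nhds hx] with y hy using deriv_cpow_mul hχ m hy
  have d := ((hh.hasDerivAt' x hx).mul (hχ.differentiable x).hasDerivAt).add
    ((hh.hasDerivAt x hx).mul (hχ.deriv.differentiable x).hasDerivAt)
  rw [expr, e.deriv_eq]
  rw [show deriv (fun x : ℝ => (1 / 2 + m) / x * (x : ℂ) ^ (1 / 2 + (m : ℂ)) * χ x +
        (x : ℂ) ^ (1 / 2 + (m : ℂ)) * deriv χ x) x = _ from d.deriv, raise, pot]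
  ring

/-- In this variable A is plain differentiation: A(x^(1/2+m) χ) = x^(1/2+m) χ'. So A reaches those
x^(1/2+m) χ with ∫ χ = 0, a subspace of codimension one. -/
theorem exists_isFactored_cpow {χ : ℝ → ℂ} (hχ : IsTest χ) (m : ℝ) {ψ g : L2}
    (hψ : ψ =ᵐ[halfLine] fun x : ℝ => (x : ℂ) ^ (1 / 2 + (m : ℂ)) * deriv χ x)
    (hg : g =ᵐ[halfLine] raise m (deriv χ)) :
    ∃ p ∈ testGraph ((m : ℂ) ^ 2), IsFactored m p ψ ∧ p.2 = g ∧
      p.1 =ᵐ[halfLine] fun x : ℝ => (x : ℂ) ^ (1 / 2 + (m : ℂ)) * χ x := by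
  have ht := hχ.cpow_mul m
  have h2 : g =ᵐ[halfLine] expr ((m : ℂ) ^ 2) fun x : ℝ => (x : ℂ) ^ (1 / 2 + (m : ℂ)) * χ x := by
    filter_upwards [hg, ae_restrict_mem measurableSet_Ioi] with x h1 hx
    rw [h1, expr_cpow_mul hχ m hx]
  refine ⟨(ht.memLp.toLp _, g), ⟨_, ht, ht.memLp.coeFn_toLp, h2⟩,
    isFactored_test m ht ht.memLp.coeFn_toLp h2 ?_, rfl, ht.memLp.coeFn_toLp⟩
  filter_upwards [hψ, ae_restrict_mem measurableSet_Ioi] with x h1 hx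
  rw [h1, deriv_cpow_mul hχ m hx]
  ring

/-- The normalization turns a dilation of ψ into χ ↦ e^τ χ(e^τ ·), which preserves ∫ χ, the quantity
obstructing membership in the range of A. -/
theorem dilation_cpow_mul {χ : ℝ → ℂ} (m τ : ℝ) {ψ : L2}
    (hψ : ψ =ᵐ[halfLine] fun x : ℝ => (x : ℂ) ^ (1 / 2 + (m : ℂ)) * χ x) :
    (Complex.exp (-(τ * m)) • dilation τ ψ : L2) =ᵐ[halfLine]
      fun x : ℝ => (x : ℂ) ^ (1 / 2 + (m : ℂ)) * ((Real.exp τ : ℂ) * χ (Real.exp τ * x)) := by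
  filter_upwards [Lp.coeFn_smul (Complex.exp (-(τ * m))) (dilation τ ψ),
    (memLp_dilation τ ψ).coeFn_toLp, (quasi_dilation τ).ae hψ, ae_restrict_mem measurableSet_Ioi]
    with x k1 k2 k3 hx
  have k2' : dilation τ ψ x = (Real.exp (τ / 2) : ℂ) * ψ (Real.exp τ * x) := k2
  rw [k1, Pi.smul_apply, k2', k3, exp_mul_cpow τ hx, smul_eq_mul]
  have e : Complex.exp (-(τ * m)) * ((Real.exp (τ / 2) : ℂ) * Complex.exp (τ * (1 / 2 + m))) =
      (Real.exp τ : ℂ) := by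
    push_cast
    rw [← Complex.exp_add, ← Complex.exp_add]
    ring_nf
  rw [← e]
  ring

theorem dilation_raise {χ : ℝ → ℂ} (hχ : IsTest χ) (m τ : ℝ) {g : L2}
    (hg : g =ᵐ[halfLine] raise m χ) :
    (Complex.exp (τ - τ * m) • dilation τ g : L2) =ᵐ[halfLine]
      raise m fun x : ℝ => (Real.exp τ : ℂ) * χ (Real.exp τ * x) := by
  filter_upwards [Lp.coeFn_smul (Complex.exp (τ - τ * m)) (dilation τ g),
    (memLp_dilation τ g).coeFn_toLp, (quasi_dilation τ).ae hg, ae_restrict_mem measurableSet_Ioi]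
    with x k1 k2 k3 hx
  have k2' : dilation τ g x = (Real.exp (τ / 2) : ℂ) * g (Real.exp τ * x) := k2
  have d2 : HasDerivAt (fun x => Real.exp τ * x) (Real.exp τ) x := by
    simpa using (hasDerivAt_id x).const_mul (Real.exp τ)
  have d := ((hχ.differentiable _).hasDerivAt.scomp x d2).const_mul (Real.exp τ : ℂ)
  rw [k1, Pi.smul_apply, k2', k3, raise, raise,
    show deriv (fun x : ℝ => (Real.exp τ : ℂ) * χ (Real.exp τ * x)) x = _ from d.deriv,
    exp_mul_cpow τ hx, smul_eq_mul, Complex.real_smul]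
  have hx0 : (x : ℂ) ≠ 0 := by exact_mod_cast (ne_of_gt hx : x ≠ 0)
  have he : ((Real.exp τ : ℝ) : ℂ) ≠ 0 := by exact_mod_cast (Real.exp_pos τ).ne'
  have e : Complex.exp (τ - τ * m) * ((Real.exp (τ / 2) : ℂ) * Complex.exp (τ * (1 / 2 + m))) =
      (Real.exp τ : ℂ) * (Real.exp τ : ℂ) := by
    push_cast
    rw [← Complex.exp_add, ← Complex.exp_add, ← Complex.exp_add]
    ring_nf
  have e' : ∀ u v c d : ℂ, Complex.exp (τ - τ * m) * ((Real.exp (τ / 2) : ℂ) *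
      (-(Complex.exp (τ * (1 / 2 + m)) * u * c) -
        2 * (v * (Complex.exp (τ * (1 / 2 + m)) * u * d)))) =
      (Complex.exp (τ - τ * m) * ((Real.exp (τ / 2) : ℂ) * Complex.exp (τ * (1 / 2 + m)))) *
        (-(u * c) - 2 * (v * (u * d))) := fun u v c d => by ring
  rw [e', e]
  push_cast
  field_simp

end Raising

/-! ### Minimality of the form of H_m for m ≤ 0. -/

section Krein

variable {m : ℝ}

theorem integral_conj_mul_eq_inner (w : L2) {u : ℝ → ℂ} {ψ : L2} (h : ψ =ᵐ[halfLine] u) :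
    ∫ x in Ioi (0 : ℝ), starRingEnd ℂ (w x) * u x = ⟪w, ψ⟫_ℂ := by
  rw [inner_eq_integral]
  exact integral_congr_ae (h.mono fun x hx => by simp only [hx])

/-- The graph of the functional `ψ ↦ ⟪f, g⟫` on the pairs `(ψ, g)` coming from test functions. -/
def functionalGraph (m : ℝ) (f : L2) : Submodule ℂ (L2 × ℂ) where
  carrier := {v | ∃ p ∈ testGraph ((m : ℂ) ^ 2), IsFactored m p v.1 ∧ v.2 = ⟪f, p.2⟫_ℂ}
  zero_mem' := by
    obtain ⟨ψ, hψ⟩ := exists_isFactored (m := m) (Submodule.zero_mem _)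
    refine ⟨0, Submodule.zero_mem _, ?_, by simp⟩
    have := hψ.smul 0
    rwa [zero_smul, zero_smul] at this
  add_mem' := by
    rintro u v ⟨p, hp, h1, h2⟩ ⟨p', hp', h1', h2'⟩
    refine ⟨p + p', Submodule.add_mem _ hp hp', h1.add h1', ?_⟩
    rw [Prod.snd_add, Prod.snd_add, inner_add_right, h2, h2']
  smul_mem' := by
    rintro c v ⟨p, hp, h1, h2⟩
    refine ⟨c • p, Submodule.smul_mem _ c hp, h1.smul c, ?_⟩
    rw [Prod.smul_snd, Prod.smul_snd, inner_smul_right, h2, smul_eq_mul]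

/-- For `m ≤ 0` the identity `⟪f, A* ψ⟫ = ⟪w, ψ⟫` extends from `ψ = A φ`, with `φ` a test function,
to all test functions `ψ`. -/
theorem inner_raise_eq (hm : m ≤ 0) {f w : L2}
    (hw : ∀ p ∈ testGraph ((m : ℂ) ^ 2), ∀ ψ, IsFactored m p ψ → ⟪f, p.2⟫_ℂ = ⟪w, ψ⟫_ℂ)
    {χ : ℝ → ℂ} (hχ : IsTest χ) {ψ g : L2}
    (hψ : ψ =ᵐ[halfLine] fun x : ℝ => (x : ℂ) ^ (1 / 2 + (m : ℂ)) * χ x)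
    (hg : g =ᵐ[halfLine] raise m χ) : ⟪f, g⟫_ℂ = ⟪w, ψ⟫_ℂ := by
  -- `L` measures the failure of the identity. It vanishes on derivatives, which correspond to the
  -- range of A, and is therefore c ∫ χ.
  set L : (ℝ → ℂ) → ℂ := fun χ =>
    (∫ x in Ioi (0 : ℝ), starRingEnd ℂ (w x) * ((x : ℂ) ^ (1 / 2 + (m : ℂ)) * χ x)) -
      ∫ x in Ioi (0 : ℝ), starRingEnd ℂ (f x) * raise m χ x with hL
  have hLeq : ∀ {χ : ℝ → ℂ} {ψ g : L2},
      (ψ =ᵐ[halfLine] fun x : ℝ => (x : ℂ) ^ (1 / 2 + (m : ℂ)) * χ x) →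
      (g =ᵐ[halfLine] raise m χ) → L χ = ⟪w, ψ⟫_ℂ - ⟪f, g⟫_ℂ := fun h1 h2 => by
    rw [hL]
    simp only
    rw [integral_conj_mul_eq_inner w h1, integral_conj_mul_eq_inner f h2]
  have hLt : ∀ {χ : ℝ → ℂ} (h : IsTest χ), L χ = ⟪w, (h.cpow_mul m).memLp.toLp _⟫_ℂ -
      ⟪f, (h.raise m).memLp.toLp _⟫_ℂ := fun h =>
    hLeq (h.cpow_mul m).memLp.coeFn_toLp (h.raise m).memLp.coeFn_toLp
  obtain ⟨c, hc⟩ := exists_eq_mul_integral L (fun φ θ hφ hθ c => by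
      have e1 : ((hφ.cpow_mul m).memLp.toLp _ + c • (hθ.cpow_mul m).memLp.toLp _ : L2) =ᵐ[halfLine]
          fun x : ℝ => (x : ℂ) ^ (1 / 2 + (m : ℂ)) * (φ + c • θ) x := by
        filter_upwards [Lp.coeFn_add ((hφ.cpow_mul m).memLp.toLp _)
          (c • (hθ.cpow_mul m).memLp.toLp _), Lp.coeFn_smul c ((hθ.cpow_mul m).memLp.toLp _),
          (hφ.cpow_mul m).memLp.coeFn_toLp, (hθ.cpow_mul m).memLp.coeFn_toLp] with x k1 k2 k3 k4
        rw [k1, Pi.add_apply, k2, Pi.smul_apply, k3, k4, Pi.add_apply, Pi.smul_apply, smul_eq_mul,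
          smul_eq_mul]
        ring
      have e2 : ((hφ.raise m).memLp.toLp _ + c • (hθ.raise m).memLp.toLp _ : L2) =ᵐ[halfLine]
          raise m (φ + c • θ) := by
        filter_upwards [Lp.coeFn_add ((hφ.raise m).memLp.toLp _)
          (c • (hθ.raise m).memLp.toLp _), Lp.coeFn_smul c ((hθ.raise m).memLp.toLp _),
          (hφ.raise m).memLp.coeFn_toLp, (hθ.raise m).memLp.coeFn_toLp] with x k1 k2 k3 k4
        have d : deriv (φ + c • θ) x = deriv φ x + c * deriv θ x :=
          ((hφ.differentiable x).hasDerivAt.add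
            ((hθ.differentiable x).hasDerivAt.const_smul c)).deriv
        rw [k1, Pi.add_apply, k2, Pi.smul_apply, k3, k4, raise, raise, raise, d, Pi.add_apply,
          Pi.smul_apply, smul_eq_mul, smul_eq_mul]
        ring
      rw [hLeq e1 e2, hLt hφ, hLt hθ, inner_add_right, inner_add_right, inner_smul_right,
        inner_smul_right]
      ring)
    (fun φ hφ => by
      obtain ⟨p, hp, h1, h2, -⟩ := exists_isFactored_cpow hφ m (hφ.deriv.cpow_mul m).memLp.coeFn_toLp
        (hφ.deriv.raise m).memLp.coeFn_toLp
      rw [hLt hφ.deriv, ← h2, hw p hp _ h1, sub_self])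
  -- Dilating by τ = -n keeps ∫ χ₀ = 1, so c is constant along the sequence, while both inner
  -- products tend to 0 by weak convergence.
  have hc0 : c = 0 := by
    obtain ⟨χ₀, hχ₀, hI⟩ := exists_isTest_integral_eq_one
    set Ψ : L2 := (hχ₀.cpow_mul m).memLp.toLp _ with hΨ
    set G : L2 := (hχ₀.raise m).memLp.toLp _ with hG
    have hΨe := (hχ₀.cpow_mul m).memLp.coeFn_toLp
    have hGe := (hχ₀.raise m).memLp.coeFn_toLp
    have t := (tendsto_inner_dilation w (hχ₀.cpow_mul m) hΨe).norm.add
      (tendsto_inner_dilation f (hχ₀.raise m) hGe).norm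
    rw [norm_zero, add_zero] at t
    have hle : ∀ n : ℕ, ‖c‖ ≤ ‖⟪w, dilation (-(n : ℝ)) Ψ⟫_ℂ‖ + ‖⟪f, dilation (-(n : ℝ)) G⟫_ℂ‖ := by
      intro n
      set τ : ℝ := -(n : ℝ) with hτ
      have hτ0 : τ ≤ 0 := by simp [hτ]
      have ht : IsTest fun x : ℝ => (Real.exp τ : ℂ) * χ₀ (Real.exp τ * x) := by
        obtain ⟨a, b, ha, hab, hs⟩ := hχ₀.exists_Ioo
        have he := Real.exp_pos τ
        refine isTest_of_contDiffOn (a := a / Real.exp τ) (b := b / Real.exp τ) (by positivity)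
          (contDiff_const.mul (hχ₀.smooth.comp (contDiff_const.mul contDiff_id))).contDiffOn
          fun x hx => ?_
        rw [image_eq_zero_of_notMem_tsupport (f := χ₀) fun h' => hx ⟨?_, ?_⟩, mul_zero]
        · rw [div_le_iff₀' he]; exact (hs h').1.le
        · rw [le_div_iff₀' he]; exact (hs h').2.le
      have hI' : ∫ x in Ioi (0 : ℝ), (Real.exp τ : ℂ) * χ₀ (Real.exp τ * x) = 1 := by
        have e2 := integral_comp_mul_left_Ioi χ₀ 0 (Real.exp_pos τ)
        rw [mul_zero] at e2
        rw [integral_const_mul, e2, hI, Complex.real_smul, mul_one, Complex.ofReal_inv,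
          mul_inv_cancel₀ (by exact_mod_cast (Real.exp_pos τ).ne')]
      have e1 := hc _ ht
      rw [hI', mul_one, hLeq (dilation_cpow_mul m τ hΨe) (dilation_raise hχ₀ m τ hGe),
        inner_smul_right, inner_smul_right] at e1
      -- The sign of m enters here: with τ ≤ 0 and m ≤ 0 both normalizing factors stay bounded.
      have n1 : ‖Complex.exp (-(τ * m))‖ ≤ 1 := by
        rw [Complex.norm_exp, Real.exp_le_one_iff]
        have : (-((τ : ℂ) * m)).re = -(τ * m) := by simp
        rw [this]
        nlinarith
      have n2 : ‖Complex.exp (τ - τ * m)‖ ≤ 1 := by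
        rw [Complex.norm_exp, Real.exp_le_one_iff]
        have : ((τ : ℂ) - τ * m).re = τ - τ * m := by simp
        rw [this]
        nlinarith
      rw [← e1]
      refine (norm_sub_le _ _).trans (add_le_add ?_ ?_)
      · rw [norm_mul]; exact mul_le_of_le_one_left (norm_nonneg _) n1
      · rw [norm_mul]; exact mul_le_of_le_one_left (norm_nonneg _) n2
    have := ge_of_tendsto' t hle
    exact norm_le_zero_iff.1 this
  have h1 := hc χ hχ
  rw [hc0, zero_mul, hLeq hψ hg, sub_eq_zero] at h1
  exact h1.symm

/-- The extended identity now applies to the cut-off solution, whose image under A lies outside the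
range of A on test functions when its boundary value is nontrivial. -/
theorem inner_eq_of_isFactored (hm : m ≤ 0) {f w : L2}
    (hw : ∀ p ∈ testGraph ((m : ℂ) ^ 2), ∀ ψ, IsFactored m p ψ → ⟪f, p.2⟫_ℂ = ⟪w, ψ⟫_ℂ)
    {r : L2 × L2} {ψ : L2} (h : IsFactored m r ψ) : ⟪f, r.2⟫_ℂ = ⟪w, ψ⟫_ℂ := by
  obtain ⟨-, -, η, -, -, -, hη, h5, -, h7⟩ := h
  -- The exponent equals -(1/2 + m), so this is χ = x^(-1/2-m) η.
  have ht : IsTest fun x : ℝ => (x : ℂ) ^ (1 / 2 + ((-1 - m : ℝ) : ℂ)) * η x := hη.cpow_mul _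
  have hx : ∀ x : ℝ, 0 < x → η x = (x : ℂ) ^ (1 / 2 + (m : ℂ)) *
      ((x : ℂ) ^ (1 / 2 + ((-1 - m : ℝ) : ℂ)) * η x) := by
    intro x hx
    have hx0 : (x : ℂ) ≠ 0 := by exact_mod_cast hx.ne'
    rw [← mul_assoc, ← Complex.cpow_add _ _ hx0]
    have : (1 / 2 + (m : ℂ)) + (1 / 2 + ((-1 - m : ℝ) : ℂ)) = 0 := by push_cast; ring
    rw [this, Complex.cpow_zero, one_mul]
  refine inner_raise_eq hm hw ht (h5.trans ?_) (h7.trans ?_)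
  · filter_upwards [ae_restrict_mem measurableSet_Ioi] with x h0 using hx x h0
  · filter_upwards [ae_restrict_mem measurableSet_Ioi] with x h0
    have e : η =ᶠ[𝓝 x] fun x : ℝ => (x : ℂ) ^ (1 / 2 + (m : ℂ)) *
        ((x : ℂ) ^ (1 / 2 + ((-1 - m : ℝ) : ℂ)) * η x) := by
      filter_upwards [Ioi_mem_nhds h0] with y hy using hx y hy
    have hd := (deriv_cpow_mul ht m h0)
    rw [e.deriv_eq, hd, raise]
    linear_combination (-((1 / 2 + m) / x)) * hx x h0

/-- A form value s of S at f gives |⟪f, Lφ⟫|² ≤ s ‖Aφ‖² on test functions. Riesz turns this into ⟪f,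
A*ψ⟫ = ⟪w, ψ⟫ with ‖w‖² ≤ s; after extension to all factored pairs, Cauchy–Schwarz yields the same
bound on the core of H_m, and duality gives the form limit. -/
theorem formLE_H {ξ : ℝ → ℝ} (hξ : IsCutoff ξ) (h1 : -1 < m) (hm : m ≤ 0) {S : L2 →ₗ.[ℂ] L2}
    (hS : IsNonnegOp S) (hle : LMin ((m : ℂ) ^ 2) ≤ S) : FormLE (H ξ (m : ℂ)) S := by
  intro f s hf
  have hhalf : (1 / 2 : ℂ).re = 1 / 2 := by norm_num
  have hL : MemLp (fun x : ℝ => (x : ℂ) ^ (1 / 2 + (m : ℂ))) 2 (volume.restrict (Ioc 0 1)) :=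
    memLp_cpow (by rw [Complex.add_re, hhalf, Complex.ofReal_re]; linarith)
  obtain ⟨q, hq, -⟩ := exists_isCutPair hξ (isHom_cpow (m : ℂ)) hL
  obtain ⟨ψ, -, hψ⟩ := hq.isFactored hξ h1
  have hs0 := (hf.norm_inner_sq_le hS hle 0).1
  have hnorm : ∀ {r : L2 × L2} {ψ : L2}, IsFactored m r ψ → RCLike.re ⟪r.1, r.2⟫_ℂ = ‖ψ‖ ^ 2 :=
    fun h => by rw [h.inner_eq, norm_sq_eq_re_inner (𝕜 := ℂ)]
  obtain ⟨w, hws, hw⟩ := exists_inner_eq_of_bound (functionalGraph m f) hs0 (by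
    rintro v ⟨p, hp, hv1, hv2⟩
    have hpm : p ∈ (LMin ((m : ℂ) ^ 2)).graph := by
      rw [graph_LMin]
      exact Submodule.le_topologicalClosure _ hp
    obtain ⟨u, hu1, hu2⟩ := (LinearPMap.mem_graph_iff _).1 hpm
    have := (hf.norm_inner_sq_le hS hle u).2
    rw [quadForm, hu1, hu2, hnorm hv1] at this
    rwa [hv2])
  have hw' : ∀ p ∈ testGraph ((m : ℂ) ^ 2), ∀ ψ, IsFactored m p ψ → ⟪f, p.2⟫_ℂ = ⟪w, ψ⟫_ℂ :=
    fun p hp ψ hψ => hw (ψ, ⟪f, p.2⟫_ℂ) ⟨p, hp, hψ, rfl⟩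
  refine exists_isFormLimit_of_norm_inner_le (isSelfAdjoint_H hξ h1 (by linarith))
    (isNonnegOp_H hξ h1 (by linarith)) (fun u => ?_) hs0
  refine forall_mem_graph_H hq (P := fun r => ‖⟪f, r.2⟫_ℂ‖ ^ 2 ≤ s * RCLike.re ⟪r.1, r.2⟫_ℂ)
    (isClosed_le (by fun_prop) (by fun_prop)) (fun p hp c => ?_) _ ((H ξ (m : ℂ)).mem_graph u)
  obtain ⟨ψ', hψ'⟩ := exists_isFactored hp
  have hfac := hψ'.add (hψ.smul c)
  rw [hnorm hfac, inner_eq_of_isFactored hm hw' hfac]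
  calc ‖⟪w, ψ' + c • ψ⟫_ℂ‖ ^ 2 ≤ (‖w‖ * ‖ψ' + c • ψ‖) ^ 2 :=
        pow_le_pow_left₀ (norm_nonneg _) (norm_inner_le_norm _ _) 2
    _ = ‖w‖ ^ 2 * ‖ψ' + c • ψ‖ ^ 2 := mul_pow _ _ _
    _ ≤ s * ‖ψ' + c • ψ‖ ^ 2 := mul_le_mul_of_nonneg_right hws (sq_nonneg _)

end Krein

/-! ### The Friedrichs extension -/

theorem norm_sq_le_setIntegral {g : L2} {S : Set ℝ} (hS : MeasurableSet S) (hS0 : S ⊆ Ioi 0)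
    {b : ℝ → ℝ} (hb : IntegrableOn b S volume) (hin : ∀ᵐ x ∂halfLine, x ∈ S → ‖g x‖ ^ 2 ≤ b x)
    (hout : ∀ᵐ x ∂halfLine, x ∉ S → g x = 0) : ‖g‖ ^ 2 ≤ ∫ x in S, b x := by
  have e : ∫ x in S, b x = ∫ x in Ioi (0 : ℝ), S.indicator b x := by
    rw [setIntegral_indicator hS, inter_eq_right.2 hS0]
  rw [norm_sq_eq_integral, e]
  refine integral_mono_of_nonneg (ae_of_all _ fun x => sq_nonneg _)
    ((integrable_indicator_iff hS).2 hb).integrableOn ?_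
  filter_upwards [hin, hout] with x h1 h2
  by_cases hx : x ∈ S
  · rw [indicator_of_mem hx]
    exact h1 hx
  · rw [indicator_of_notMem hx, h2 hx]
    simp

theorem exists_norm_deriv_smoothTransition_le :
    ∃ C, 0 ≤ C ∧ (∀ t, |deriv Real.smoothTransition t| ≤ C) ∧
      ∀ t, t ∉ Icc (0 : ℝ) 1 → deriv Real.smoothTransition t = 0 := by
  have hz : ∀ t, t ∉ Icc (0 : ℝ) 1 → deriv Real.smoothTransition t = 0 := by
    intro t ht
    have key : ∃ c : ℝ, Real.smoothTransition =ᶠ[𝓝 t] fun _ => c := by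
      by_cases h0 : t < 0
      · refine ⟨0, ?_⟩
        filter_upwards [Iio_mem_nhds h0] with y hy
        exact Real.smoothTransition.zero_of_nonpos (le_of_lt hy)
      · refine ⟨1, ?_⟩
        have h1 : 1 < t := by
          by_contra hn
          exact ht ⟨not_lt.1 h0, not_lt.1 hn⟩
        filter_upwards [Ioi_mem_nhds h1] with y hy
        exact Real.smoothTransition.one_of_one_le (le_of_lt hy)
    obtain ⟨c, hc⟩ := key
    rw [hc.deriv_eq, deriv_const]
  have hcont : Continuous (deriv Real.smoothTransition) :=
    (Real.smoothTransition.contDiff (n := 1)).continuous_deriv le_rfl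
  obtain ⟨C, hC⟩ := isCompact_Icc.exists_bound_of_continuousOn (s := Icc (0 : ℝ) 1) hcont.continuousOn
  refine ⟨|C|, abs_nonneg _, fun t => ?_, hz⟩
  by_cases ht : t ∈ Icc (0 : ℝ) 1
  · exact (hC t ht).trans (le_abs_self C)
  · rw [hz t ht, abs_zero]
    exact abs_nonneg _

/-- A logarithmic cutoff, rising from `0` at `e^(-2N)` to `1` at `e^(-N)`. -/
def logCut (N x : ℝ) : ℝ := Real.smoothTransition (2 + Real.log x / N)

section LogCut

variable {N x : ℝ}

theorem logCut_eq_zero (hN : 0 < N) (hx : 0 < x) (h : x ≤ Real.exp (-2 * N)) : logCut N x = 0 := by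
  refine Real.smoothTransition.zero_of_nonpos ?_
  have h1 : Real.log x ≤ -2 * N := (Real.log_le_iff_le_exp hx).2 h
  have h2 : Real.log x / N ≤ -2 := (div_le_iff₀ hN).2 h1
  linarith

theorem logCut_eq_one (hN : 0 < N) (h : Real.exp (-N) ≤ x) : logCut N x = 1 := by
  refine Real.smoothTransition.one_of_one_le ?_
  have hx : 0 < x := (Real.exp_pos _).trans_le h
  have h1 : -N ≤ Real.log x := (Real.le_log_iff_exp_le hx).2 h
  have h2 : -1 ≤ Real.log x / N := (le_div_iff₀ hN).2 (by linarith)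
  linarith

theorem abs_logCut_sub_one_le : |logCut N x - 1| ≤ 1 := by
  have h1 := Real.smoothTransition.nonneg (2 + Real.log x / N)
  have h2 := Real.smoothTransition.le_one (2 + Real.log x / N)
  rw [logCut, abs_le]
  constructor <;> linarith

theorem contDiffOn_logCut : ContDiffOn ℝ ∞ (logCut N) (Ioi 0) := by
  refine Real.smoothTransition.contDiff.comp_contDiffOn (contDiffOn_const.add ?_)
  exact ContDiffOn.div_const (Real.contDiffOn_log.mono fun x hx => ne_of_gt hx) N

theorem hasDerivAt_logCut (hx : 0 < x) :
    HasDerivAt (logCut N) (deriv Real.smoothTransition (2 + Real.log x / N) * (x⁻¹ / N)) x := by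
  have h1 : HasDerivAt (fun x => 2 + Real.log x / N) (x⁻¹ / N) x :=
    ((Real.hasDerivAt_log hx.ne').div_const N).const_add 2
  have h2 := (Real.smoothTransition.contDiff (n := 1)).differentiable (by simp)
    (2 + Real.log x / N)
  exact h2.hasDerivAt.comp x h1

end LogCut

/-! ### Approximation of x^(1/2+m) ξ by test functions in the form norm. -/

section Friedrichs

variable {ξ : ℝ → ℝ} {m : ℝ}

/-- The product of the cutoff with a logarithmic cutoff, as a test function. -/
def cutTest (ξ : ℝ → ℝ) (N : ℝ) : ℝ → ℂ := (Ioi 0).indicator fun x => ((logCut N x * ξ x : ℝ) : ℂ)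

theorem cutTest_apply (ξ : ℝ → ℝ) (N : ℝ) {x : ℝ} (hx : 0 < x) :
    cutTest ξ N x = ((logCut N x * ξ x : ℝ) : ℂ) := indicator_of_mem (s := Ioi 0) hx _

theorem isTest_cutTest (hξ : IsCutoff ξ) {N : ℝ} (hN : 0 < N) : IsTest (cutTest ξ N) := by
  obtain ⟨δ, R, hδ, hR, b1, b2⟩ := hξ.exists_bounds
  refine isTest_of_contDiffOn (Real.exp_pos (-2 * N)) (b := R) ?_ fun x hx => ?_
  · refine ContDiffOn.congr (Complex.ofRealCLM.contDiff.comp_contDiffOn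
      (contDiffOn_logCut.mul hξ.smooth.contDiffOn)) fun x hx => cutTest_apply ξ N hx
  · by_cases hx0 : 0 < x
    · rw [cutTest_apply ξ N hx0]
      by_cases h1 : x < Real.exp (-2 * N)
      · rw [logCut_eq_zero hN hx0 h1.le]
        simp
      · have : R < x := by
          by_contra hn
          exact hx ⟨not_lt.1 h1, not_lt.1 hn⟩
        rw [b2 x this]
        simp
    · exact indicator_of_notMem (s := Ioi 0) hx0 _

theorem deriv_cutTest (hξ : IsCutoff ξ) {N x : ℝ} (hx : 0 < x) :
    deriv (cutTest ξ N) x = ((deriv Real.smoothTransition (2 + Real.log x / N) * (x⁻¹ / N) * ξ x +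
      logCut N x * deriv ξ x : ℝ) : ℂ) := by
  have d := ((hasDerivAt_logCut (N := N) hx).mul
    ((hξ.smooth.differentiable (by simp)) x).hasDerivAt).ofReal_comp
  exact (d.congr_of_eventuallyEq (f₁ := cutTest ξ N) (by
    filter_upwards [Ioi_mem_nhds hx] with y hy
    exact cutTest_apply ξ N hy)).deriv

theorem rpow_sq_le (hm : 0 ≤ m) {x : ℝ} (hx : 0 < x) (hx1 : x ≤ 1) :
    (x ^ (1 / 2 + m)) ^ 2 ≤ x := by
  rw [← Real.rpow_natCast, ← Real.rpow_mul hx.le]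
  calc x ^ ((1 / 2 + m) * (2 : ℕ)) ≤ x ^ (1 : ℝ) :=
        Real.rpow_le_rpow_of_exponent_ge hx hx1 (by push_cast; linarith)
    _ = x := Real.rpow_one x

theorem norm_sub_cut_sq_le (hm : 0 ≤ m) {C : ℝ} (hC : ∀ x, |ξ x| ≤ C) {N : ℝ} (hN : 0 < N)
    {p q : L2} (hp : p =ᵐ[halfLine] fun x : ℝ => (x : ℂ) ^ (1 / 2 + (m : ℂ)) * cutTest ξ N x)
    (hq : q =ᵐ[halfLine] fun x : ℝ => (x : ℂ) ^ (1 / 2 + (m : ℂ)) * (ξ x : ℂ)) :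
    ‖p - q‖ ^ 2 ≤ C ^ 2 * Real.exp (-N) := by
  have hexp : Real.exp (-N) ≤ 1 := Real.exp_le_one_iff.2 (by linarith)
  have hae : ∀ᵐ x ∂halfLine, ‖(p - q : L2) x‖ = x ^ (1 / 2 + m) * (|logCut N x - 1| * |ξ x|) := by
    filter_upwards [Lp.coeFn_sub p q, hp, hq, ae_restrict_mem measurableSet_Ioi] with x k1 k2 k3 hx
    rw [k1, Pi.sub_apply, k2, k3, cutTest_apply ξ N hx, ← mul_sub, norm_mul, norm_cpow_eq hx,
      ← Complex.ofReal_sub, Complex.norm_real, Real.norm_eq_abs, ← abs_mul]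
    congr 2
    ring
  have h := norm_sq_le_setIntegral (g := p - q) (S := Ioc 0 (Real.exp (-N))) measurableSet_Ioc
    Ioc_subset_Ioi_self (b := fun _ => C ^ 2) (integrableOn_const (by simp)) (by
      filter_upwards [hae] with x k hx
      rw [k, mul_pow, mul_pow]
      have h1 := (rpow_sq_le hm hx.1 (hx.2.trans hexp)).trans (hx.2.trans hexp)
      have h2 : |logCut N x - 1| ^ 2 ≤ 1 := pow_le_one₀ (abs_nonneg _) abs_logCut_sub_one_le
      have h3 : |ξ x| ^ 2 ≤ C ^ 2 := pow_le_pow_left₀ (abs_nonneg _) (hC x) 2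
      calc (x ^ (1 / 2 + m)) ^ 2 * (|logCut N x - 1| ^ 2 * |ξ x| ^ 2) ≤ 1 * (1 * C ^ 2) := by
            gcongr
        _ = C ^ 2 := by ring) (by
      filter_upwards [hae, ae_restrict_mem measurableSet_Ioi] with x k hx0 hx
      have : Real.exp (-N) ≤ x := by
        by_contra hn
        exact hx ⟨hx0, (not_le.1 hn).le⟩
      rw [← norm_eq_zero, k, logCut_eq_one hN this]
      simp)
  refine h.trans (le_of_eq ?_)
  rw [setIntegral_const, smul_eq_mul, measureReal_def, Real.volume_Ioc, sub_zero,
    ENNReal.toReal_ofReal (Real.exp_pos _).le, mul_comm]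

/-- The error is x^(1/2+m) ξ times the derivative of the logarithmic cutoff; its square is at most
(C'C)²/(N²x), and 1/x has integral N over [e^(-2N), e^(-N)]. The logarithmic scale is needed at m =
0, where a cutoff rescaled linearly only gives a bounded error. -/
theorem norm_sub_deriv_cut_sq_le (hξ : IsCutoff ξ) (hm : 0 ≤ m) {C C' : ℝ} (hC : ∀ x, |ξ x| ≤ C)
    (hC' : ∀ t, |deriv Real.smoothTransition t| ≤ C')
    (hz : ∀ t, t ∉ Icc (0 : ℝ) 1 → deriv Real.smoothTransition t = 0) {N : ℝ} (hN : 0 < N)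
    (hNξ : ∀ x, 0 < x → x < Real.exp (-N) → deriv ξ x = 0) {p q : L2}
    (hp : p =ᵐ[halfLine] fun x : ℝ => (x : ℂ) ^ (1 / 2 + (m : ℂ)) * deriv (cutTest ξ N) x)
    (hq : q =ᵐ[halfLine] fun x : ℝ => (x : ℂ) ^ (1 / 2 + (m : ℂ)) * ((deriv ξ x : ℝ) : ℂ)) :
    ‖p - q‖ ^ 2 ≤ (C' * C) ^ 2 / N := by
  have hexp : Real.exp (-N) ≤ 1 := Real.exp_le_one_iff.2 (by linarith)
  have hle : Real.exp (-2 * N) ≤ Real.exp (-N) := Real.exp_le_exp.2 (by linarith)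
  have hsub : Icc (Real.exp (-2 * N)) (Real.exp (-N)) ⊆ Ioi 0 :=
    fun x hx => (Real.exp_pos _).trans_le hx.1
  have hae : ∀ᵐ x ∂halfLine, ‖(p - q : L2) x‖ = x ^ (1 / 2 + m) *
      (|deriv Real.smoothTransition (2 + Real.log x / N)| * (x⁻¹ / N) * |ξ x|) := by
    filter_upwards [Lp.coeFn_sub p q, hp, hq, ae_restrict_mem measurableSet_Ioi] with x k1 k2 k3 hx
    have hx' : 0 < x := hx
    have e : (logCut N x - 1) * deriv ξ x = 0 := by
      by_cases h1 : x < Real.exp (-N)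
      · rw [hNξ x hx h1, mul_zero]
      · rw [logCut_eq_one hN (not_lt.1 h1), sub_self, zero_mul]
    rw [k1, Pi.sub_apply, k2, k3, deriv_cutTest hξ hx, ← mul_sub, norm_mul, norm_cpow_eq hx,
      ← Complex.ofReal_sub, Complex.norm_real, Real.norm_eq_abs,
      ← abs_of_pos (show 0 < x⁻¹ / N by positivity), ← abs_mul, ← abs_mul,
      abs_of_pos (show 0 < x⁻¹ / N by positivity)]
    congr 2
    linear_combination e
  have hb : ContinuousOn (fun x : ℝ => (C' * C) ^ 2 / N ^ 2 * x⁻¹)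
      (Icc (Real.exp (-2 * N)) (Real.exp (-N))) :=
    continuousOn_const.mul (continuousOn_inv₀.mono fun x hx => ne_of_gt (hsub hx))
  have h := norm_sq_le_setIntegral (g := p - q) measurableSet_Icc hsub hb.integrableOn_Icc (by
      filter_upwards [hae] with x k hx
      have hx0 : 0 < x := hsub hx
      rw [k, mul_pow, mul_pow, mul_pow, div_pow]
      have h1 := rpow_sq_le hm hx0 (hx.2.trans hexp)
      have h2 := pow_le_pow_left₀ (abs_nonneg _) (hC' (2 + Real.log x / N)) 2
      have h3 := pow_le_pow_left₀ (abs_nonneg _) (hC x) 2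
      calc (x ^ (1 / 2 + m)) ^ 2 * (|deriv Real.smoothTransition (2 + Real.log x / N)| ^ 2 *
            (x⁻¹ ^ 2 / N ^ 2) * |ξ x| ^ 2) ≤ x * (C' ^ 2 * (x⁻¹ ^ 2 / N ^ 2) * C ^ 2) := by
            gcongr
        _ = (C' * C) ^ 2 / N ^ 2 * x⁻¹ := by field_simp) (by
      filter_upwards [hae, ae_restrict_mem measurableSet_Ioi] with x k hx0 hx
      have ht : 2 + Real.log x / N ∉ Icc (0 : ℝ) 1 := by
        rintro ⟨t1, t2⟩
        have t3 : -2 ≤ Real.log x / N := by linarith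
        have t4 : Real.log x / N ≤ -1 := by linarith
        rw [le_div_iff₀ hN] at t3
        rw [div_le_iff₀ hN] at t4
        exact hx ⟨(Real.le_log_iff_exp_le hx0).1 t3,
          (Real.log_le_iff_le_exp hx0).1 (by linarith)⟩
      rw [← norm_eq_zero, k, hz _ ht]
      simp)
  refine h.trans (le_of_eq ?_)
  rw [integral_Icc_eq_integral_Ioc, ← intervalIntegral.integral_of_le hle,
    intervalIntegral.integral_const_mul, integral_inv_of_pos (Real.exp_pos _) (Real.exp_pos _),
    ← Real.exp_sub, Real.log_exp]
  field_simp
  ring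

/-- The form of L^min is ‖A u‖² on factored pairs, so a sequence converging in L² together with its
images under A is form-Cauchy. The truncations x^(1/2+m) `cutTest` have both properties for m ≥ 0.
-/
theorem cut_mem_formDomain (hξ : IsCutoff ξ) (hm : 0 ≤ m)
    (hn : IsNonnegOp (LMin ((m : ℂ) ^ 2))) {q : L2 × L2}
    (hq : IsCutPair ξ ((m : ℂ) ^ 2) (fun x : ℝ => (x : ℂ) ^ (1 / 2 + (m : ℂ))) q) :
    q.1 ∈ formDomain (LMin ((m : ℂ) ^ 2)) := by
  obtain ⟨ψ, hψe, hψ⟩ := hq.isFactored hξ (by linarith)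
  obtain ⟨δ, R, hδ, hR, b1, b2⟩ := hξ.exists_bounds
  obtain ⟨C, hC⟩ := hξ.compact.exists_bound_of_continuous hξ.smooth.continuous
  obtain ⟨C', -, hC', hz⟩ := exists_norm_deriv_smoothTransition_le
  have hpos : ∀ n : ℕ, (0 : ℝ) < (n : ℝ) + 1 := fun n => by positivity
  have ht : ∀ n : ℕ, IsTest (cutTest ξ ((n : ℝ) + 1)) := fun n => isTest_cutTest hξ (hpos n)
  choose p hp hfac hp2 hp1 using fun n : ℕ => exists_isFactored_cpow (ht n) m
    ((ht n).deriv.cpow_mul m).memLp.coeFn_toLp ((ht n).deriv.raise m).memLp.coeFn_toLp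
  set Ψ : ℕ → L2 := fun n => ((ht n).deriv.cpow_mul m).memLp.toLp _ with hΨ
  have hlim : Tendsto (fun n : ℕ => (n : ℝ) + 1) atTop atTop :=
    tendsto_atTop_add_const_right _ _ tendsto_natCast_atTop_atTop
  have hexp : Tendsto (fun n : ℕ => Real.exp (-((n : ℝ) + 1))) atTop (𝓝 0) :=
    Real.tendsto_exp_neg_atTop_nhds_zero.comp hlim
  have tsq : ∀ {u : ℕ → L2} {v : L2}, Tendsto (fun n => ‖u n - v‖ ^ 2) atTop (𝓝 0) →
      Tendsto u atTop (𝓝 v) := fun h => by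
    rw [tendsto_iff_norm_sub_tendsto_zero]
    simpa using h.sqrt
  have t1 : Tendsto (fun n => (p n).1) atTop (𝓝 q.1) := by
    refine tsq (squeeze_zero (fun n => sq_nonneg _)
      (fun n => norm_sub_cut_sq_le hm hC (hpos n) (hp1 n) hq.ae_eq) ?_)
    simpa using hexp.const_mul (C ^ 2)
  have t2 : Tendsto Ψ atTop (𝓝 ψ) := by
    refine tsq (squeeze_zero' (Eventually.of_forall fun n => sq_nonneg _) ?_
      (hlim.const_div_atTop ((C' * C) ^ 2)))
    -- Once e^(-N) < δ/2, the cutoff `ξ` is constant where the logarithmic cutoff varies, so no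
    -- cross term with ξ' appears.
    filter_upwards [hexp.eventually (gt_mem_nhds (half_pos hδ))] with n hn
    refine norm_sub_deriv_cut_sq_le hξ hm hC hC' hz (hpos n) (fun x hx hx' => ?_)
      ((ht n).deriv.cpow_mul m).memLp.coeFn_toLp hψe
    exact (IsCutoff.cutImage_eq_zero b1 b2 hx fun h => by linarith [h.1]).1
  have hpm : ∀ n, p n ∈ (LMin ((m : ℂ) ^ 2)).graph := fun n => by
    rw [graph_LMin]
    exact Submodule.le_topologicalClosure _ (hp n)
  choose u hu1 hu2 using fun n => (LinearPMap.mem_graph_iff _).1 (hpm n)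
  refine hn.mem_formDomain (u := u) (by simpa only [hu1] using t1) ?_
  have e : ∀ v : ℕ × ℕ, quadForm (LMin ((m : ℂ) ^ 2)) (u v.1 - u v.2) = ‖Ψ v.1 - Ψ v.2‖ ^ 2 := by
    intro v
    rw [quadForm, LinearPMap.map_sub, Submodule.coe_sub, hu1, hu1, hu2, hu2, ← Prod.fst_sub,
      ← Prod.snd_sub, ((hfac v.1).sub (hfac v.2)).inner_eq, norm_sq_eq_re_inner (𝕜 := ℂ)]
  simp only [e]
  rw [← prod_atTop_atTop_eq]
  have := ((t2.comp tendsto_fst).sub (t2.comp tendsto_snd)).norm.pow 2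
  simpa using this

end Friedrichs

/-- The domain of H_m is that of L^min plus one line, and both lie in the form domain.
Self-adjointness then leaves no room for a larger restriction of the adjoint. -/
theorem isFriedrichsExtension_H {ξ : ℝ → ℝ} (hξ : IsCutoff ξ) {m : ℝ} (hm : 0 ≤ m) (h2 : m < 1) :
    IsFriedrichsExtension (LMin ((m : ℂ) ^ 2)) (H ξ (m : ℂ)) := by
  have hhalf : (1 / 2 : ℂ).re = 1 / 2 := by norm_num
  have hL : MemLp (fun x : ℝ => (x : ℂ) ^ (1 / 2 + (m : ℂ))) 2 (volume.restrict (Ioc 0 1)) :=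
    memLp_cpow (by rw [Complex.add_re, hhalf, Complex.ofReal_re]; linarith)
  obtain ⟨q, hq, -⟩ := exists_isCutPair hξ (isHom_cpow (m : ℂ)) hL
  have hle := LMin_le_H ξ (m : ℂ)
  have hn := (isNonnegOp_H hξ (by linarith) h2).of_le hle (dense_domain_LMin _)
  refine isFriedrichsExtension_of_subset hn (isSelfAdjoint_H hξ (by linarith) h2) hle fun f hf => ?_
  obtain ⟨c, hc⟩ := (mem_graph_H_iff_exists hq).1 ((H ξ (m : ℂ)).mem_graph ⟨f, hf⟩)
  obtain ⟨u, hu, -⟩ := (LinearPMap.mem_graph_iff _).1 hc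
  have hu' : (u : L2) = f - c • q.1 := hu
  have := hn.add_mem_formDomain (coe_mem_formDomain u)
    (hn.smul_mem_formDomain c (cut_mem_formDomain hξ hm hn hq))
  rwa [hu', sub_add_cancel] at this

theorem isKreinExtension_H {ξ : ℝ → ℝ} (hξ : IsCutoff ξ) {m : ℝ} (h1 : -1 < m) (hm : m ≤ 0) :
    IsKreinExtension (LMin ((m : ℂ) ^ 2)) (H ξ (m : ℂ)) := by
  have hle := LMin_le_H ξ (m : ℂ)
  have hn := isNonnegOp_H hξ h1 (by linarith)
  exact ⟨hn.of_le hle (dense_domain_LMin _), isSelfAdjoint_H hξ h1 (by linarith), hn, hle,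
    fun S _ hS hS' => formLE_H hξ h1 hm hS hS'⟩

end InverseSquare

end

/-! ### Assembly of the five statements. -/

theorem mainTheorem4 (ξ : ℝ → ℝ) (hξ : InverseSquare.IsCutoff ξ) :
    (∀ α : ℝ, 1 ≤ α →
      InverseSquare.LMin (α : ℂ) = InverseSquare.H ξ ((√α : ℝ) : ℂ) ∧
      InverseSquare.IsEssentiallySelfAdjoint (InverseSquare.LTest (α : ℂ))) ∧
    (∀ α : ℝ, α < 1 →
      InverseSquare.IsHermitianOp (InverseSquare.LMin (α : ℂ)) ∧
      ¬ InverseSquare.IsEssentiallySelfAdjoint (InverseSquare.LTest (α : ℂ)) ∧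
      InverseSquare.deficiencyIndices (InverseSquare.LMin (α : ℂ)) = (1, 1)) ∧
    (∀ α : ℝ, 0 ≤ α → α < 1 →
      InverseSquare.IsFriedrichsExtension (InverseSquare.LMin (α : ℂ))
        (InverseSquare.H ξ ((√α : ℝ) : ℂ)) ∧
      InverseSquare.IsKreinExtension (InverseSquare.LMin (α : ℂ))
        (InverseSquare.H ξ ((-√α : ℝ) : ℂ))) ∧
    (InverseSquare.H ξ (1 / 2) = InverseSquare.dirichletLaplacian ∧
      InverseSquare.H ξ (-1 / 2) = InverseSquare.neumannLaplacian) ∧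
    (∀ α : ℝ, α < 0 →
      ¬ ∃ (B : InverseSquare.L2 →ₗ.[ℂ] InverseSquare.L2) (ν : ℝ),
        InverseSquare.LMin (α : ℂ) ≤ B ∧ IsSelfAdjoint B ∧
          InverseSquare.IsHomogeneous ν B) := by
  refine ⟨fun α hα => InverseSquare.LMin_eq_H_of_one_le hξ hα,
    fun α hα => ⟨InverseSquare.isHermitianOp_LMin α, InverseSquare.deficiency_LMin hξ hα⟩,
    fun α h0 h1 => ?_,
    ⟨InverseSquare.H_half_eq hξ, InverseSquare.H_neg_half_eq hξ⟩,
    fun α hα => InverseSquare.not_exists_homogeneous hξ hα⟩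
  have hs : √α < 1 := (Real.sqrt_lt' one_pos).2 (by simpa using h1)
  have hs0 := Real.sqrt_nonneg α
  have e1 : ((√α : ℝ) : ℂ) ^ 2 = α := by rw [← Complex.ofReal_pow, Real.sq_sqrt h0]
  have e2 : ((-√α : ℝ) : ℂ) ^ 2 = α := by rw [← Complex.ofReal_pow, neg_sq, Real.sq_sqrt h0]
  have hF := InverseSquare.isFriedrichsExtension_H hξ hs0 hs
  have hK := InverseSquare.isKreinExtension_H hξ (m := -√α) (by linarith) (by linarith)
  rw [e1] at hF
  rw [e2] at hK
  exact ⟨hF, hK⟩
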